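/- For a partition $\alpha=(\alpha_1\ge\cdots\ge\alpha_m)$ of $n\ge 1$ with $m=l(\alpha)$ parts, let $\mathcal C_\alpha\subset\mathfrak S_n$ be the conjugacy class of permutations of cycle type $\alpha$, and for $g\ge 0$ let $c_g(\alpha)$ be the number of tuples $(\sigma_1,\ldots,\sigma_j)$ of transpositions in $\mathfrak S_n$, with $j=n+m+2g-2$, which generate $\mathfrak S_n$ and satisfy $\sigma_1\cdots\sigma_j=\pi$ for a fixed $\pi\in\mathcal C_\alpha$. Let $$\Phi(u,z,\mathbf p)=\sum_{n,m\ge1,\;g\ge0}\ \sum_{\alpha\vdash n,\;l(\alpha)=m}\frac{|\mathcal C_\alpha|}{n!}\,c_g(\alpha)\,\frac{u^{n+m+2(g-1)}}{(n+m+2(g-1))!}\,z^g\,p_{\alpha_1}\cdots p_{\alpha_m},$$ and for $m\ge 0$ let $\Psi_m^{(g)}(x_1,\ldots,x_m)\in\mathbb Q[[x_1,\ldots,x_m]]$ be the series obtained from the coefficient of $z^g$ in $\Phi$ by setting $u=1$, keeping only the terms with $l(\alpha)=m$, and replacing each $p_{\alpha_1}\cdots p_{\alpha_m}$ by $\sum_{\pi\in\mathfrak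 S_m}x_1^{\alpha_{\pi(1)}}\cdots x_m^{\alpha_{\pi(m)}}$. In particular $\Psi_0^{(g)}=0$. Let $w_i=w_i(x_i)$ be the unique power series in $x_i$ with $w_i=x_ie^{w_i}$, and let $\partial/\partial w_i=(\partial w_i/\partial x_i)^{-1}\,\partial/\partial x_i$. For $f$ in the field of fractions of $\mathbb Q[[x_1,\ldots,x_m]]$ and $0\le i\le m-1$ put $$\Theta_i f(x_1,\ldots,x_m)=\sum_{(\mathcal R,\mathcal S,\mathcal T)}f(x_{r_1},x_{s_1},\ldots,x_{s_i},x_{t_1},\ldots,x_{t_{m-i-1}}),$$ the sum being over all ordered partitions $(\mathcal R,\mathcal S,\mathcal T)$ of $\{1,\ldots,m\}$ with $\mathcal R=\{r_1\}$, $\mathcal S=\{s_1<\cdots<s_i\}$, $\mathcal T=\{t_1<\cdots<t_{m-i-1}\}$; for $i>m-1$ the sum is empty. **Theorem.** For all $g,m\ge1$, $$\left(w_1\frac{\partial}{\partial w_1}+\cdots+w_m\frac{\partial}{\partial w_m}+m+2(g-1)\right)\Psi_m^{(g)}(x_1,\ldots,x_m)=T_1+T_2+T_3+T_4,$$ where $$T_1=\frac12\sum_{i=1}^m\left.\left(x_i\frac{\partial}{\partial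 x_i}\,x_{m+1}\frac{\partial}{\partial x_{m+1}}\Psi_{m+1}^{(g-1)}(x_1,\ldots,x_{m+1})\right)\right|_{x_{m+1}=x_i},$$ $$T_2=\Theta_1\left[\frac{w_2}{1-w_1}\,\frac{1}{w_1-w_2}\;x_1\frac{\partial}{\partial x_1}\Psi_{m-1}^{(g)}(x_1,x_3,\ldots,x_m)\right]\quad(\text{so } T_2=0 \text{ for } m=1),$$ $$T_3=\sum_{k=3}^m\Theta_{k-1}\left[\left(x_1\frac{\partial}{\partial x_1}\Psi_k^{(0)}(x_1,\ldots,x_k)\right)\left(x_1\frac{\partial}{\partial x_1}\Psi_{m-k+1}^{(g)}(x_1,x_{k+1},\ldots,x_m)\right)\right],$$ $$T_4=\frac12\sum_{\substack{1\le k\le m\\1\le a\le g-1}}\Theta_{k-1}\left[\left(x_1\frac{\partial}{\partial x_1}\Psi_k^{(a)}(x_1,\ldots,x_k)\right)\left(x_1\frac{\partial}{\partial x_1}\Psi_{m-k+1}^{(g-a)}(x_1,x_{k+1},\ldots,x_m)\right)\right],$$ with $\Psi_0^{(g)}=0$ for $g\ge1$ and the initial condition, for all $m\ge1$, $$\Psi_m^{(0)}(x_1,\ldots,x_m)=\left(x_1\frac{\partial}{\partial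 x_1}+\cdots+x_m\frac{\partial}{\partial x_m}\right)^{m-3}\prod_{i=1}^m\frac{w_i}{1-w_i}.$$ For $m=1,2$ the negative power denotes the inverse on power series without constant term; that is, $\Psi_1^{(0)}$ and $\Psi_2^{(0)}$ have no constant term and satisfy $\left(x_1\frac{\partial}{\partial x_1}\right)^2\Psi_1^{(0)}=\frac{w_1}{1-w_1}$ and $\left(x_1\frac{\partial}{\partial x_1}+x_2\frac{\partial}{\partial x_2}\right)\Psi_2^{(0)}=\frac{w_1}{1-w_1}\,\frac{w_2}{1-w_2}$. -/

import Mathlib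

noncomputable section

namespace Hurwitz

/-! ### Ordered transitive factorizations into transpositions -/

/-- The conjugacy class `C_α` of the symmetric group on `n` symbols indexed by `α ⊢ n`. -/
def conjClass {n : ℕ} (α : n.Partition) : Set (Equiv.Perm (Fin n)) :=
  {π | π.partition.parts = α.parts}

theorem conjClass_nonempty {n : ℕ} (α : n.Partition) : (conjClass α).Nonempty := by
  have hle : (α.parts.filter (fun k => 2 ≤ k)).sum ≤ n := by
    have h := congrArg Multiset.sum (Multiset.filter_add_not (fun k => 2 ≤ k) α.parts)
    rw [Multiset.sum_add, α.parts_sum] at h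
    omega
  obtain ⟨π, hπ⟩ := (Equiv.Perm.exists_with_cycleType_iff (α := Fin n)
    (m := α.parts.filter (fun k => 2 ≤ k))).2 ⟨by simpa using hle, fun a ha => by
      simpa using (Multiset.mem_filter.1 ha).2⟩
  refine ⟨π, ?_⟩
  have hone : α.parts.filter (fun k => ¬ 2 ≤ k) =
      Multiset.replicate (Multiset.card (α.parts.filter (fun k => ¬ 2 ≤ k))) 1 := by
    rw [Multiset.eq_replicate_card]
    intro b hb
    have h1 := α.parts_pos (Multiset.mem_filter.1 hb).1
    have h2 := (Multiset.mem_filter.1 hb).2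
    omega
  have hsplit := Multiset.filter_add_not (fun k => 2 ≤ k) α.parts
  have hsum : (α.parts.filter (fun k => 2 ≤ k)).sum +
      Multiset.card (α.parts.filter (fun k => ¬ 2 ≤ k)) = n := by
    have h := congrArg Multiset.sum hsplit
    rw [Multiset.sum_add, α.parts_sum] at h
    rw [hone] at h
    simpa using h
  change π.partition.parts = α.parts
  rw [Equiv.Perm.parts_partition, ← Equiv.Perm.sum_cycleType, hπ]
  conv_rhs => rw [← hsplit, hone]
  congr 2
  simp only [Fintype.card_fin]
  omega

/-- The set of `j`-tuples of transpositions of `{1, …, n}` whose product is `π` and which generate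
the whole symmetric group. -/
def transitiveFactorizations {n : ℕ} (j : ℕ) (π : Equiv.Perm (Fin n)) :
    Set (Fin j → Equiv.Perm (Fin n)) :=
  {σ | π = (List.ofFn σ).prod ∧ (∀ i, (σ i).IsSwap) ∧ Subgroup.closure (Set.range σ) = ⊤}

/-- The number `c_g(α)` of ordered transitive factorizations, into `j = n + l(α) - 2 + 2g`
transpositions, of a fixed element of `C_α`. (It is used for `n ≥ 1` only, when also `l(α) ≥ 1`,
so that the subtraction does not truncate.) -/
def transFactCount (g : ℕ) {n : ℕ} (α : n.Partition) : ℕ :=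
  (transitiveFactorizations (n + Multiset.card α.parts + 2 * g - 2)
    (conjClass_nonempty α).some).ncard

/-- The coefficient of `z ^ g * p_α` in the generating series
`Φ(u, z, p) = ∑_{n, m ≥ 1, g ≥ 0} ∑_{α ⊢ n, l(α) = m}
  (|C_α| / n!) c_g(α) (u ^ (n + m + 2 (g - 1)) / (n + m + 2 (g - 1))!) z ^ g p_α`;
it is a polynomial in `u`. -/
def PhiCoeff (g : ℕ) {n : ℕ} (α : n.Partition) : Polynomial ℚ :=
  if n = 0 then 0 else
    Polynomial.C (((conjClass α).ncard : ℚ) / (n.factorial : ℚ) * (transFactCount g α : ℚ) /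
      ((n + Multiset.card α.parts + 2 * g - 2).factorial : ℚ)) *
    Polynomial.X ^ (n + Multiset.card α.parts + 2 * g - 2)

/-! ### Symmetrization -/

/-- The symmetrization `Ξ^{1, …, m}` of the monomial `p_α`: it is `∑_{π ∈ S_m} x ^ π(α)` if `α` has
`m` parts, and `0` otherwise. The parts are listed as `α_1 ≥ α_2 ≥ ⋯`. -/
def Xi (m : ℕ) {n : ℕ} (α : n.Partition) : MvPowerSeries (Fin m) ℚ :=
  if Multiset.card α.parts = m then
    ∑ π : Equiv.Perm (Fin m), MvPowerSeries.monomial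
      (Finsupp.equivFunOnFinite.symm
        (fun i : Fin m => (α.parts.sort (· ≥ ·)).getD (π i : ℕ) 0)) (1 : ℚ)
  else 0

/-- The series `Ψ_m^{(g)} = [z ^ g] Ξ^{1, …, m} Φ(u, z, p)` at `u = 1`, in `m` variables. As `Ξ p_α`
is homogeneous of degree `n` for `α ⊢ n`, only the partitions of `n = |β|` contribute to the
coefficient of `x ^ β`. -/
def Psi (g m : ℕ) : MvPowerSeries (Fin m) ℚ := fun β =>
  ∑ α : (Finsupp.degree β).Partition,
    (PhiCoeff g α).eval 1 * MvPowerSeries.coeff β (Xi m α)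

/-! ### Series in the variables `x_1, x_2, …` -/

/-- Formal power series over `ℚ` in `x_i = MvPowerSeries.X i`, `i : ℕ` (only the `x_i` with `i ≥ 1`
are used). -/
abbrev Series : Type := MvPowerSeries ℕ ℚ

/-- The field of fractions of the ring of formal power series. -/
abbrev SeriesField : Type := FractionRing Series

/-- The inclusion of the power series into their field of fractions. -/
abbrev toField : Series →+* SeriesField := algebraMap Series SeriesField

/-- `Ψ_m^{(g)}(x_{v 0}, …, x_{v (m - 1)})`. -/
def PsiAt (g m : ℕ) (v : Fin m → ℕ) : Series := MvPowerSeries.rename v (Psi g m)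

/-- `Ψ_m^{(g)}(x_1, x_{k + 1}, x_{k + 2}, …, x_{k + m - 1})`. For `k = 1` it is
`Ψ_m^{(g)}(x_1, …, x_m)`. -/
def PsiSkip (g m k : ℕ) : Series :=
  PsiAt g m (fun j => if (j : ℕ) = 0 then 1 else k + (j : ℕ))

/-- `Ψ_m^{(g)}(x_1, …, x_m)`. -/
def PsiStd (g m : ℕ) : Series := PsiAt g m (fun j => (j : ℕ) + 1)

/-- The operator `x_i ∂/∂x_i`. -/
def xD (i : ℕ) (F : Series) : Series := MvPowerSeries.X i * MvPowerSeries.pderiv ℚ i F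

/-- The operator `x_1 ∂/∂x_1 + ⋯ + x_m ∂/∂x_m`. -/
def euler (m : ℕ) (F : Series) : Series := ∑ i ∈ Finset.Icc 1 m, xD i F

/-- The map of indices behind the substitution `x_a ↦ x_b`. -/
def mergeIdx (a b : ℕ) : ℕ → ℕ := fun j => if j = a then b else j

instance mergeIdx_tendstoCofinite (a b : ℕ) : Filter.TendstoCofinite (mergeIdx a b) := by
  rw [Filter.tendstoCofinite_iff_finite_preimage_singleton]
  intro c
  refine Set.Finite.subset (Set.toFinite {a, c}) ?_
  intro j hj
  simp only [Set.mem_preimage, Set.mem_singleton_iff, mergeIdx] at hj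
  simp only [Set.mem_insert_iff, Set.mem_singleton_iff]
  split_ifs at hj with h
  · exact Or.inl h
  · exact Or.inr hj

/-- The substitution `F ↦ F |_{x_a = x_b}`. -/
def setEq (a b : ℕ) (F : Series) : Series := MvPowerSeries.rename (mergeIdx a b) F

/-! ### The variables `w_i` -/

/-- The series `x * e ^ (-x)`. -/
def xExpNeg : PowerSeries ℚ := PowerSeries.X * PowerSeries.evalNegHom (PowerSeries.exp ℚ)

theorem constantCoeff_xExpNeg : PowerSeries.constantCoeff xExpNeg = 0 := by
  simp [xExpNeg]

theorem isUnit_coeff_one_xExpNeg : IsUnit (PowerSeries.coeff 1 xExpNeg) := by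
  have h : PowerSeries.coeff 1 xExpNeg = 1 := by
    rw [xExpNeg, PowerSeries.coeff_succ_X_mul]
    simp [PowerSeries.evalNegHom]
  rw [h]
  exact isUnit_one

/-- The compositional inverse `w(x)` of `x * e ^ (-x)`: the power series with `w = x * e ^ w`. -/
def treeSeries : PowerSeries ℚ :=
  PowerSeries.substInvOfIsUnit xExpNeg isUnit_coeff_one_xExpNeg

/-- `treeSeries` is the unique solution `w` of `w = x * e ^ w` (the condition on the constant
coefficient says that the composition `e ^ w` makes sense). -/
theorem eq_treeSeries_iff (w : PowerSeries ℚ) :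
    w = treeSeries ↔ PowerSeries.constantCoeff w = 0 ∧
      w = PowerSeries.X * (PowerSeries.exp ℚ).subst w := by
  have hexp : ∀ v : PowerSeries ℚ, PowerSeries.constantCoeff v = 0 →
      (xExpNeg.subst v = PowerSeries.X ↔ v = PowerSeries.X * (PowerSeries.exp ℚ).subst v) := by
    intro v hv
    have hs : PowerSeries.HasSubst v := PowerSeries.HasSubst.of_constantCoeff_zero' hv
    have h1 : (PowerSeries.exp ℚ).subst v *
        (PowerSeries.evalNegHom (PowerSeries.exp ℚ)).subst v = (1 : PowerSeries ℚ) := by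
      rw [← PowerSeries.subst_mul hs, PowerSeries.exp_mul_exp_neg_eq_one,
        ← PowerSeries.coe_substAlgHom hs, map_one]
    have h2 : xExpNeg.subst v =
        v * (PowerSeries.evalNegHom (PowerSeries.exp ℚ)).subst v := by
      rw [xExpNeg, PowerSeries.subst_mul hs, PowerSeries.subst_X hs]
    rw [h2]
    constructor
    · intro h
      rw [← h, mul_assoc, mul_comm _ ((PowerSeries.exp ℚ).subst v), h1, mul_one]
    · intro h
      calc _ = PowerSeries.X * (PowerSeries.exp ℚ).subst v *
            (PowerSeries.evalNegHom (PowerSeries.exp ℚ)).subst v := by rw [← h]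
        _ = _ := by rw [mul_assoc, h1, mul_one]
  constructor
  · rintro rfl
    have h0 : PowerSeries.constantCoeff treeSeries = 0 :=
      PowerSeries.constantCoeff_substInvOfIsUnit _ _
    exact ⟨h0, (hexp _ h0).1
      (PowerSeries.subst_substInvOfIsUnit_right _ constantCoeff_xExpNeg _)⟩
  · rintro ⟨h0, h⟩
    have hs : PowerSeries.HasSubst w := PowerSeries.HasSubst.of_constantCoeff_zero' h0
    have hP : PowerSeries.HasSubst xExpNeg :=
      PowerSeries.HasSubst.of_constantCoeff_zero' constantCoeff_xExpNeg
    have h3 := (hexp w h0).2 h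
    have h4 : treeSeries.subst xExpNeg = (PowerSeries.X : PowerSeries ℚ) :=
      PowerSeries.subst_substInvOfIsUnit_left _ constantCoeff_xExpNeg _
    have h5 := PowerSeries.subst_comp_subst_apply hP hs treeSeries
    rw [h4, h3, PowerSeries.subst_X hs] at h5
    rw [h5]
    exact (PowerSeries.map_algebraMap_eq_subst_X treeSeries).symm.trans (by simp)

/-- The series `w_i = w_i(x_i)` with `w_i = x_i * e ^ w_i`. -/
def w (i : ℕ) : Series := treeSeries.subst (MvPowerSeries.X i : Series)

/-- The derivation `∂/∂w_i` in the coordinates `w_1, w_2, …`: as `w_i` depends on `x_i` only, it is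
`(∂w_i/∂x_i)⁻¹ ∂/∂x_i` (the constant term of `∂w_i/∂x_i` is `1`). -/
def wDeriv (i : ℕ) (F : Series) : Series :=
  (MvPowerSeries.pderiv ℚ i (w i))⁻¹ * MvPowerSeries.pderiv ℚ i F

/-- The series `V_m = ∏_{i = 1}^m w_i / (1 - w_i)`. -/
def V (m : ℕ) : Series := ∏ i ∈ Finset.Icc 1 m, w i * (1 - w i)⁻¹

/-! ### The operators `Θ_i` -/

/-- The automorphism `x_j ↦ x_{σ j}` of the field of fractions. -/
def permute (σ : Equiv.Perm ℕ) : SeriesField ≃+* SeriesField :=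
  IsFractionRing.ringEquivOfRingEquiv (MvPowerSeries.renameEquiv ℚ σ).toRingEquiv

open Classical in
/-- The permutations `σ` of `{1, …, m}` that are increasing on `{2, …, i + 1}` and on
`{i + 2, …, m}`. For `i ≤ m - 1` they correspond to the ordered partitions `(R, S, T)` of
`{1, …, m}` with `|R| = 1`, `|S| = i`, `|T| = m - i - 1`, through `R = {σ 1}`,
`S = {σ 2 < ⋯ < σ (i + 1)}` and `T = {σ (i + 2) < ⋯ < σ m}`. There are none for `i > m - 1`. -/
def splittings (m i : ℕ) : Finset (Equiv.Perm (Finset.Icc 1 m)) :=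
  Finset.univ.filter fun σ => i + 1 ≤ m ∧
    StrictMonoOn (Equiv.Perm.ofSubtype σ) (Set.Icc 2 (i + 1)) ∧
    StrictMonoOn (Equiv.Perm.ofSubtype σ) (Set.Icc (i + 2) m)

/-- `Θ_i f(x_1, …, x_m) = ∑_{(R, S, T)} f(x_R, x_S, x_T)`. -/
def Theta (m i : ℕ) (f : SeriesField) : SeriesField :=
  ∑ σ ∈ splittings m i, permute (Equiv.Perm.ofSubtype σ) f

/-! ### The four terms of the equation -/

/-- `½ ∑_{i = 1}^m (x_i ∂/∂x_i x_{m+1} ∂/∂x_{m+1} Ψ_{m+1}^{(g-1)}(x_1, …, x_{m+1}))|_{x_{m+1} = x_i}`,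
for `g ≥ 1`. -/
def T₁ (g m : ℕ) : Series :=
  (1 / 2 : ℚ) • ∑ i ∈ Finset.Icc 1 m,
    setEq (m + 1) i (xD i (xD (m + 1) (PsiStd (g - 1) (m + 1))))

/-- `Θ_1 (w_2 / (1 - w_1)) (1 / (w_1 - w_2)) x_1 ∂/∂x_1 Ψ_{m-1}^{(g)}(x_1, x_3, …, x_m)`,
which is `0` for `m = 1`. -/
def T₂ (g m : ℕ) : SeriesField :=
  Theta m 1 (toField (w 2) / (1 - toField (w 1)) * (1 / (toField (w 1) - toField (w 2))) *
    toField (xD 1 (PsiSkip g (m - 1) 2)))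

/-- `∑_{k = 3}^m Θ_{k-1} (x_1 ∂/∂x_1 Ψ_k^{(0)}(x_1, …, x_k))
  (x_1 ∂/∂x_1 Ψ_{m-k+1}^{(g)}(x_1, x_{k+1}, …, x_m))`. -/
def T₃ (g m : ℕ) : SeriesField :=
  ∑ k ∈ Finset.Icc 3 m, Theta m (k - 1)
    (toField (xD 1 (PsiStd 0 k)) * toField (xD 1 (PsiSkip g (m - k + 1) k)))

/-- `½ ∑_{1 ≤ k ≤ m, 1 ≤ a ≤ g-1} Θ_{k-1} (x_1 ∂/∂x_1 Ψ_k^{(a)}(x_1, …, x_k))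
  (x_1 ∂/∂x_1 Ψ_{m-k+1}^{(g-a)}(x_1, x_{k+1}, …, x_m))`. -/
def T₄ (g m : ℕ) : SeriesField :=
  (1 / 2) * ∑ k ∈ Finset.Icc 1 m, ∑ a ∈ Finset.Icc 1 (g - 1), Theta m (k - 1)
    (toField (xD 1 (PsiStd a k)) * toField (xD 1 (PsiSkip (g - a) (m - k + 1) k)))

end Hurwitz

end

/-! Remove the first transposition (a b) from a transitive factorization of π. The remaining factors
multiply to (a b)π, whose cycles arise from those of π by joining the cycles of a and b, if these
differ, or by cutting their common cycle in two. The remaining transpositions either still connect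
all points or split them into exactly two orbits, one containing a and the other b; a splitting can
only follow a cut. Dividing the counts by j! and by the product of the cycle lengths (`hur`) absorbs
the shuffles of the two subfactorizations and the choices of points, and gives the recursion
`hur_succ`. By `le_and_even_of_hur_ne_zero` only j = n + m + 2g - 2 occurs, so the recursion is
graded by the genus (`hurG_recursion`). The orders of the stabilizers of the exponent vectors cancel
in the symmetrization, so the coefficients of Ψ are exactly these weighted counts (`coeff_psi`), and
the recursion becomes a differential equation with a join term, a cut term and product terms
(`psiS_cut_join`).

In genus zero the recursion determines the counts, so Hurwitz's formula follows once n^(m-3) ∏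
b^b/b! is shown to satisfy it (`genusZero_recursion`). The sums over subsets of parts are evaluated
by the Abel–Hurwitz identities (`sum_abelSet_mul_abelSet`). There remain sums over p + q = b; the
argument uses not closed forms of them but identities for their symmetrizations over two or three
parts. These come from `treeQuot_reciprocity`, which is read off from a closed form of the series
with coefficients k a_k a_N/(N + k), where a_b = b^b/b!; that closed form is proved by uniqueness of
the solution of a first-order linear differential equation (`kappa_mul`).

The stated equation comes from sorting the product terms that contain a genus zero factor. A factor
in one variable is x_r ∂Ψ/∂x_r = w_r; moved to the left, it turns x_r ∂/∂x_r into (1 - w_r) x_r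
∂/∂x_r = w_r ∂/∂w_r. A factor in two variables combines with the join kernel x_s/(x_r - x_s) into
the kernel of T₂ (`joinS_coefficient`). Genus zero factors in at least three variables give T₃, and
products of two factors of positive genus give T₄. The operators Θ become sums over an element and a
subset by `theta_eq_sum`. -/

noncomputable section

namespace Hurwitz

open Finset

/-! ### Abel–Hurwitz identities for sums over subsets -/

section AbelHurwitz

variable {ι : Type*} [DecidableEq ι]

/-- An iterated finite difference of order larger than the degree of a polynomial vanishes. -/
theorem sum_powerset_neg_one_pow_mul_eval (b : ι → ℚ) (M : Finset ι) :
    ∀ Q : Polynomial ℚ, Q.degree < (M.card : ℕ) → ∀ x : ℚ,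
      ∑ I ∈ M.powerset, (-1) ^ I.card * Q.eval (x + ∑ i ∈ I, b i) = 0 := by
  induction M using Finset.induction_on with
  | empty =>
    intro Q hQ x
    have : Q = 0 := by
      rw [← Polynomial.degree_eq_bot]
      simpa using hQ
    simp [this]
  | insert k M hk ih =>
    intro Q hQ x
    rw [Finset.sum_powerset_insert hk, ← Finset.sum_add_distrib]
    -- Pairing I with I ∪ {k} replaces Q by this difference, whose degree is smaller because the
    -- leading terms cancel.
    set Q' : Polynomial ℚ := Q - Q.comp (Polynomial.X + Polynomial.C (b k)) with hQ'
    have hdeg : Q'.degree < (M.card : ℕ) := by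
      by_cases h0 : Q = 0
      · simp [hQ', h0]
      have hlin : (Polynomial.X + Polynomial.C (b k)).natDegree = 1 :=
        Polynomial.natDegree_X_add_C _
      have hne : Q.comp (Polynomial.X + Polynomial.C (b k)) ≠ 0 := by
        intro h
        have := congrArg (fun R : Polynomial ℚ => R.comp (Polynomial.X - Polynomial.C (b k))) h
        simp [Polynomial.comp_assoc] at this
        exact h0 this
      have h1 : Q'.degree < Q.degree := by
        apply Polynomial.degree_sub_lt_left _ h0
        · rw [Polynomial.leadingCoeff_comp (by rw [hlin]; norm_num)]
          simp
        · rw [Polynomial.degree_eq_natDegree h0, Polynomial.degree_eq_natDegree hne,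
            Polynomial.natDegree_comp, hlin, mul_one]
      rw [Finset.card_insert_of_notMem hk] at hQ
      rw [Polynomial.degree_eq_natDegree h0] at h1 hQ
      have h2 : Q.natDegree ≤ M.card := by
        have : Q.natDegree < M.card + 1 := by exact_mod_cast hQ
        omega
      exact lt_of_lt_of_le h1 (by exact_mod_cast h2)
    rw [← ih Q' hdeg x]
    refine Finset.sum_congr rfl fun I hI => ?_
    have hkI : k ∉ I := fun h => hk (Finset.mem_powerset.1 hI h)
    rw [Finset.card_insert_of_notMem hkI, Finset.sum_insert hkI, hQ', Polynomial.eval_sub,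
      Polynomial.eval_comp]
    simp only [Polynomial.eval_add, Polynomial.eval_X, Polynomial.eval_C]
    rw [show x + (b k + ∑ i ∈ I, b i) = x + ∑ i ∈ I, b i + b k by ring]
    ring

/-- The Abel–Hurwitz set function `x (x + b_I) ^ (|I| - 1)`. -/
def abelSet (b : ι → ℚ) (x : ℚ) (I : Finset ι) : ℚ :=
  if I = ∅ then 1 else x * (x + ∑ i ∈ I, b i) ^ (I.card - 1)

theorem sum_powerset_sdiff_comm {β : Type*} [AddCommMonoid β] (M : Finset ι)
    (f : Finset ι → ι → β) :
    ∑ I ∈ M.powerset, ∑ j ∈ M \ I, f I j = ∑ j ∈ M, ∑ I ∈ (M.erase j).powerset, f I j := by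
  refine Finset.sum_comm' fun I j => ?_
  simp only [mem_powerset, mem_sdiff, subset_erase]
  tauto

/-- Hurwitz's generalization of Abel's binomial theorem. -/
theorem sum_abelSet_mul_pow (b : ι → ℚ) (x : ℚ) (M : Finset ι) : ∀ y : ℚ,
    ∑ I ∈ M.powerset, abelSet b x I * (y + ∑ i ∈ M \ I, b i) ^ (M \ I).card =
      (x + y + ∑ i ∈ M, b i) ^ M.card := by
  induction M using Finset.strongInduction with
  | H M ih =>
  rcases M.eq_empty_or_nonempty with rfl | hM
  · simp [abelSet]
  set P : Polynomial ℚ := ∑ I ∈ M.powerset, Polynomial.C (abelSet b x I) *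
    (Polynomial.X + Polynomial.C (∑ i ∈ M \ I, b i)) ^ (M \ I).card -
    (Polynomial.X + Polynomial.C (x + ∑ i ∈ M, b i)) ^ M.card with hP
  have heval : ∀ y, P.eval y = ∑ I ∈ M.powerset, abelSet b x I *
      (y + ∑ i ∈ M \ I, b i) ^ (M \ I).card - (y + (x + ∑ i ∈ M, b i)) ^ M.card := by
    intro y
    simp [hP, Polynomial.eval_finsetSum]
  -- Differentiating (y + b_{M∖I})^|M∖I| in y marks an element j of M∖I; for each fixed j the
  -- induction hypothesis applies to M∖{j} at y + b_j.
  have hder : P.derivative = 0 := by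
    refine Polynomial.funext fun y => ?_
    have h1 : P.derivative.eval y = ∑ I ∈ M.powerset, abelSet b x I *
        ((M \ I).card * (y + ∑ i ∈ M \ I, b i) ^ ((M \ I).card - 1)) -
        M.card * (y + (x + ∑ i ∈ M, b i)) ^ (M.card - 1) := by
      simp only [hP, Polynomial.derivative_sub, Polynomial.derivative_sum,
        Polynomial.derivative_C_mul, Polynomial.derivative_X_add_C_pow, Polynomial.eval_sub,
        Polynomial.eval_finsetSum, Polynomial.eval_mul, Polynomial.eval_pow, Polynomial.eval_add,
        Polynomial.eval_X, Polynomial.eval_C]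
    rw [h1, Polynomial.eval_zero, sub_eq_zero]
    have h2 : ∀ I ∈ M.powerset, abelSet b x I *
        ((M \ I).card * (y + ∑ i ∈ M \ I, b i) ^ ((M \ I).card - 1)) =
        ∑ j ∈ M \ I, abelSet b x I *
          (y + b j + ∑ i ∈ M.erase j \ I, b i) ^ (M.erase j \ I).card := by
      intro I _
      rw [← Finset.mul_sum]
      congr 1
      rw [← nsmul_eq_mul]
      symm
      refine Finset.sum_eq_card_nsmul fun j hj => ?_
      rw [Finset.erase_sdiff_comm, Finset.card_erase_of_mem hj, add_assoc,
        Finset.add_sum_erase _ _ hj]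
    rw [Finset.sum_congr rfl h2, sum_powerset_sdiff_comm, ← nsmul_eq_mul]
    refine Finset.sum_eq_card_nsmul fun j hj => ?_
    rw [ih _ (Finset.erase_ssubset hj), Finset.card_erase_of_mem hj,
      ← Finset.add_sum_erase _ _ hj]
    congr 1
    ring
  -- At y = -(x + b_M) one has y + b_{M∖I} = -(x + b_I), so the sum is, up to a factor, the |M|-th
  -- finite difference of a polynomial of degree |M| - 1.
  have hroot : P.eval (-(x + ∑ i ∈ M, b i)) = 0 := by
    rw [heval, neg_add_cancel, zero_pow (Finset.card_ne_zero.2 hM), sub_zero]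
    have h3 : ∀ I ∈ M.powerset, abelSet b x I *
        (-(x + ∑ i ∈ M, b i) + ∑ i ∈ M \ I, b i) ^ (M \ I).card =
        (-1) ^ M.card * x * ((-1) ^ I.card *
          ((Polynomial.X : Polynomial ℚ) ^ (M.card - 1)).eval (x + ∑ i ∈ I, b i)) := by
      intro I hI
      have hIM := Finset.mem_powerset.1 hI
      have hs : -(x + ∑ i ∈ M, b i) + ∑ i ∈ M \ I, b i = (-1) * (x + ∑ i ∈ I, b i) := by
        rw [← Finset.sum_sdiff hIM]; ring
      have hc : (M \ I).card + I.card = M.card := Finset.card_sdiff_add_card_eq_card hIM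
      have hsign : (-1 : ℚ) ^ (M \ I).card = (-1) ^ M.card * (-1) ^ I.card := by
        rw [← hc, pow_add, mul_assoc, ← mul_pow]
        simp
      rw [hs, mul_pow, hsign]
      simp only [Polynomial.eval_pow, Polynomial.eval_X]
      by_cases h0 : I = ∅
      · subst h0
        have : M.card = M.card - 1 + 1 := by
          have := Finset.card_pos.2 hM
          omega
        simp only [abelSet, sum_empty, add_zero, card_empty, sdiff_empty, if_true, pow_zero]
        conv_lhs => rw [this]
        conv_rhs => rw [this]
        simp only [Nat.add_sub_cancel]
        ring
      · have hI0 := Finset.card_pos.2 (Finset.nonempty_iff_ne_empty.2 h0)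
        rw [abelSet, if_neg h0]
        rw [show M.card - 1 = (I.card - 1) + (M \ I).card by omega, pow_add]
        ring
    rw [Finset.sum_congr rfl h3, ← Finset.mul_sum, sum_powerset_neg_one_pow_mul_eval, mul_zero]
    rw [Polynomial.degree_X_pow]
    have := Finset.card_pos.2 hM
    exact_mod_cast (by omega : M.card - 1 < M.card)
  intro y
  have hPC := Polynomial.eq_C_of_derivative_eq_zero hder
  have hc : P.coeff 0 = 0 := by
    rw [hPC, Polynomial.eval_C] at hroot
    exact hroot
  have hz : P.eval y = 0 := by rw [hPC, hc]; simp
  rw [heval, sub_eq_zero] at hz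
  rw [hz]
  congr 1
  ring

/-- Uses y = (y + b_J) - b_J. Each subtracted term is kept in the form of a plain power over J∖{j}
with y shifted by b_j, so that Hurwitz's identity applies to it. -/
theorem abelSet_eq_sub (b : ι → ℚ) (y : ℚ) (J : Finset ι) :
    abelSet b y J = (y + ∑ i ∈ J, b i) ^ J.card -
      ∑ j ∈ J, b j * (y + b j + ∑ i ∈ J.erase j, b i) ^ (J.erase j).card := by
  have h : ∀ j ∈ J, b j * (y + b j + ∑ i ∈ J.erase j, b i) ^ (J.erase j).card =
      b j * (y + ∑ i ∈ J, b i) ^ (J.card - 1) := by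
    intro j hj
    rw [add_assoc, Finset.add_sum_erase _ _ hj, Finset.card_erase_of_mem hj]
  rw [Finset.sum_congr rfl h, ← Finset.sum_mul]
  by_cases h0 : J = ∅
  · simp [abelSet, h0]
  · have : J.card = J.card - 1 + 1 := by
      have := Finset.card_pos.2 (Finset.nonempty_iff_ne_empty.2 h0)
      omega
    rw [abelSet, if_neg h0, this, pow_succ]
    simp only [Nat.add_sub_cancel]
    ring

/-- The Abel–Hurwitz set functions form a one-parameter group under subset convolution. -/
theorem sum_abelSet_mul_abelSet (b : ι → ℚ) (x y : ℚ) (M : Finset ι) :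
    ∑ I ∈ M.powerset, abelSet b x I * abelSet b y (M \ I) = abelSet b (x + y) M := by
  simp_rw [abelSet_eq_sub b y, mul_sub, Finset.sum_sub_distrib, sum_abelSet_mul_pow,
    Finset.mul_sum]
  rw [sum_powerset_sdiff_comm, abelSet_eq_sub]
  congr 1
  refine Finset.sum_congr rfl fun j hj => ?_
  have h : ∀ I ∈ (M.erase j).powerset, abelSet b x I *
      (b j * (y + b j + ∑ i ∈ (M \ I).erase j, b i) ^ ((M \ I).erase j).card) =
      b j * (abelSet b x I *
        (y + b j + ∑ i ∈ M.erase j \ I, b i) ^ (M.erase j \ I).card) := by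
    intro I _
    rw [Finset.erase_sdiff_comm]
    ring
  rw [Finset.sum_congr rfl h, ← Finset.mul_sum, sum_abelSet_mul_pow]
  congr 2
  ring

end AbelHurwitz

/-! ### Coefficients of the tree series -/

/-- The number `b ^ b / b!`. -/
def treeA (b : ℕ) : ℚ := (b : ℚ) ^ b / (b.factorial : ℚ)

@[simp] theorem treeA_zero : treeA 0 = 1 := by simp [treeA]

/-- The coefficients `b ^ (b - 1) / b!` of the tree series. -/
def treeT (b : ℕ) : ℚ := if b = 0 then 0 else (b : ℚ) ^ (b - 1) / (b.factorial : ℚ)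

@[simp] theorem treeT_zero : treeT 0 = 0 := by simp [treeT]

theorem mul_treeT {b : ℕ} (hb : b ≠ 0) : (b : ℚ) * treeT b = treeA b := by
  rw [treeT, if_neg hb, treeA, ← mul_div_assoc, ← pow_succ']
  congr 2
  omega

/-- A special case of Abel's binomial theorem. -/
theorem sum_antidiagonal_treeT_succ_mul_treeA (r : ℕ) :
    ∑ p ∈ antidiagonal r, treeT (p.1 + 1) * treeA p.2 = ((r : ℚ) + 1) ^ r / (r.factorial : ℚ) := by
  -- All weights are 1, with x = 1 and y = 0; the terms then depend on |I| only and the sum over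
  -- subsets becomes a binomial sum.
  have h := sum_abelSet_mul_pow (ι := ℕ) (fun _ => 1) 1 (range r) 0
  have h2 : ∀ I ∈ (range r).powerset, abelSet (fun _ => 1) 1 I *
      (0 + ∑ i ∈ range r \ I, (1 : ℚ)) ^ (range r \ I).card =
      (fun i : ℕ => ((i : ℚ) + 1) ^ (i - 1) * ((r - i : ℕ) : ℚ) ^ (r - i)) I.card := by
    intro I hI
    have hc := Finset.card_sdiff_of_subset (mem_powerset.1 hI)
    rw [card_range] at hc
    by_cases h0 : I = ∅
    · simp [h0, abelSet]
    · simp only [abelSet, if_neg h0, sum_const, hc, nsmul_eq_mul, mul_one, zero_add, one_mul]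
      rw [add_comm]
  rw [Finset.sum_congr rfl h2, Finset.sum_powerset_apply_card
    (fun i : ℕ => ((i : ℚ) + 1) ^ (i - 1) * ((r - i : ℕ) : ℚ) ^ (r - i))] at h
  simp only [card_range, sum_const, nsmul_eq_mul, mul_one, add_zero] at h
  rw [Finset.Nat.sum_antidiagonal_eq_sum_range_succ (fun i j => treeT (i + 1) * treeA j),
    add_comm (r : ℚ) 1, ← h, Finset.sum_div]
  refine Finset.sum_congr rfl fun i hi => ?_
  have hir : i ≤ r := by simpa [Nat.lt_succ_iff] using hi
  rw [Nat.cast_choose ℚ hir, treeA, treeT, if_neg (Nat.succ_ne_zero i), Nat.factorial_succ]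
  have h1 := Nat.factorial_ne_zero i
  have h2 := Nat.factorial_ne_zero r
  have h3 := Nat.factorial_ne_zero (r - i)
  have h4 : (i : ℚ) + 1 ≠ 0 := by positivity
  have h5 : ((i : ℚ) + 1) ^ i = (i + 1) * ((i + 1) ^ (i - 1)) ∨ i = 0 := by
    rcases Nat.eq_zero_or_pos i with h | h
    · exact Or.inr h
    · left
      rw [← pow_succ']
      congr 1
      omega
  push_cast
  rcases h5 with h5 | h5
  · rw [h5]
    field_simp
  · subst h5
    simp
    field_simp

/-- This is the differential equation x w' = w + w · x w' on coefficients. It comes from Abel's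
identity: the term with p.2 = 0 is counted there with `treeA 0` = 1 but here with 0, and the missing
amount is the summand `treeT b`. -/
theorem treeT_recurrence (b : ℕ) :
    (b : ℚ) * treeT b = treeT b + ∑ p ∈ antidiagonal b, treeT p.1 * (p.2 * treeT p.2) := by
  rcases b with _ | r
  · simp
  have h := sum_antidiagonal_treeT_succ_mul_treeA r
  rw [Finset.Nat.sum_antidiagonal_succ]
  simp only [treeT_zero, zero_mul, zero_add]
  have h2 : ∑ p ∈ antidiagonal r, treeT (p.1 + 1) * (p.2 * treeT p.2) =
      ∑ p ∈ antidiagonal r, treeT (p.1 + 1) * treeA p.2 - treeT (r + 1) := by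
    rw [eq_sub_iff_add_eq]
    have : treeT (r + 1) = ∑ p ∈ antidiagonal r, if p = (r, 0) then treeT (r + 1) else 0 := by
      rw [Finset.sum_ite_eq' (antidiagonal r) (r, 0), if_pos (by simp)]
    rw [this, ← Finset.sum_add_distrib]
    refine Finset.sum_congr rfl fun p hp => ?_
    rw [HasAntidiagonal.mem_antidiagonal] at hp
    by_cases h0 : p.2 = 0
    · have : p = (r, 0) := Prod.ext (by simpa [h0] using hp) h0
      simp [this]
    · rw [if_neg (by rintro rfl; exact h0 rfl), mul_treeT h0, add_zero]
  rw [h2, h, mul_treeT (Nat.succ_ne_zero r), treeA, Nat.factorial_succ]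
  have h1 := Nat.factorial_ne_zero r
  have h4 : (r : ℚ) + 1 ≠ 0 := by positivity
  push_cast
  field_simp
  rw [pow_succ]
  ring

theorem constantCoeff_treeSeries : PowerSeries.constantCoeff treeSeries = 0 :=
  ((eq_treeSeries_iff treeSeries).1 rfl).1

/-- The differential equation `x w' = w + w * (x w')` of the tree series. -/
theorem X_mul_derivative_treeSeries :
    PowerSeries.X * PowerSeries.derivative ℚ treeSeries =
      treeSeries + treeSeries * (PowerSeries.X * PowerSeries.derivative ℚ treeSeries) := by
  have h := ((eq_treeSeries_iff treeSeries).1 rfl).2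
  have hs : PowerSeries.HasSubst treeSeries :=
    PowerSeries.HasSubst.of_constantCoeff_zero' constantCoeff_treeSeries
  have h1 := congrArg (PowerSeries.derivative ℚ) h
  rw [Derivation.leibniz, PowerSeries.derivative_subst hs, PowerSeries.derivative_exp,
    PowerSeries.derivative_X] at h1
  simp only [smul_eq_mul, mul_one] at h1
  set E := (PowerSeries.exp ℚ).subst treeSeries
  set D := PowerSeries.derivative ℚ treeSeries
  calc PowerSeries.X * D = PowerSeries.X * (PowerSeries.X * (E * D) + E) := by rw [← h1]
    _ = PowerSeries.X * E + PowerSeries.X * E * (PowerSeries.X * D) := by ring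
    _ = _ := by rw [← h]

theorem coeff_X_mul_derivative (f : PowerSeries ℚ) (b : ℕ) :
    PowerSeries.coeff b (PowerSeries.X * PowerSeries.derivative ℚ f) =
      b * PowerSeries.coeff b f := by
  rcases b with _ | b
  · simp
  · rw [PowerSeries.coeff_succ_X_mul, PowerSeries.coeff_derivative]
    push_cast
    ring

theorem coeff_one_treeSeries : PowerSeries.coeff 1 treeSeries = 1 := by
  have h := ((eq_treeSeries_iff treeSeries).1 rfl).2
  have h2 := congrArg (PowerSeries.coeff 1) h
  have hs : PowerSeries.HasSubst treeSeries :=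
    PowerSeries.HasSubst.of_constantCoeff_zero' constantCoeff_treeSeries
  have h3 : PowerSeries.constantCoeff ((PowerSeries.exp ℚ - 1).subst treeSeries) = 0 :=
    PowerSeries.constantCoeff_subst_eq_zero constantCoeff_treeSeries _ (by simp)
  rw [← PowerSeries.coe_substAlgHom hs, map_sub, map_one, map_sub, map_one, sub_eq_zero,
    PowerSeries.coe_substAlgHom hs] at h3
  rw [PowerSeries.coeff_succ_X_mul, PowerSeries.coeff_zero_eq_constantCoeff_apply, h3] at h2
  exact h2

/-- In place of Lagrange inversion: both sequences satisfy the same recurrence and agree at 0 and 1.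
-/
theorem coeff_treeSeries (b : ℕ) : PowerSeries.coeff b treeSeries = treeT b := by
  induction b using Nat.strong_induction_on with
  | _ b ih =>
  rcases Nat.eq_zero_or_pos b with rfl | hb
  · simp [constantCoeff_treeSeries]
  rcases Nat.eq_or_lt_of_le (Nat.succ_le_of_lt hb) with h1 | h1
  · rw [← h1]
    simp [coeff_one_treeSeries, treeT]
  have h := congrArg (PowerSeries.coeff b) X_mul_derivative_treeSeries
  rw [map_add, coeff_X_mul_derivative, PowerSeries.coeff_mul] at h
  simp only [coeff_X_mul_derivative] at h
  have h' := treeT_recurrence b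
  have hsum : ∑ p ∈ antidiagonal b, PowerSeries.coeff p.1 treeSeries *
      (p.2 * PowerSeries.coeff p.2 treeSeries) =
      ∑ p ∈ antidiagonal b, treeT p.1 * (p.2 * treeT p.2) := by
    refine Finset.sum_congr rfl fun p hp => ?_
    rw [HasAntidiagonal.mem_antidiagonal] at hp
    by_cases h1 : p.1 = 0
    · simp [h1, constantCoeff_treeSeries]
    by_cases h2 : p.2 = 0
    · simp [h2]
    rw [ih p.1 (by omega), ih p.2 (by omega)]
  rw [hsum] at h
  -- The coefficient at b occurs on both sides of the recurrence with total factor b - 1, and the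
  -- convolution involves only smaller indices, since its end terms vanish.
  have hb1 : (b : ℚ) - 1 ≠ 0 := by
    have : (1 : ℚ) < b := by exact_mod_cast h1
    linarith
  refine mul_left_cancel₀ hb1 ?_
  linarith

/-- The series `w / (1 - w) = ∑_{b ≥ 1} (b ^ b / b!) x ^ b`. -/
def treeW : PowerSeries ℚ := PowerSeries.X * PowerSeries.derivative ℚ treeSeries

theorem coeff_treeW (b : ℕ) : PowerSeries.coeff b treeW = if b = 0 then 0 else treeA b := by
  rw [treeW, coeff_X_mul_derivative, coeff_treeSeries]
  split_ifs with h
  · simp [h]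
  · exact mul_treeT h

/-- The differential equation of the tree series solved for x w': it identifies `treeW` with w/(1 -
w) without inverting a series. -/
theorem one_sub_treeSeries_mul : (1 - treeSeries) * (1 + treeW) = 1 := by
  have := X_mul_derivative_treeSeries
  rw [← treeW] at this
  linear_combination this

theorem coeff_one_add_treeW (b : ℕ) : PowerSeries.coeff b (1 + treeW) = treeA b := by
  rw [map_add, coeff_treeW, PowerSeries.coeff_one]
  split_ifs with h
  · simp [h]
  · simp

theorem treeSeries_mul_one_add_treeW : treeSeries * (1 + treeW) = treeW := by
  linear_combination -one_sub_treeSeries_mul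

/-- The coefficients of `w * (1 + w / (1 - w)) = w / (1 - w)`. -/
theorem sum_antidiagonal_treeT_mul_treeA (N : ℕ) :
    ∑ p ∈ antidiagonal N, treeT p.1 * treeA p.2 = if N = 0 then 0 else treeA N := by
  rw [← coeff_treeW, ← treeSeries_mul_one_add_treeW, PowerSeries.coeff_mul]
  simp only [coeff_treeSeries, coeff_one_add_treeW]

/-! ### Coefficients of multivariate series -/

theorem coeff_xD (i : ℕ) (F : Series) (β : ℕ →₀ ℕ) :
    MvPowerSeries.coeff β (xD i F) = β i * MvPowerSeries.coeff β F := by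
  by_cases h : β i = 0
  · rw [h, xD, MvPowerSeries.X, MvPowerSeries.coeff_monomial_mul, if_neg]
    · simp
    · intro hle
      have := hle i
      simp [h] at this
  · have hle : Finsupp.single i 1 ≤ β := by
      rw [Finsupp.single_le_iff]
      omega
    rw [xD, MvPowerSeries.X, MvPowerSeries.coeff_monomial_mul, if_pos hle,
      MvPowerSeries.coeff_pderiv, tsub_add_cancel_of_le hle, one_mul]
    have : ((β - Finsupp.single i 1 : ℕ →₀ ℕ) i : ℚ) + 1 = β i := by
      simp only [Finsupp.coe_tsub, Pi.sub_apply, Finsupp.single_eq_same]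
      rw [Nat.cast_sub (by omega)]
      simp
    rw [this, mul_comm]

/-- Multiplication by a series in the single variable `x_i`. -/
theorem coeff_subst_X_mul (u : PowerSeries ℚ) (i : ℕ) (F : Series) (β : ℕ →₀ ℕ) :
    MvPowerSeries.coeff β (u.subst (MvPowerSeries.X i : Series) * F) =
      ∑ p ∈ antidiagonal (β i), PowerSeries.coeff p.1 u *
        MvPowerSeries.coeff (β.update i p.2) F := by
  rw [MvPowerSeries.coeff_mul]
  symm
  refine Finset.sum_of_injOn
    (fun p : ℕ × ℕ => ((Finsupp.single i p.1, β.update i p.2) : (ℕ →₀ ℕ) × (ℕ →₀ ℕ))) ?_ ?_ ?_ ?_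
  · rintro ⟨p, q⟩ _ ⟨p', q'⟩ _ h
    simp only [Prod.mk.injEq] at h
    have h1 := DFunLike.congr_fun h.1 i
    have h2 := DFunLike.congr_fun h.2 i
    simp at h1 h2
    simp [h1, h2]
  · rintro ⟨p, q⟩ h
    simp only [Finset.mem_coe, HasAntidiagonal.mem_antidiagonal] at h ⊢
    ext j
    by_cases hj : j = i
    · subst hj
      simp [h]
    · simp [hj]
  · rintro ⟨γ, δ⟩ h hn
    rw [HasAntidiagonal.mem_antidiagonal] at h
    simp only at h
    rw [PowerSeries.coeff_subst_single, if_neg, zero_mul]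
    intro hγ'
    have hγ : γ = Finsupp.single i (γ i) := hγ'
    apply hn
    refine ⟨(γ i, δ i), ?_, ?_⟩
    · simp [← h]
    · simp only [Prod.mk.injEq]
      refine ⟨hγ.symm, ?_⟩
      ext j
      by_cases hj : j = i
      · subst hj
        simp
      · have : γ j = 0 := by rw [hγ]; simp [Ne.symm hj]
        simp [hj, ← h, this]
  · rintro ⟨p, q⟩ _
    rw [PowerSeries.coeff_subst_single]
    simp

/-- The series `w_i / (1 - w_i)`. -/
def wFrac (i : ℕ) : Series := treeW.subst (MvPowerSeries.X i : Series)

theorem coeff_w (i : ℕ) (β : ℕ →₀ ℕ) : MvPowerSeries.coeff β (w i) =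
    if β = Finsupp.single i (β i) then treeT (β i) else 0 := by
  rw [w, PowerSeries.coeff_subst_single, coeff_treeSeries]

theorem coeff_wFrac (i : ℕ) (β : ℕ →₀ ℕ) : MvPowerSeries.coeff β (wFrac i) =
    if β = Finsupp.single i (β i) then (if β i = 0 then 0 else treeA (β i)) else 0 := by
  rw [wFrac, PowerSeries.coeff_subst_single, coeff_treeW]

theorem one_sub_w_mul (i : ℕ) : (1 - w i) * (1 + wFrac i) = 1 := by
  have hs := PowerSeries.HasSubst.X (S := ℚ) i
  have h := congrArg (PowerSeries.substAlgHom hs) one_sub_treeSeries_mul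
  rw [map_mul, map_sub, map_add, map_one, PowerSeries.coe_substAlgHom] at h
  exact h

theorem w_mul_one_add_wFrac (i : ℕ) : w i * (1 + wFrac i) = wFrac i := by
  linear_combination -one_sub_w_mul i

@[simp] theorem constantCoeff_w (i : ℕ) : MvPowerSeries.constantCoeff (w i) = 0 := by
  rw [← MvPowerSeries.coeff_zero_eq_constantCoeff_apply, coeff_w]
  simp

@[simp] theorem constantCoeff_wFrac (i : ℕ) : MvPowerSeries.constantCoeff (wFrac i) = 0 := by
  rw [← MvPowerSeries.coeff_zero_eq_constantCoeff_apply, coeff_wFrac]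
  simp

theorem one_sub_w_inv (i : ℕ) : (1 - w i)⁻¹ = 1 + wFrac i := by
  rw [MvPowerSeries.inv_eq_iff_mul_eq_one (by simp), mul_comm]
  exact one_sub_w_mul i

theorem xD_w (i : ℕ) : xD i (w i) = wFrac i := by
  ext β
  rw [coeff_xD, coeff_w, coeff_wFrac]
  split_ifs with h h2
  · simp [h2]
  · exact mul_treeT h2
  · simp

/-- `w_i ∂/∂w_i = (1 - w_i) x_i ∂/∂x_i`. -/
theorem w_mul_wDeriv (i : ℕ) (F : Series) : w i * wDeriv i F = (1 - w i) * xD i F := by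
  have h : (1 - w i) * xD i (w i) = w i := by
    rw [xD_w]
    linear_combination one_sub_w_mul i
  have h2 : (1 - w i) * xD i (w i) = w i := h
  have hX : MvPowerSeries.coeff (Finsupp.single i 1) (w i) = 1 := by
    rw [coeff_w]
    simp [treeT]
  have hc : MvPowerSeries.constantCoeff (MvPowerSeries.pderiv ℚ i (w i)) ≠ 0 := by
    rw [← MvPowerSeries.coeff_zero_eq_constantCoeff_apply, MvPowerSeries.coeff_pderiv, zero_add,
      hX]
    simp
  have hinv := MvPowerSeries.mul_inv_cancel _ hc
  rw [wDeriv, xD]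
  rw [xD] at h
  calc w i * ((MvPowerSeries.pderiv ℚ i (w i))⁻¹ * MvPowerSeries.pderiv ℚ i F)
      = (1 - w i) * (MvPowerSeries.X i * MvPowerSeries.pderiv ℚ i (w i)) *
        ((MvPowerSeries.pderiv ℚ i (w i))⁻¹ * MvPowerSeries.pderiv ℚ i F) := by rw [h]
    _ = (1 - w i) * (MvPowerSeries.X i * MvPowerSeries.pderiv ℚ i F) *
        (MvPowerSeries.pderiv ℚ i (w i) * (MvPowerSeries.pderiv ℚ i (w i))⁻¹) := by ring
    _ = _ := by rw [hinv, mul_one]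

/-! ### The derivation given by the total degree -/

/-- The derivation multiplying a monomial by its total degree. -/
def degD (F : Series) : Series := fun β => (β.degree : ℚ) * MvPowerSeries.coeff β F

theorem coeff_degD (F : Series) (β : ℕ →₀ ℕ) :
    MvPowerSeries.coeff β (degD F) = (β.degree : ℚ) * MvPowerSeries.coeff β F := rfl

theorem degD_add (F G : Series) : degD (F + G) = degD F + degD G := by
  ext β
  simp only [coeff_degD, map_add]
  ring

theorem degD_sub (F G : Series) : degD (F - G) = degD F - degD G := by
  ext β
  simp only [coeff_degD, map_sub]
  ring

theorem degD_mul (F G : Series) : degD (F * G) = degD F * G + F * degD G := by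
  ext β
  simp only [coeff_degD, map_add, MvPowerSeries.coeff_mul, Finset.mul_sum]
  rw [← Finset.sum_add_distrib]
  refine Finset.sum_congr rfl fun p hp => ?_
  rw [HasAntidiagonal.mem_antidiagonal] at hp
  rw [← hp, map_add]
  push_cast
  ring

theorem degD_X (i : ℕ) : degD (MvPowerSeries.X i : Series) = MvPowerSeries.X i := by
  ext β
  rw [coeff_degD, MvPowerSeries.coeff_X]
  split_ifs with h
  · simp [h]
  · simp

/-- Uniqueness for a linear differential equation: in degree n the equation reads (n - d) F_β = a
combination of coefficients of lower degree, so F vanishes once its coefficients of degree at most d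
do. -/
theorem eq_zero_of_degD_eq {F c : Series} (h : degD F = F * c) {d : ℕ}
    (hc : MvPowerSeries.constantCoeff c = d)
    (hF : ∀ β : ℕ →₀ ℕ, β.degree ≤ d → MvPowerSeries.coeff β F = 0) : F = 0 := by
  have key : ∀ n : ℕ, ∀ β : ℕ →₀ ℕ, β.degree = n → MvPowerSeries.coeff β F = 0 := by
    intro n
    induction n using Nat.strong_induction_on with
    | _ n ih =>
    intro β hβ
    by_cases hn : β.degree ≤ d
    · exact hF β hn
    have h1 := congrArg (MvPowerSeries.coeff β) h
    -- The pair (β, 0) carries the constant term d of c; all other pairs involve coefficients of F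
    -- of smaller degree.
    rw [coeff_degD, MvPowerSeries.coeff_mul, Finset.sum_eq_single (β, 0)] at h1
    · rw [MvPowerSeries.coeff_zero_eq_constantCoeff_apply, hc] at h1
      have h2 : (β.degree : ℚ) - d ≠ 0 := by
        rw [sub_ne_zero]
        exact_mod_cast (by omega : β.degree ≠ d)
      refine (mul_eq_zero.1 (?_ : ((β.degree : ℚ) - d) * _ = 0)).resolve_left h2
      simp only at h1
      linear_combination h1
    · rintro ⟨γ, δ⟩ hp hne
      rw [HasAntidiagonal.mem_antidiagonal] at hp
      simp only at hp ⊢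
      have hδ : δ ≠ 0 := by
        rintro rfl
        rw [add_zero] at hp
        exact hne (by rw [hp])
      have hδ' : δ.degree ≠ 0 := by
        rwa [Ne, Finsupp.degree_eq_zero_iff]
      have hdeg : γ.degree + δ.degree = n := by rw [← map_add, hp, hβ]
      rw [ih γ.degree (by omega) γ rfl, zero_mul]
    · intro hp
      exact absurd (by simp) hp
  ext β
  rw [key _ β rfl, map_zero]

/-! ### Series in two of the variables -/

/-- The series `∑ c N k x_r ^ N x_s ^ k`. -/
def biSeries (r s : ℕ) (c : ℕ → ℕ → ℚ) : Series := fun β =>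
  if β.support ⊆ {r, s} then c (β r) (β s) else 0

theorem coeff_biSeries (r s : ℕ) (c : ℕ → ℕ → ℚ) (β : ℕ →₀ ℕ) :
    MvPowerSeries.coeff β (biSeries r s c) =
      if β.support ⊆ {r, s} then c (β r) (β s) else 0 := rfl

theorem biSeries_swap (r s : ℕ) (c : ℕ → ℕ → ℚ) :
    biSeries s r c = biSeries r s (fun N k => c k N) := by
  ext β
  rw [coeff_biSeries, coeff_biSeries, Finset.pair_comm]

theorem biSeries_add (r s : ℕ) (c d : ℕ → ℕ → ℚ) :
    biSeries r s c + biSeries r s d = biSeries r s (fun N k => c N k + d N k) := by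
  ext β
  rw [map_add, coeff_biSeries, coeff_biSeries, coeff_biSeries]
  split_ifs <;> simp

theorem biSeries_sub (r s : ℕ) (c d : ℕ → ℕ → ℚ) :
    biSeries r s c - biSeries r s d = biSeries r s (fun N k => c N k - d N k) := by
  ext β
  rw [map_sub, coeff_biSeries, coeff_biSeries, coeff_biSeries]
  split_ifs <;> simp

theorem biSeries_injective {r s : ℕ} (hrs : r ≠ s) {c d : ℕ → ℕ → ℚ}
    (h : biSeries r s c = biSeries r s d) (N k : ℕ) : c N k = d N k := by
  have h1 := congrArg (MvPowerSeries.coeff (Finsupp.single r N + Finsupp.single s k)) h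
  have hsub : (Finsupp.single r N + Finsupp.single s k : ℕ →₀ ℕ).support ⊆ {r, s} := by
    refine Finsupp.support_add.trans (Finset.union_subset ?_ ?_)
    · exact Finsupp.support_single_subset.trans (by simp)
    · exact Finsupp.support_single_subset.trans (by simp)
  rw [coeff_biSeries, coeff_biSeries, if_pos hsub, if_pos hsub] at h1
  simpa [hrs, hrs.symm, Finsupp.single_apply] using h1

theorem subst_X_mul_biSeries {r s : ℕ} (hrs : r ≠ s) (u : PowerSeries ℚ) (c : ℕ → ℕ → ℚ) :
    u.subst (MvPowerSeries.X r : Series) * biSeries r s c =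
      biSeries r s (fun N k => ∑ p ∈ antidiagonal N, PowerSeries.coeff p.1 u * c p.2 k) := by
  ext β
  rw [coeff_subst_X_mul, coeff_biSeries]
  have hsub : ∀ q, (β.update r q).support ⊆ {r, s} ↔ β.support ⊆ {r, s} := by
    intro q
    constructor
    · intro h j hj
      by_cases hjr : j = r
      · simp [hjr]
      · exact h (by simpa [hjr] using hj)
    · intro h j hj
      by_cases hjr : j = r
      · simp [hjr]
      · exact h (by simpa [hjr] using hj)
  simp only [coeff_biSeries, hsub]
  split_ifs with h
  · refine Finset.sum_congr rfl fun p _ => ?_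
    simp [hrs.symm]
  · simp

theorem subst_X_eq_biSeries {r s : ℕ} (hrs : r ≠ s) (u : PowerSeries ℚ) :
    u.subst (MvPowerSeries.X r : Series) =
      biSeries r s (fun N k => if k = 0 then PowerSeries.coeff N u else 0) := by
  ext β
  rw [PowerSeries.coeff_subst_single, coeff_biSeries, ← ite_and]
  refine if_congr ?_ rfl rfl
  constructor
  · intro h
    rw [h]
    refine ⟨Finsupp.support_single_subset.trans (by simp), ?_⟩
    simp [hrs]
  · rintro ⟨h1, h2⟩
    ext j
    by_cases hjr : j = r
    · simp [hjr]
    rw [Finsupp.single_eq_of_ne hjr]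
    by_contra hj
    have := h1 (Finsupp.mem_support_iff.2 hj)
    simp only [mem_insert, hjr, mem_singleton, false_or] at this
    subst this
    exact hj h2

theorem degD_biSeries {r s : ℕ} (hrs : r ≠ s) (c : ℕ → ℕ → ℚ) :
    degD (biSeries r s c) = biSeries r s (fun N k => ((N : ℚ) + k) * c N k) := by
  ext β
  rw [coeff_degD, coeff_biSeries, coeff_biSeries]
  split_ifs with h
  · have : β.degree = β r + β s := by
      rw [Finsupp.degree_apply, Finset.sum_subset h fun j _ hj => Finsupp.notMem_support_iff.1 hj,
        Finset.sum_pair hrs]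
    rw [this]
    push_cast
    ring
  · simp

theorem X_eq_subst (r : ℕ) :
    (MvPowerSeries.X r : Series) =
      (PowerSeries.X : PowerSeries ℚ).subst (MvPowerSeries.X r : Series) :=
  (PowerSeries.subst_X (PowerSeries.HasSubst.X r)).symm

theorem X_mul_biSeries {r s : ℕ} (hrs : r ≠ s) (c : ℕ → ℕ → ℚ) :
    MvPowerSeries.X r * biSeries r s c =
      biSeries r s (fun N k => if N = 0 then 0 else c (N - 1) k) := by
  rw [X_eq_subst, subst_X_mul_biSeries hrs]
  congr 1
  funext N k
  rcases N with _ | N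
  · simp
  · rw [Finset.sum_eq_single (1, N)]
    · simp
    · rintro ⟨p, q⟩ hp hne
      rw [PowerSeries.coeff_X, if_neg, zero_mul]
      rintro h
      simp only at h
      subst h
      rw [HasAntidiagonal.mem_antidiagonal] at hp
      simp only at hp
      exact hne (by rw [show q = N by omega])
    · intro h
      exact absurd (by simp [add_comm]) h

theorem X_mul_biSeries_right {r s : ℕ} (hrs : r ≠ s) (c : ℕ → ℕ → ℚ) :
    MvPowerSeries.X s * biSeries r s c =
      biSeries r s (fun N k => if k = 0 then 0 else c N (k - 1)) := by
  rw [biSeries_swap s r, X_mul_biSeries hrs.symm, biSeries_swap]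

theorem subst_X_eq_biSeries_right {r s : ℕ} (hrs : r ≠ s) (u : PowerSeries ℚ) :
    u.subst (MvPowerSeries.X s : Series) =
      biSeries r s (fun N k => if N = 0 then PowerSeries.coeff k u else 0) := by
  rw [subst_X_eq_biSeries hrs.symm, biSeries_swap]

theorem one_add_wFrac_eq_subst (i : ℕ) :
    1 + wFrac i = (1 + treeW).subst (MvPowerSeries.X i : Series) := by
  have hs := PowerSeries.HasSubst.X (S := ℚ) i
  rw [← PowerSeries.coe_substAlgHom hs, map_add, map_one, PowerSeries.coe_substAlgHom]
  rfl

theorem degD_w (i : ℕ) : degD (w i) = wFrac i := by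
  ext β
  rw [coeff_degD, coeff_w, coeff_wFrac]
  split_ifs with h h2
  · simp [h2]
  · rw [← mul_treeT h2]
    congr 2
    rw [h]
    simp
  · simp

/-- Obtained by applying the degree derivation to w (1 + W) = W and eliminating w through (1 - w)(1
+ W) = 1, where W = w/(1 - w). -/
theorem degD_wFrac (i : ℕ) : degD (wFrac i) = wFrac i * (1 + wFrac i) ^ 2 := by
  have h := congrArg degD (w_mul_one_add_wFrac i)
  have h1 : degD (1 : Series) = 0 := by
    ext β
    rw [coeff_degD, MvPowerSeries.coeff_one]
    split_ifs with h0 <;> simp [h0]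
  rw [degD_mul, degD_add, h1, degD_w, zero_add] at h
  linear_combination (-(1 + wFrac i)) * h - degD (wFrac i) * one_sub_w_mul i

/-- The coefficients of `∑_{N ≥ 0, k ≥ 1} (k a_k a_N / (N + k)) x_r ^ N x_s ^ k`. -/
def kappaCoeff (N k : ℕ) : ℚ := if k = 0 then 0 else k * treeA k * treeA N / ((N : ℚ) + k)

/-- The degree derivation cancels the denominator N + k, after which the coefficients factor into a
series in x_r times the derivative of W_s. -/
theorem degD_kappa {r s : ℕ} (hrs : r ≠ s) : degD (biSeries r s kappaCoeff) =
    (1 + wFrac r) * (wFrac s * (1 + wFrac s) ^ 2) := by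
  rw [← degD_wFrac, wFrac.eq_def s, subst_X_eq_biSeries_right hrs, degD_biSeries hrs,
    degD_biSeries hrs, one_add_wFrac_eq_subst, subst_X_mul_biSeries hrs]
  congr 1
  funext N k
  rw [Finset.sum_eq_single (N, 0)]
  · simp only [coeff_one_add_treeW, coeff_treeW, kappaCoeff]
    split_ifs with h
    · simp
    · have : (N : ℚ) + k ≠ 0 := by positivity
      field_simp
      simp
      ring
  · rintro ⟨p, q⟩ hp hne
    rw [HasAntidiagonal.mem_antidiagonal] at hp
    have : q ≠ 0 := by
      rintro rfl
      exact hne (by rw [← hp]; rfl)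
    simp [this]
  · intro h
    exact absurd (by simp) h

theorem le_order_of_mul {F G : Series} {a b : ℕ} (hF : (a : ℕ∞) ≤ F.order)
    (hG : (b : ℕ∞) ≤ G.order) : ((a + b : ℕ) : ℕ∞) ≤ (F * G).order := by
  push_cast
  exact (add_le_add hF hG).trans MvPowerSeries.le_order_mul

theorem le_order_w_sub_X (i : ℕ) : ((2 : ℕ) : ℕ∞) ≤ (w i - MvPowerSeries.X i).order := by
  refine MvPowerSeries.le_order fun β hβ => ?_
  have hβ' : β.degree < 2 := by exact_mod_cast hβ
  rw [map_sub, coeff_w, MvPowerSeries.coeff_X]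
  have hle : β i ≤ β.degree := Finsupp.le_degree i β
  rcases Nat.lt_or_ge (β i) 1 with h | h
  · have h0 : β i = 0 := by omega
    rw [if_neg (fun h1 : β = Finsupp.single i 1 => by rw [h1] at h0; simp at h0), h0]
    simp
  · have h1 : β i = 1 := by omega
    rw [h1]
    by_cases h2 : β = Finsupp.single i 1
    · simp [h2, treeT]
    · simp [h2]

theorem le_order_wFrac_sub_X (i : ℕ) : ((2 : ℕ) : ℕ∞) ≤ (wFrac i - MvPowerSeries.X i).order := by
  refine MvPowerSeries.le_order fun β hβ => ?_
  have hβ' : β.degree < 2 := by exact_mod_cast hβ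
  rw [map_sub, coeff_wFrac, MvPowerSeries.coeff_X]
  have hle : β i ≤ β.degree := Finsupp.le_degree i β
  rcases Nat.lt_or_ge (β i) 1 with h | h
  · have h0 : β i = 0 := by omega
    rw [if_neg (fun h1 : β = Finsupp.single i 1 => by rw [h1] at h0; simp at h0), h0]
    simp
  · have h1 : β i = 1 := by omega
    rw [h1]
    by_cases h2 : β = Finsupp.single i 1
    · simp [h2, treeA]
    · simp [h2]

theorem one_le_order {F : Series} (h : MvPowerSeries.constantCoeff F = 0) :
    ((1 : ℕ) : ℕ∞) ≤ F.order :=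
  MvPowerSeries.one_le_order_iff_constCoeff_eq_zero.2 h

theorem constantCoeff_biSeries (r s : ℕ) (c : ℕ → ℕ → ℚ) :
    MvPowerSeries.constantCoeff (biSeries r s c) = c 0 0 := by
  rw [← MvPowerSeries.coeff_zero_eq_constantCoeff_apply, coeff_biSeries]
  simp

/-- The closed form of `∑_{N ≥ 0, k ≥ 1} (k a_k a_N / (N + k)) x_r ^ N x_s ^ k`. -/
theorem kappa_mul {r s : ℕ} (hrs : r ≠ s) :
    biSeries r s kappaCoeff * (w r - w s) * (MvPowerSeries.X r - MvPowerSeries.X s) =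
      MvPowerSeries.X s * (w r - w s) - wFrac s * (MvPowerSeries.X r - MvPowerSeries.X s) := by
  set K := biSeries r s kappaCoeff with hK
  set x : Series := MvPowerSeries.X r with hx
  set y : Series := MvPowerSeries.X s with hy
  rw [← sub_eq_zero]
  have hu : wFrac r - wFrac s = (w r - w s) * (1 + wFrac r) * (1 + wFrac s) := by
    linear_combination -(1 + wFrac s) * w_mul_one_add_wFrac r +
      (1 + wFrac r) * w_mul_one_add_wFrac s
  -- Both sides satisfy the same inhomogeneous equation, because w_r - w_s is multiplied by (1 +
  -- W_r)(1 + W_s) under the derivation and x_r - x_s by 1. The factor has constant term 2, so only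
  -- degrees up to 2 need checking.
  refine eq_zero_of_degD_eq (c := 1 + (1 + wFrac r) * (1 + wFrac s)) (d := 2) ?_ ?_ ?_
  · simp only [degD_sub, degD_mul, degD_w, degD_wFrac, hK, degD_kappa hrs, hx, hy, degD_X]
    rw [← hK, ← hx, ← hy]
    rw [hu]
    linear_combination (wFrac s * (1 + wFrac s) * (x - y)) * (-1 : Series) * hu
  · simp
    norm_num
  · intro β hβ
    refine MvPowerSeries.coeff_of_lt_order (lt_of_lt_of_le (b := ((3 : ℕ) : ℕ∞)) ?_ ?_)
    · exact_mod_cast (by omega : β.degree < 3)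
    -- The quadratic parts cancel after replacing w_r, w_s and W_s by their linear terms; every
    -- remaining product has order at least 3.
    have hid : K * (w r - w s) * (x - y) - (y * (w r - w s) - wFrac s * (x - y)) =
        K * (w r - w s) * (x - y) + (-(y * (w r - x)) +
          (y * (w s - y) + (wFrac s - y) * (x - y))) := by ring
    rw [hid]
    have hu1 : ((1 : ℕ) : ℕ∞) ≤ (w r - w s).order := one_le_order (by simp)
    have hv1 : ((1 : ℕ) : ℕ∞) ≤ (x - y).order := one_le_order (by simp [hx, hy])
    have hy1 : ((1 : ℕ) : ℕ∞) ≤ y.order := one_le_order (by simp [hy])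
    have hK1 : ((1 : ℕ) : ℕ∞) ≤ K.order :=
      one_le_order (by rw [hK, constantCoeff_biSeries]; simp [kappaCoeff])
    have h1 := le_order_of_mul (le_order_of_mul hK1 hu1) hv1
    have h2 := le_order_of_mul hy1 (le_order_w_sub_X r)
    have h3 := le_order_of_mul hy1 (le_order_w_sub_X s)
    have h4 := le_order_of_mul (le_order_wFrac_sub_X s) hv1
    refine le_trans (le_min h1 (le_trans (le_min ?_ (le_trans (le_min h3 h4)
      MvPowerSeries.min_order_le_add)) MvPowerSeries.min_order_le_add))
      MvPowerSeries.min_order_le_add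
    rw [MvPowerSeries.order_neg]
    exact h2

theorem X_sub_X_ne_zero {r s : ℕ} (hrs : r ≠ s) :
    (MvPowerSeries.X r - MvPowerSeries.X s : Series) ≠ 0 := by
  intro h
  have := congrArg (MvPowerSeries.coeff (Finsupp.single r 1)) h
  simp [MvPowerSeries.coeff_X, Finsupp.single_left_inj, hrs] at this

theorem w_sub_w_ne_zero {r s : ℕ} (hrs : r ≠ s) : w r - w s ≠ 0 := by
  intro h
  have := congrArg (MvPowerSeries.coeff (Finsupp.single r 1)) h
  rw [map_sub, coeff_w, coeff_w] at this
  simp [treeT, hrs.symm] at this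

/-- The series `∑_{N, k ≥ 1} c_{N + k} x_r ^ N x_s ^ k`. -/
theorem X_sub_X_mul_biSeries {r s : ℕ} (hrs : r ≠ s) :
    (MvPowerSeries.X r - MvPowerSeries.X s) *
      biSeries r s (fun N k => if N = 0 ∨ k = 0 then 0 else treeA (N + k)) =
      MvPowerSeries.X s * wFrac r - MvPowerSeries.X r * wFrac s := by
  rw [wFrac, wFrac, sub_mul, X_mul_biSeries hrs, X_mul_biSeries_right hrs,
    subst_X_eq_biSeries hrs, subst_X_eq_biSeries_right hrs, X_mul_biSeries_right hrs,
    X_mul_biSeries hrs, biSeries_sub, biSeries_sub]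
  congr 1
  funext N k
  simp only [coeff_treeW]
  rcases N with _ | _ | N <;> rcases k with _ | _ | k <;> simp [add_assoc, add_comm, add_left_comm]

/-- The reciprocity in the form of generating series. After multiplication by (x_r - x_s)(w_r - w_s)
every series involved has a closed form and only algebra is left. -/
theorem kappa_add_kappa {r s : ℕ} (hrs : r ≠ s) :
    (1 + wFrac r) * biSeries r s kappaCoeff + (1 + wFrac s) * biSeries s r kappaCoeff =
      biSeries r s (fun N k => if N = 0 ∨ k = 0 then 0 else treeA (N + k)) - 1 +
        (1 + wFrac r) * (1 + wFrac s) := by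
  refine mul_left_cancel₀ (mul_ne_zero (X_sub_X_ne_zero hrs) (w_sub_w_ne_zero hrs)) ?_
  have hu : wFrac r - wFrac s = (w r - w s) * (1 + wFrac r) * (1 + wFrac s) := by
    linear_combination -(1 + wFrac s) * w_mul_one_add_wFrac r +
      (1 + wFrac r) * w_mul_one_add_wFrac s
  linear_combination (1 + wFrac r) * kappa_mul hrs + (1 + wFrac s) * kappa_mul hrs.symm -
    (w r - w s) * X_sub_X_mul_biSeries hrs + (MvPowerSeries.X r - MvPowerSeries.X s) * hu

/-- `∑_{p + q = N} a_p a_q / (q + k)`. -/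
def treeQuot (N k : ℕ) : ℚ := ∑ p ∈ antidiagonal N, treeA p.1 * (treeA p.2 / ((p.2 : ℚ) + k))

/-- The basic reciprocity between the sums `treeQuot`. -/
theorem treeQuot_reciprocity {N k : ℕ} (hN : N ≠ 0) (hk : k ≠ 0) :
    k * treeA k * treeQuot N k + N * treeA N * treeQuot k N =
      treeA (N + k) + treeA N * treeA k := by
  -- Any two distinct variables serve; the identity is compared at x_1^N x_2^k, where the constant 1
  -- does not contribute because N and k are nonzero.
  have h := kappa_add_kappa (r := 1) (s := 2) (by norm_num)
  have h1 : (1 : ℕ) ≠ 2 := by norm_num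
  have hone : (1 : Series) = biSeries 1 2 (fun N k => if N = 0 ∧ k = 0 then 1 else 0) := by
    have h2 : (1 : Series) = (1 : PowerSeries ℚ).subst (MvPowerSeries.X 1 : Series) := by
      rw [← PowerSeries.coe_substAlgHom (PowerSeries.HasSubst.X (S := ℚ) 1), map_one]
    rw [h2, subst_X_eq_biSeries h1]
    congr 1
    funext N k
    rw [PowerSeries.coeff_one]
    split_ifs <;> simp_all
  have hprod : (1 + wFrac 1) * (1 + wFrac 2) =
      biSeries 1 2 (fun N k => treeA N * treeA k) := by
    rw [one_add_wFrac_eq_subst 2, subst_X_eq_biSeries h1.symm, biSeries_swap,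
      one_add_wFrac_eq_subst 1, subst_X_mul_biSeries h1]
    congr 1
    funext N k
    rw [Finset.sum_eq_single (N, 0)]
    · simp [coeff_one_add_treeW]
    · rintro ⟨p, q⟩ hp hne
      rw [HasAntidiagonal.mem_antidiagonal] at hp
      have : q ≠ 0 := by
        rintro rfl
        exact hne (by rw [← hp]; rfl)
      simp [this]
    · intro h
      exact absurd (by simp) h
  rw [hprod, one_add_wFrac_eq_subst 1, one_add_wFrac_eq_subst 2, subst_X_mul_biSeries h1,
    subst_X_mul_biSeries h1.symm, biSeries_swap 1 2, biSeries_add, hone, biSeries_sub,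
    biSeries_add] at h
  have h2 := biSeries_injective h1 h N k
  simp only [coeff_one_add_treeW, kappaCoeff, hN, hk, if_false, or_self, false_and, sub_zero] at h2
  rw [← h2, treeQuot, treeQuot, Finset.mul_sum, Finset.mul_sum]
  congr 1 <;>
  · refine Finset.sum_congr rfl fun p _ => ?_
    ring

/-! ### Sums over ordered pairs of positive parts -/

/-- The pairs of positive integers with sum `N`. -/
def posAnti (N : ℕ) : Finset (ℕ × ℕ) := (antidiagonal N).filter fun p => p.1 ≠ 0 ∧ p.2 ≠ 0

theorem mem_posAnti {N : ℕ} {p : ℕ × ℕ} : p ∈ posAnti N ↔ p.1 + p.2 = N ∧ p.1 ≠ 0 ∧ p.2 ≠ 0 := by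
  rw [posAnti, mem_filter, HasAntidiagonal.mem_antidiagonal]

theorem sum_posAnti_swap {β : Type*} [AddCommMonoid β] (N : ℕ) (f : ℕ × ℕ → β) :
    ∑ p ∈ posAnti N, f p.swap = ∑ p ∈ posAnti N, f p := by
  refine Finset.sum_nbij' Prod.swap Prod.swap ?_ ?_ ?_ ?_ ?_
  all_goals simp [mem_posAnti, add_comm, and_comm]

theorem sum_antidiagonal_eq_posAnti {N : ℕ} (hN : N ≠ 0) (f : ℕ × ℕ → ℚ) :
    ∑ p ∈ antidiagonal N, f p = ∑ p ∈ posAnti N, f p + f (0, N) + f (N, 0) := by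
  have h : antidiagonal N = insert (0, N) (insert (N, 0) (posAnti N)) := by
    ext ⟨p, q⟩
    simp only [HasAntidiagonal.mem_antidiagonal, mem_insert, mem_posAnti, Prod.mk.injEq]
    omega
  rw [h, sum_insert, sum_insert]
  · ring
  · simp [mem_posAnti]
  · simp [mem_posAnti, hN.symm]

theorem treeA_ne_zero (b : ℕ) : treeA b ≠ 0 := by
  rcases Nat.eq_zero_or_pos b with rfl | hb
  · simp
  · have := Nat.factorial_pos b
    rw [treeA]
    positivity

theorem treeT_eq {b : ℕ} (hb : b ≠ 0) : treeT b = treeA b / b := by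
  have : (b : ℚ) ≠ 0 := by exact_mod_cast hb
  rw [← mul_treeT hb]
  field_simp

theorem sum_posAnti_div_fst {N : ℕ} (hN : N ≠ 0) :
    ∑ p ∈ posAnti N, treeA p.1 * treeA p.2 / p.1 = treeA N - treeA N / N := by
  have h := sum_antidiagonal_treeT_mul_treeA N
  rw [if_neg hN, sum_antidiagonal_eq_posAnti hN] at h
  simp only [treeT_zero, treeA_zero, zero_mul, add_zero, mul_one, treeT_eq hN] at h
  rw [← eq_sub_iff_add_eq] at h
  rw [← h]
  refine Finset.sum_congr rfl fun p hp => ?_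
  rw [treeT_eq (mem_posAnti.1 hp).2.1]
  ring

theorem sum_posAnti_div_snd {N : ℕ} (hN : N ≠ 0) :
    ∑ p ∈ posAnti N, treeA p.1 * treeA p.2 / p.2 = treeA N - treeA N / N := by
  rw [← sum_posAnti_div_fst hN, ← sum_posAnti_swap]
  refine Finset.sum_congr rfl fun p _ => ?_
  simp [mul_comm]

/-- `∑_{p + q = N, p, q ≥ 1} a_p a_q / (q + k)`. -/
def posQuot (N k : ℕ) : ℚ := ∑ p ∈ posAnti N, treeA p.1 * treeA p.2 / ((p.2 : ℚ) + k)

theorem sum_posAnti_div_fst_add (N k : ℕ) :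
    ∑ p ∈ posAnti N, treeA p.1 * treeA p.2 / ((p.1 : ℚ) + k) = posQuot N k := by
  rw [posQuot, ← sum_posAnti_swap]
  refine Finset.sum_congr rfl fun p _ => ?_
  simp [mul_comm]

/-- The terms of `treeQuot` with p = 0 or q = 0 contribute 3 a_N a_k altogether, which turns the
coefficient +1 into -2. -/
theorem posQuot_reciprocity {N k : ℕ} (hN : N ≠ 0) (hk : k ≠ 0) :
    k * treeA k * posQuot N k + N * treeA N * posQuot k N =
      treeA (N + k) - 2 * (treeA N * treeA k) := by
  have key : ∀ {N k : ℕ}, N ≠ 0 → k ≠ 0 →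
      treeQuot N k = posQuot N k + treeA N / ((N : ℚ) + k) + treeA N / k := by
    intro N k hN hk
    rw [treeQuot, sum_antidiagonal_eq_posAnti hN, posQuot]
    simp [div_eq_mul_inv, mul_assoc]
  have h := treeQuot_reciprocity hN hk
  rw [key hN hk, key hk hN] at h
  have h1 : (N : ℚ) ≠ 0 := by exact_mod_cast hN
  have h2 : (k : ℚ) ≠ 0 := by exact_mod_cast hk
  have h3 : (N : ℚ) + k ≠ 0 := by positivity
  have h4 : (k : ℚ) * treeA k * (treeA N / ((N : ℚ) + k) + treeA N / k) +
      N * treeA N * (treeA k / ((k : ℚ) + N) + treeA k / N) = 3 * (treeA N * treeA k) := by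
    rw [add_comm (k : ℚ) N]
    field_simp
    ring
  linear_combination h - h4

/-- Partial fractions: 1/(pq) = (1/N)(1/p + 1/q). -/
theorem sum_posAnti_one {N : ℕ} (hN : N ≠ 0) :
    ∑ p ∈ posAnti N, treeA p.1 * treeA p.2 / (p.1 * p.2) = 2 * (N - 1) * treeA N / (N : ℚ) ^ 2 := by
  have h1 : (N : ℚ) ≠ 0 := by exact_mod_cast hN
  have h : ∑ p ∈ posAnti N, treeA p.1 * treeA p.2 / (p.1 * p.2) =
      (1 / N) * (∑ p ∈ posAnti N, treeA p.1 * treeA p.2 / p.1 +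
        ∑ p ∈ posAnti N, treeA p.1 * treeA p.2 / p.2) := by
    rw [← Finset.sum_add_distrib, Finset.mul_sum]
    refine Finset.sum_congr rfl fun p hp => ?_
    obtain ⟨hs, hp1, hp2⟩ := mem_posAnti.1 hp
    have h2 : (p.1 : ℚ) ≠ 0 := by exact_mod_cast hp1
    have h3 : (p.2 : ℚ) ≠ 0 := by exact_mod_cast hp2
    have hs' : (N : ℚ) = p.1 + p.2 := by exact_mod_cast hs.symm
    rw [hs'] at h1 ⊢
    field_simp
    ring
  rw [h, sum_posAnti_div_fst hN, sum_posAnti_div_snd hN]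
  field_simp
  ring

/-- `∑_{p + q = N, p, q ≥ 1} a_p a_q / (q (p + k))`. -/
def posSum₂ (N k : ℕ) : ℚ := ∑ p ∈ posAnti N, treeA p.1 * treeA p.2 / (p.2 * ((p.1 : ℚ) + k))

/-- Partial fractions: since p + q = N, (N + k)/(q (p + k)) = 1/q + 1/(p + k). -/
theorem mul_posSum₂ {N k : ℕ} (hN : N ≠ 0) :
    ((N : ℚ) + k) * posSum₂ N k = treeA N - treeA N / N + posQuot N k := by
  rw [← sum_posAnti_div_snd hN, ← sum_posAnti_div_fst_add, ← Finset.sum_add_distrib, posSum₂,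
    Finset.mul_sum]
  refine Finset.sum_congr rfl fun p hp => ?_
  obtain ⟨hs, hp1, hp2⟩ := mem_posAnti.1 hp
  have h2 : (p.1 : ℚ) + k ≠ 0 := by positivity
  have h3 : (p.2 : ℚ) ≠ 0 := by exact_mod_cast hp2
  have hs' : (N : ℚ) = p.1 + p.2 := by exact_mod_cast hs.symm
  rw [hs']
  field_simp
  ring

/-- The uncontrolled sums `posQuot` enter on the left only in the combination that
`posQuot_reciprocity` evaluates. The term in a_(N+k) is what will cancel against the join terms. -/
theorem posSum₂_reciprocity {N k : ℕ} (hN : N ≠ 0) (hk : k ≠ 0) :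
    ((N : ℚ) + k) * (k * posSum₂ N k / treeA N + N * posSum₂ k N / treeA k) =
      ((N : ℚ) + k) * (1 - 1 / N - 1 / k) + treeA (N + k) / (treeA N * treeA k) := by
  have h1 : (N : ℚ) ≠ 0 := by exact_mod_cast hN
  have h2 : (k : ℚ) ≠ 0 := by exact_mod_cast hk
  have hA := treeA_ne_zero N
  have hB := treeA_ne_zero k
  have e1 := mul_posSum₂ (k := k) hN
  have e2 := mul_posSum₂ (k := N) hk
  have e3 := posQuot_reciprocity hN hk
  have e4 : treeA (N + k) = k * treeA k * posQuot N k + N * treeA N * posQuot k N +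
      2 * (treeA N * treeA k) := by linear_combination -e3
  have e5 : ((N : ℚ) + k) * (k * posSum₂ N k / treeA N + N * posSum₂ k N / treeA k) =
      k * (treeA N - treeA N / N + posQuot N k) / treeA N +
        N * (treeA k - treeA k / k + posQuot k N) / treeA k := by
    rw [← e1, ← e2]
    ring
  rw [e5, e4]
  field_simp
  ring

/-- `∑_{p + q = N, p, q ≥ 1} a_p a_q / ((p + k) (q + l))`. -/
def posSum₃ (N k l : ℕ) : ℚ :=
  ∑ p ∈ posAnti N, treeA p.1 * treeA p.2 / (((p.1 : ℚ) + k) * ((p.2 : ℚ) + l))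

/-- Partial fractions: (N + k + l)/((p + k)(q + l)) = 1/(p + k) + 1/(q + l). -/
theorem mul_posSum₃ (N k l : ℕ) :
    ((N : ℚ) + k + l) * posSum₃ N k l = posQuot N k + posQuot N l := by
  rw [← sum_posAnti_div_fst_add N k, posQuot, ← Finset.sum_add_distrib, posSum₃,
    Finset.mul_sum]
  refine Finset.sum_congr rfl fun p hp => ?_
  obtain ⟨hs, hp1, hp2⟩ := mem_posAnti.1 hp
  have h2 : (p.1 : ℚ) + k ≠ 0 := by positivity
  have h3 : (p.2 : ℚ) + l ≠ 0 := by positivity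
  have hs' : (N : ℚ) = p.1 + p.2 := by exact_mod_cast hs.symm
  rw [hs']
  field_simp
  ring

/-- The six values of `posQuot` on the left group into three pairs, one for each pair among N, k, l,
and each pair is evaluated by `posQuot_reciprocity`. -/
theorem posSum₃_reciprocity {N k l : ℕ} (hN : N ≠ 0) (hk : k ≠ 0) (hl : l ≠ 0) :
    ((N : ℚ) + k + l) * (k * l * posSum₃ N k l / treeA N + N * l * posSum₃ k N l / treeA k +
        N * k * posSum₃ l N k / treeA l) =
      -2 * ((N : ℚ) + k + l) + l * (treeA (N + k) / (treeA N * treeA k)) +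
        k * (treeA (N + l) / (treeA N * treeA l)) + N * (treeA (k + l) / (treeA k * treeA l)) := by
  have hA := treeA_ne_zero N
  have hB := treeA_ne_zero k
  have hC := treeA_ne_zero l
  have e1 := mul_posSum₃ N k l
  have e2 := mul_posSum₃ k N l
  have e3 := mul_posSum₃ l N k
  have f1 := posQuot_reciprocity hN hk
  have f2 := posQuot_reciprocity hN hl
  have f3 := posQuot_reciprocity hk hl
  have f1' : treeA (N + k) = k * treeA k * posQuot N k + N * treeA N * posQuot k N +
      2 * (treeA N * treeA k) := by linear_combination -f1
  have f2' : treeA (N + l) = l * treeA l * posQuot N l + N * treeA N * posQuot l N +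
      2 * (treeA N * treeA l) := by linear_combination -f2
  have f3' : treeA (k + l) = l * treeA l * posQuot k l + k * treeA k * posQuot l k +
      2 * (treeA k * treeA l) := by linear_combination -f3
  have e5 : ((N : ℚ) + k + l) * (k * l * posSum₃ N k l / treeA N +
      N * l * posSum₃ k N l / treeA k + N * k * posSum₃ l N k / treeA l) =
      k * l * (posQuot N k + posQuot N l) / treeA N + N * l * (posQuot k N + posQuot k l) / treeA k
        + N * k * (posQuot l N + posQuot l k) / treeA l := by
    rw [← e1, ← e2, ← e3]
    ring
  rw [e5, f1', f2', f3']
  field_simp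
  ring

/-! ### Convolution of set functions -/

section Convolution

variable {ι : Type*} [DecidableEq ι]

/-- A subset with a marked element is the same as the element together with a subset of the rest;
this moves the sum over marked elements outside a convolution. -/
theorem sum_powerset_sum_mem {β : Type*} [AddCommMonoid β] (R : Finset ι)
    (F : ι → Finset ι → Finset ι → β) :
    ∑ S ∈ R.powerset, ∑ j ∈ S, F j (S.erase j) (R \ S) =
      ∑ j ∈ R, ∑ S ∈ (R.erase j).powerset, F j S (R.erase j \ S) := by
  rw [Finset.sum_sigma', Finset.sum_sigma']
  refine Finset.sum_bij' (fun x _ => ⟨x.2, x.1.erase x.2⟩) (fun x _ => ⟨insert x.1 x.2, x.1⟩)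
    ?_ ?_ ?_ ?_ ?_
  · rintro ⟨S, j⟩ h
    simp only [mem_sigma, mem_powerset] at h ⊢
    exact ⟨h.1 h.2, Finset.erase_subset_erase _ h.1⟩
  · rintro ⟨j, S⟩ h
    simp only [mem_sigma, mem_powerset] at h ⊢
    exact ⟨Finset.insert_subset h.1 (h.2.trans (Finset.erase_subset _ _)), mem_insert_self _ _⟩
  · rintro ⟨S, j⟩ h
    simp only [mem_sigma, mem_powerset] at h
    simp [Finset.insert_erase h.2]
  · rintro ⟨j, S⟩ h
    simp only [mem_sigma, mem_powerset] at h
    have : j ∉ S := fun hj => by simpa using h.2 hj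
    simp [Finset.erase_insert this]
  · rintro ⟨S, j⟩ h
    simp only [mem_sigma, mem_powerset] at h
    have : R.erase j \ S.erase j = R \ S := by
      ext i
      simp only [mem_sdiff, mem_erase]
      have := h.2
      constructor
      · rintro ⟨⟨h1, h2⟩, h3⟩
        exact ⟨h2, fun h4 => h3 ⟨h1, h4⟩⟩
      · rintro ⟨h1, h2⟩
        exact ⟨⟨fun h3 => h2 (h3 ▸ this), h1⟩, fun h3 => h2 h3.2⟩
    simp only [this]

theorem sum_powerset_compl {β : Type*} [AddCommMonoid β] (R : Finset ι)
    (f : Finset ι → Finset ι → β) :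
    ∑ S ∈ R.powerset, f S (R \ S) = ∑ S ∈ R.powerset, f (R \ S) S := by
  refine Finset.sum_nbij' (fun S => R \ S) (fun S => R \ S) ?_ ?_ ?_ ?_ ?_
  · simp
  · simp
  · intro S hS
    exact Finset.sdiff_sdiff_eq_self (mem_powerset.1 hS)
  · intro S hS
    exact Finset.sdiff_sdiff_eq_self (mem_powerset.1 hS)
  · intro S hS
    simp only [Finset.sdiff_sdiff_eq_self (mem_powerset.1 hS)]

theorem abelSet_eq_zpow (b : ι → ℚ) {x : ℚ} (hx : x ≠ 0) (I : Finset ι) :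
    abelSet b x I = x * (x + ∑ i ∈ I, b i) ^ ((I.card : ℤ) - 1) := by
  by_cases h0 : I = ∅
  · subst h0
    simp [abelSet, hx]
  · rw [abelSet, if_neg h0]
    have := Finset.card_pos.2 (Finset.nonempty_iff_ne_empty.2 h0)
    rw [← zpow_natCast, Nat.cast_sub (by omega)]
    simp

/-- `x ^ 2 (x + b_I) ^ (|I| - 2)` in terms of the Abel–Hurwitz set functions. -/
theorem sq_mul_zpow_eq (b : ι → ℚ) {x : ℚ} (hx : 0 < x) (I : Finset ι) (hb : ∀ i ∈ I, 0 < b i) :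
    x ^ 2 * (x + ∑ i ∈ I, b i) ^ ((I.card : ℤ) - 2) =
      abelSet b x I - ∑ j ∈ I, x * (b j / (x + b j)) * abelSet b (x + b j) (I.erase j) := by
  have hpos : 0 < x + ∑ i ∈ I, b i := 
    add_pos_of_pos_of_nonneg hx (Finset.sum_nonneg fun i hi => (hb i hi).le)
  -- Each subtracted term equals b_j · x (x + b_I)^(|I|-2), so the difference is x (x + b_I - b_I)(x
  -- + b_I)^(|I|-2).
  have h : ∀ j ∈ I, x * (b j / (x + b j)) * abelSet b (x + b j) (I.erase j) =
      b j * (x * (x + ∑ i ∈ I, b i) ^ ((I.card : ℤ) - 2)) := by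
    intro j hj
    have hxj : 0 < x + b j := add_pos hx (hb j hj)
    rw [abelSet_eq_zpow _ hxj.ne', add_assoc x, Finset.add_sum_erase _ _ hj,
      Finset.card_erase_of_mem hj, Nat.cast_sub (Finset.card_pos.2 ⟨j, hj⟩)]
    rw [show ((I.card : ℤ) - (1 : ℕ) - 1) = (I.card : ℤ) - 2 by push_cast; ring]
    field_simp
  rw [Finset.sum_congr rfl h, ← Finset.sum_mul, abelSet_eq_zpow _ hx.ne',
    show (I.card : ℤ) - 1 = (I.card : ℤ) - 2 + 1 by ring, zpow_add_one₀ hpos.ne']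
  ring

/-- The subset convolution of two functions `x ^ 2 (x + b_I) ^ (|I| - 2)`. -/
theorem sum_zpow_mul_zpow (b : ι → ℚ) {x y : ℚ} (hx : 0 < x) (hy : 0 < y) (R : Finset ι)
    (hb : ∀ i ∈ R, 0 < b i) :
    ∑ S ∈ R.powerset, (x ^ 2 * (x + ∑ i ∈ S, b i) ^ ((S.card : ℤ) - 2)) *
        (y ^ 2 * (y + ∑ i ∈ R \ S, b i) ^ (((R \ S).card : ℤ) - 2)) =
      abelSet b (x + y) R -
        ∑ j ∈ R, (x * (b j / (x + b j)) + y * (b j / (y + b j))) *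
          abelSet b (x + y + b j) (R.erase j) +
        ∑ j ∈ R, ∑ l ∈ R.erase j, x * (b j / (x + b j)) * (y * (b l / (y + b l))) *
          abelSet b (x + y + b j + b l) ((R.erase j).erase l) := by
  -- For a fixed marked element j the group law of the Abel–Hurwitz functions evaluates the
  -- convolution over the remaining elements.
  have conv : ∀ (z t : ℚ) (c : ι → ℚ) (Q : Finset ι),
      ∑ S ∈ Q.powerset, (∑ j ∈ S, c j * abelSet b (z + b j) (S.erase j)) * abelSet b t (Q \ S) =
        ∑ j ∈ Q, c j * abelSet b (z + t + b j) (Q.erase j) := by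
    intro z t c Q
    simp_rw [Finset.sum_mul]
    rw [sum_powerset_sum_mem Q
      (fun j S T => c j * abelSet b (z + b j) S * abelSet b t T)]
    refine Finset.sum_congr rfl fun j _ => ?_
    simp_rw [mul_assoc]
    rw [← Finset.mul_sum, sum_abelSet_mul_abelSet]
    congr 2
    ring
  have h1 : ∀ S ∈ R.powerset, (x ^ 2 * (x + ∑ i ∈ S, b i) ^ ((S.card : ℤ) - 2)) *
      (y ^ 2 * (y + ∑ i ∈ R \ S, b i) ^ (((R \ S).card : ℤ) - 2)) =
      abelSet b x S * abelSet b y (R \ S) -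
      (∑ j ∈ S, x * (b j / (x + b j)) * abelSet b (x + b j) (S.erase j)) * abelSet b y (R \ S) -
      (∑ l ∈ R \ S, y * (b l / (y + b l)) * abelSet b (y + b l) ((R \ S).erase l)) *
        abelSet b x S +
      (∑ j ∈ S, x * (b j / (x + b j)) * abelSet b (x + b j) (S.erase j)) *
        ∑ l ∈ R \ S, y * (b l / (y + b l)) * abelSet b (y + b l) ((R \ S).erase l) := by
    intro S hS
    rw [sq_mul_zpow_eq b hx S fun i hi => hb i (mem_powerset.1 hS hi),
      sq_mul_zpow_eq b hy (R \ S) fun i hi => hb i (mem_sdiff.1 hi).1]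
    ring
  rw [Finset.sum_congr rfl h1, Finset.sum_add_distrib, Finset.sum_sub_distrib,
    Finset.sum_sub_distrib, sum_abelSet_mul_abelSet, conv]
  rw [sum_powerset_compl R (fun S T => (∑ l ∈ T, y * (b l / (y + b l)) *
    abelSet b (y + b l) (T.erase l)) * abelSet b x S), conv]
  simp_rw [Finset.sum_mul]
  rw [sum_powerset_sum_mem R (fun j S T => x * (b j / (x + b j)) * abelSet b (x + b j) S *
    ∑ l ∈ T, y * (b l / (y + b l)) * abelSet b (y + b l) (T.erase l))]
  have h2 : ∀ j ∈ R, ∑ S ∈ (R.erase j).powerset, x * (b j / (x + b j)) * abelSet b (x + b j) S *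
      ∑ l ∈ R.erase j \ S, y * (b l / (y + b l)) * abelSet b (y + b l) ((R.erase j \ S).erase l) =
      ∑ l ∈ R.erase j, x * (b j / (x + b j)) * (y * (b l / (y + b l))) *
          abelSet b (x + y + b j + b l) ((R.erase j).erase l) := by
    intro j _
    rw [sum_powerset_compl (R.erase j) (fun S T => x * (b j / (x + b j)) * abelSet b (x + b j) S *
      ∑ l ∈ T, y * (b l / (y + b l)) * abelSet b (y + b l) (T.erase l))]
    have h3 : ∀ S ∈ (R.erase j).powerset,
        x * (b j / (x + b j)) * abelSet b (x + b j) (R.erase j \ S) *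
          ∑ l ∈ S, y * (b l / (y + b l)) * abelSet b (y + b l) (S.erase l) =
        x * (b j / (x + b j)) *
          ((∑ l ∈ S, y * (b l / (y + b l)) * abelSet b (y + b l) (S.erase l)) *
            abelSet b (x + b j) (R.erase j \ S)) := fun S _ => by ring
    rw [Finset.sum_congr rfl h3, ← Finset.mul_sum, conv, Finset.mul_sum]
    refine Finset.sum_congr rfl fun l _ => ?_
    rw [show y + (x + b j) + b l = x + y + b j + b l by ring]
    ring
  rw [Finset.sum_congr rfl h2, sub_sub, ← Finset.sum_add_distrib]
  congr 2
  refine Finset.sum_congr rfl fun j _ => ?_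
  rw [add_comm y x]
  ring

end Convolution

/-! ### The join-cut recursion for the genus zero formula -/

section GenusZero

/-- The genus zero Hurwitz number `n ^ (m - 3) ∏ (b ^ b / b!)`. -/
def genusZero (s : Multiset ℕ) : ℚ :=
  (s.sum : ℚ) ^ ((Multiset.card s : ℤ) - 3) * (s.map treeA).prod

theorem genusZero_map {ι : Type*} (S : Finset ι) (β : ι → ℕ) : genusZero (S.val.map β) =
    (∑ i ∈ S, (β i : ℚ)) ^ ((S.card : ℤ) - 3) * ∏ i ∈ S, treeA (β i) := by
  rw [genusZero, Multiset.map_map, Multiset.card_map]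
  change (((∑ i ∈ S, β i : ℕ) : ℚ)) ^ _ * _ = _
  push_cast
  rfl

theorem genusZero_cons_map {ι : Type*} (p : ℕ) (S : Finset ι) (β : ι → ℕ) :
    genusZero (p ::ₘ S.val.map β) =
      ((p : ℚ) + ∑ i ∈ S, (β i : ℚ)) ^ ((S.card : ℤ) - 2) *
        (treeA p * ∏ i ∈ S, treeA (β i)) := by
  rw [genusZero, Multiset.sum_cons, Multiset.map_cons, Multiset.prod_cons, Multiset.map_map,
    Multiset.card_cons, Multiset.card_map]
  change ((p + ∑ i ∈ S, β i : ℕ) : ℚ) ^ _ * _ = _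
  push_cast
  rw [show ((S.val.card : ℤ) + 1 - 3) = (S.card : ℤ) - 2 by rw [Finset.card_def]; ring]
  rfl

variable {ι : Type*} [DecidableEq ι]

theorem sum_offDiag_comm (M : Finset ι) (f : ι → ι → ℚ) :
    ∑ r ∈ M, ∑ s ∈ M.erase r, f r s = ∑ r ∈ M, ∑ s ∈ M.erase r, f s r := by
  refine Finset.sum_comm' fun r s => ?_
  simp only [mem_erase]
  tauto

theorem sum_offDiag_symm (M : Finset ι) (f : ι → ι → ℚ) :
    2 * ∑ r ∈ M, ∑ s ∈ M.erase r, f r s = ∑ r ∈ M, ∑ s ∈ M.erase r, (f r s + f s r) := by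
  simp_rw [Finset.sum_add_distrib]
  rw [← sum_offDiag_comm M f]
  ring

theorem sum_triples_swap_right (M : Finset ι) (f : ι → ι → ι → ℚ) :
    ∑ r ∈ M, ∑ s ∈ M.erase r, ∑ t ∈ (M.erase r).erase s, f r s t =
      ∑ r ∈ M, ∑ s ∈ M.erase r, ∑ t ∈ (M.erase r).erase s, f r t s :=
  Finset.sum_congr rfl fun r _ => sum_offDiag_comm (M.erase r) (f r)

theorem sum_triples_swap_left (M : Finset ι) (f : ι → ι → ι → ℚ) :
    ∑ r ∈ M, ∑ s ∈ M.erase r, ∑ t ∈ (M.erase r).erase s, f r s t =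
      ∑ r ∈ M, ∑ s ∈ M.erase r, ∑ t ∈ (M.erase r).erase s, f s r t := by
  rw [sum_offDiag_comm M (fun r s => ∑ t ∈ (M.erase r).erase s, f r s t)]
  refine Finset.sum_congr rfl fun r _ => Finset.sum_congr rfl fun s _ => ?_
  rw [Finset.erase_right_comm]

theorem sum_triples_symm (M : Finset ι) (f : ι → ι → ι → ℚ) :
    3 * ∑ r ∈ M, ∑ s ∈ M.erase r, ∑ t ∈ (M.erase r).erase s, f r s t =
      ∑ r ∈ M, ∑ s ∈ M.erase r, ∑ t ∈ (M.erase r).erase s,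
        (f r s t + f s r t + f t r s) := by
  simp_rw [Finset.sum_add_distrib]
  rw [← sum_triples_swap_left M f, sum_triples_swap_left M (fun r s t => f t r s),
    sum_triples_swap_right M (fun r s t => f t s r), sum_triples_swap_left M (fun r s t => f s t r),
    sum_triples_swap_right M (fun r s t => f r t s)]
  ring

theorem sum_erase_const_add (M : Finset ι) (b : ι → ℚ) {r : ι} (hr : r ∈ M) :
    ∑ s ∈ M.erase r, b s = ∑ s ∈ M, b s - b r := by
  rw [← Finset.add_sum_erase M b hr]
  ring

theorem card_erase_cast (M : Finset ι) {r : ι} (hr : r ∈ M) :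
    ((M.erase r).card : ℚ) = (M.card : ℚ) - 1 := by
  rw [Finset.card_erase_of_mem hr, Nat.cast_sub (Finset.card_pos.2 ⟨r, hr⟩)]
  simp

theorem sum_offDiag_fst (M : Finset ι) (b : ι → ℚ) :
    ∑ r ∈ M, ∑ _s ∈ M.erase r, b r = ((M.card : ℚ) - 1) * ∑ r ∈ M, b r := by
  rw [Finset.mul_sum]
  refine Finset.sum_congr rfl fun r hr => ?_
  rw [Finset.sum_const, nsmul_eq_mul, card_erase_cast M hr]

theorem sum_triples_fst (M : Finset ι) (b : ι → ℚ) :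
    ∑ r ∈ M, ∑ s ∈ M.erase r, ∑ _t ∈ (M.erase r).erase s, b r =
      ((M.card : ℚ) - 1) * ((M.card : ℚ) - 2) * ∑ r ∈ M, b r := by
  rw [Finset.mul_sum]
  refine Finset.sum_congr rfl fun r hr => ?_
  have : ∀ s ∈ M.erase r, ∑ _t ∈ (M.erase r).erase s, b r = ((M.card : ℚ) - 2) * b r := by
    intro s hs
    rw [Finset.sum_const, nsmul_eq_mul, card_erase_cast _ hs, card_erase_cast M hr]
    ring
  rw [Finset.sum_congr rfl this, Finset.sum_const, nsmul_eq_mul, card_erase_cast M hr]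
  ring

/-- The coefficient extracted from the pairs of components created by cutting a part. -/
theorem sum_posAnti_genusZero (M : Finset ι) (β : ι → ℕ) (hβ : ∀ i ∈ M, β i ≠ 0) {r : ι}
    (hr : r ∈ M) :
    ∑ p ∈ posAnti (β r), (p.1 : ℚ) * p.2 * ∑ S ∈ (M.erase r).powerset,
        genusZero (p.1 ::ₘ S.val.map β) * genusZero (p.2 ::ₘ ((M.erase r) \ S).val.map β) =
      (∏ i ∈ M, treeA (β i)) *
        ((∑ i ∈ M, (β i : ℚ)) ^ ((M.card : ℤ) - 2) * (2 * (1 - 1 / (β r : ℚ))) -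
        (∑ i ∈ M, (β i : ℚ)) ^ ((M.card : ℤ) - 3) * (2 * ∑ j ∈ M.erase r,
          ((β r : ℚ) + β j) * (β j * posSum₂ (β r) (β j) / treeA (β r))) +
        (∑ i ∈ M, (β i : ℚ)) ^ ((M.card : ℤ) - 4) * ∑ j ∈ M.erase r, ∑ l ∈ (M.erase r).erase j,
          ((β r : ℚ) + β j + β l) * (β j * β l * posSum₃ (β r) (β j) (β l) / treeA (β r))) := by
  set n : ℚ := ∑ i ∈ M, (β i : ℚ) with hn
  set R := M.erase r with hR
  have hβpos : ∀ i ∈ M, (0 : ℚ) < β i := fun i hi => by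
    exact_mod_cast Nat.pos_of_ne_zero (hβ i hi)
  have hRM : ∀ i ∈ R, i ∈ M := fun i hi => Finset.mem_of_mem_erase hi
  have hAr := treeA_ne_zero (β r)
  have hnR : (β r : ℚ) + ∑ i ∈ R, (β i : ℚ) = n := Finset.add_sum_erase M (fun i => (β i : ℚ)) hr
  have hcR : (R.card : ℤ) = M.card - 1 := by
    rw [hR, Finset.card_erase_of_mem hr, Nat.cast_sub (Finset.card_pos.2 ⟨r, hr⟩)]
    simp
  have hA : ∏ i ∈ M, treeA (β i) = treeA (β r) * ∏ i ∈ R, treeA (β i) :=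
    (Finset.mul_prod_erase M (fun i => treeA (β i)) hr).symm
  set A := ∏ i ∈ R, treeA (β i) with hAdef
  have hr0 : (β r : ℚ) ≠ 0 := (hβpos r hr).ne'
  -- With x = β_r plus the marked parts, the base of the power is always the total n, so the
  -- Abel–Hurwitz functions become powers of n.
  have e1 : abelSet (fun i => (β i : ℚ)) (β r) R = β r * n ^ ((M.card : ℤ) - 2) := by
    rw [abelSet_eq_zpow _ hr0, hnR, hcR]
    congr 2
    ring
  have e2 : ∀ j ∈ R, abelSet (fun i => (β i : ℚ)) ((β r : ℚ) + β j) (R.erase j) =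
      ((β r : ℚ) + β j) * n ^ ((M.card : ℤ) - 3) := by
    intro j hj
    have h0 : (β r : ℚ) + β j ≠ 0 := (add_pos (hβpos r hr) (hβpos j (hRM j hj))).ne'
    rw [abelSet_eq_zpow _ h0, add_assoc, Finset.add_sum_erase R (fun i => (β i : ℚ)) hj, hnR,
      Finset.card_erase_of_mem hj, Nat.cast_sub (Finset.card_pos.2 ⟨j, hj⟩), hcR]
    congr 2
    push_cast
    ring
  have e3 : ∀ j ∈ R, ∀ l ∈ R.erase j,
      abelSet (fun i => (β i : ℚ)) ((β r : ℚ) + β j + β l) ((R.erase j).erase l) =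
        ((β r : ℚ) + β j + β l) * n ^ ((M.card : ℤ) - 4) := by
    intro j hj l hl
    have hlR := Finset.mem_of_mem_erase hl
    have h0 : (β r : ℚ) + β j + β l ≠ 0 :=
      (add_pos (add_pos (hβpos r hr) (hβpos j (hRM j hj))) (hβpos l (hRM l hlR))).ne'
    have a1 := Finset.add_sum_erase (R.erase j) (fun i => (β i : ℚ)) hl
    have a2 := Finset.add_sum_erase R (fun i => (β i : ℚ)) hj
    have a3 : (β r : ℚ) + β j + β l + ∑ i ∈ (R.erase j).erase l, (β i : ℚ) = n := by
      rw [← hnR, ← a2, ← a1]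
      ring
    rw [abelSet_eq_zpow _ h0, a3,
      Finset.card_erase_of_mem hl, Finset.card_erase_of_mem hj,
      Nat.cast_sub, Nat.cast_sub (Finset.card_pos.2 ⟨j, hj⟩), hcR]
    · congr 2
      push_cast
      ring
    · rw [← Finset.card_erase_of_mem hj]
      exact Finset.card_pos.2 ⟨l, hl⟩
  have key : ∀ p ∈ posAnti (β r), (p.1 : ℚ) * p.2 * ∑ S ∈ R.powerset,
      genusZero (p.1 ::ₘ S.val.map β) * genusZero (p.2 ::ₘ (R \ S).val.map β) =
      A * (β r * n ^ ((M.card : ℤ) - 2) * (treeA p.1 * treeA p.2 / (p.1 * p.2)) -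
        n ^ ((M.card : ℤ) - 3) * ∑ j ∈ R, ((β r : ℚ) + β j) * β j *
          (treeA p.1 * treeA p.2 / (p.2 * ((p.1 : ℚ) + β j)) +
            treeA p.2 * treeA p.1 / (p.1 * ((p.2 : ℚ) + β j))) +
        n ^ ((M.card : ℤ) - 4) * ∑ j ∈ R, ∑ l ∈ R.erase j, ((β r : ℚ) + β j + β l) *
          (β j * β l) * (treeA p.1 * treeA p.2 / (((p.1 : ℚ) + β j) * ((p.2 : ℚ) + β l)))) := by
    rintro ⟨p, q⟩ hp
    obtain ⟨hs, hp1, hp2⟩ := mem_posAnti.1 hp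
    simp only at hs hp1 hp2 ⊢
    have hp0 : (0 : ℚ) < p := by exact_mod_cast Nat.pos_of_ne_zero hp1
    have hq0 : (0 : ℚ) < q := by exact_mod_cast Nat.pos_of_ne_zero hp2
    have hs' : (p : ℚ) + q = β r := by exact_mod_cast hs
    have h1 := sum_zpow_mul_zpow (fun i => (β i : ℚ)) hp0 hq0 R fun i hi => hβpos i (hRM i hi)
    rw [hs', e1] at h1
    -- Writing pq as p²q²/(pq) supplies the squares required by `sum_zpow_mul_zpow`.
    have h2 : (p : ℚ) * q * ∑ S ∈ R.powerset,
        genusZero (p ::ₘ S.val.map β) * genusZero (q ::ₘ (R \ S).val.map β) =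
        A * (treeA p * treeA q / (p * q)) * ∑ S ∈ R.powerset,
          ((p : ℚ) ^ 2 * (p + ∑ i ∈ S, (β i : ℚ)) ^ ((S.card : ℤ) - 2)) *
          ((q : ℚ) ^ 2 * (q + ∑ i ∈ R \ S, (β i : ℚ)) ^ (((R \ S).card : ℤ) - 2)) := by
      rw [Finset.mul_sum, Finset.mul_sum]
      refine Finset.sum_congr rfl fun S hS => ?_
      rw [genusZero_cons_map, genusZero_cons_map, hAdef,
        ← Finset.prod_sdiff (mem_powerset.1 hS)]
      field_simp
    rw [h2, h1, mul_assoc]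
    congr 1
    rw [mul_add, mul_sub, Finset.mul_sum, Finset.mul_sum, Finset.mul_sum, Finset.mul_sum]
    congr 1
    · congr 1
      · ring
      · refine Finset.sum_congr rfl fun j hj => ?_
        have := hβpos j (hRM j hj)
        rw [e2 j hj]
        field_simp
    · refine Finset.sum_congr rfl fun j hj => ?_
      rw [Finset.mul_sum, Finset.mul_sum]
      refine Finset.sum_congr rfl fun l hl => ?_
      have := hβpos j (hRM j hj)
      have := hβpos l (hRM l (Finset.mem_of_mem_erase hl))
      rw [e3 j hj l hl]
      field_simp
  have s2 : ∀ j, ∑ p ∈ posAnti (β r), treeA p.2 * treeA p.1 / (p.1 * ((p.2 : ℚ) + β j)) =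
      posSum₂ (β r) (β j) := by
    intro j
    rw [posSum₂, ← sum_posAnti_swap]
    rfl
  rw [Finset.sum_congr rfl key, ← Finset.mul_sum, Finset.sum_add_distrib, Finset.sum_sub_distrib,
    ← Finset.mul_sum, ← Finset.mul_sum, ← Finset.mul_sum, sum_posAnti_one (hβ r hr), hA,
    Finset.sum_comm, Finset.sum_comm (s := posAnti (β r)) (t := R)]
  simp_rw [← Finset.mul_sum, Finset.sum_add_distrib, s2]
  have t3 : ∀ j, ∑ p ∈ posAnti (β r), ∑ l ∈ R.erase j, ((β r : ℚ) + β j + β l) *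
      (β j * β l) * (treeA p.1 * treeA p.2 / (((p.1 : ℚ) + β j) * ((p.2 : ℚ) + β l))) =
      ∑ l ∈ R.erase j, ((β r : ℚ) + β j + β l) * (β j * β l) * posSum₃ (β r) (β j) (β l) := by
    intro j
    rw [Finset.sum_comm]
    simp_rw [← Finset.mul_sum]
    rfl
  simp_rw [t3]
  change A * (_ - _ * ∑ j ∈ R, ((β r : ℚ) + β j) * β j *
    (posSum₂ (β r) (β j) + posSum₂ (β r) (β j)) + _) = _
  have u2 : 2 * ∑ j ∈ R, ((β r : ℚ) + β j) * (β j * posSum₂ (β r) (β j) / treeA (β r)) =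
      (1 / treeA (β r)) * ∑ j ∈ R, ((β r : ℚ) + β j) * β j *
        (posSum₂ (β r) (β j) + posSum₂ (β r) (β j)) := by
    rw [Finset.mul_sum, Finset.mul_sum]
    refine Finset.sum_congr rfl fun j _ => ?_
    ring
  have u3 : ∑ j ∈ R, ∑ l ∈ R.erase j,
      ((β r : ℚ) + β j + β l) * (β j * β l * posSum₃ (β r) (β j) (β l) / treeA (β r)) =
      (1 / treeA (β r)) * ∑ j ∈ R, ∑ l ∈ R.erase j,
        ((β r : ℚ) + β j + β l) * (β j * β l) * posSum₃ (β r) (β j) (β l) := by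
    rw [Finset.mul_sum]
    refine Finset.sum_congr rfl fun j _ => ?_
    rw [Finset.mul_sum]
    refine Finset.sum_congr rfl fun l _ => ?_
    ring
  rw [u2, u3]
  generalize ∑ j ∈ R, ((β r : ℚ) + β j) * β j * (posSum₂ (β r) (β j) + posSum₂ (β r) (β j)) = X
  generalize ∑ j ∈ R, ∑ l ∈ R.erase j,
    ((β r : ℚ) + β j + β l) * (β j * β l) * posSum₃ (β r) (β j) (β l) = Y
  field_simp

/-- Summing the cut terms over r leaves sums over ordered pairs and triples of parts, which are
replaced by their symmetrizations. The resulting terms in a_(β_r+β_s) cancel against the join terms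
and against each other, as do the terms with 1/β_r, and 2 n^(m-3) (n + m - 2) remains. -/
theorem genusZero_recursion (M : Finset ι) (β : ι → ℕ) (hβ : ∀ i ∈ M, β i ≠ 0)
    (hM : M.Nonempty) :
    2 * (∑ i ∈ M, (β i : ℚ) + M.card - 2) * genusZero (M.val.map β) =
      ∑ r ∈ M, ∑ s ∈ M.erase r, ((β r : ℚ) + β s) *
        genusZero ((β r + β s) ::ₘ ((M.erase r).erase s).val.map β) +
      ∑ r ∈ M, ∑ p ∈ posAnti (β r), (p.1 : ℚ) * p.2 * ∑ S ∈ (M.erase r).powerset,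
        genusZero (p.1 ::ₘ S.val.map β) * genusZero (p.2 ::ₘ ((M.erase r) \ S).val.map β) := by
  set n : ℚ := ∑ i ∈ M, (β i : ℚ) with hn
  set m : ℚ := (M.card : ℚ) with hm
  set A := ∏ i ∈ M, treeA (β i) with hA
  have hβpos : ∀ i ∈ M, (0 : ℚ) < β i := fun i hi => by
    exact_mod_cast Nat.pos_of_ne_zero (hβ i hi)
  have hn0 : n ≠ 0 := (Finset.sum_pos hβpos hM).ne'
  set e : ι → ι → ℚ := fun r s => treeA (β r + β s) / (treeA (β r) * treeA (β s)) with he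
  set s2 : ι → ι → ℚ := fun r j => β j * posSum₂ (β r) (β j) / treeA (β r) with hs2
  set s3 : ι → ι → ι → ℚ := fun r j l => β j * β l * posSum₃ (β r) (β j) (β l) / treeA (β r)
    with hs3
  have hcut : ∀ r ∈ M, ∀ s ∈ M.erase r, ((β r : ℚ) + β s) *
      genusZero ((β r + β s) ::ₘ ((M.erase r).erase s).val.map β) =
      A * n ^ ((M.card : ℤ) - 4) * (((β r : ℚ) + β s) * e r s) := by
    intro r hr s hs
    rw [genusZero_cons_map, Finset.card_erase_of_mem hs, Finset.card_erase_of_mem hr, hA,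
      ← Finset.mul_prod_erase M _ hr, ← Finset.mul_prod_erase (M.erase r) _ hs]
    have h1 : ((β r + β s : ℕ) : ℚ) + ∑ i ∈ (M.erase r).erase s, (β i : ℚ) = n := by
      rw [hn, ← Finset.add_sum_erase M _ hr, ← Finset.add_sum_erase (M.erase r) _ hs]
      push_cast
      ring
    have h2 : ((M.card - 1 - 1 : ℕ) : ℤ) - 2 = (M.card : ℤ) - 4 := by
      have h3 := Finset.card_pos.2 ⟨s, hs⟩
      rw [Finset.card_erase_of_mem hr] at h3
      omega
    have h4 := treeA_ne_zero (β r)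
    have h5 := treeA_ne_zero (β s)
    rw [h1, h2]
    simp only [he]
    field_simp
  rw [genusZero_map, Finset.sum_congr rfl fun r hr => Finset.sum_congr rfl (hcut r hr),
    Finset.sum_congr (s₁ := M) rfl fun r hr => sum_posAnti_genusZero M β hβ hr]
  rw [← Finset.mul_sum, Finset.sum_add_distrib, Finset.sum_sub_distrib, ← Finset.mul_sum,
    ← Finset.mul_sum, ← Finset.mul_sum, ← Finset.mul_sum, ← Finset.mul_sum]
  have hc : ∑ r ∈ M, ∑ s ∈ M.erase r, A * n ^ ((M.card : ℤ) - 4) * (((β r : ℚ) + β s) * e r s) =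
      A * n ^ ((M.card : ℤ) - 4) * ∑ r ∈ M, ∑ s ∈ M.erase r, ((β r : ℚ) + β s) * e r s := by
    simp_rw [Finset.mul_sum]
  rw [hc]
  set σ : ℚ := ∑ r ∈ M, 1 / (β r : ℚ) with hσ
  have t1 : ∑ r ∈ M, (1 - 1 / (β r : ℚ)) = m - σ := by
    rw [Finset.sum_sub_distrib]
    simp [hm, hσ]
  -- Exchanging r and j pairs each term with the one needed in `posSum₂_reciprocity`.
  have t2 : 2 * ∑ r ∈ M, ∑ j ∈ M.erase r, ((β r : ℚ) + β j) * s2 r j =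
      2 * (m - 1) * n - 2 * m * (m - 1) - 2 * n * σ + 2 * m +
        ∑ r ∈ M, ∑ j ∈ M.erase r, e r j := by
    rw [sum_offDiag_symm M (fun r j => ((β r : ℚ) + β j) * s2 r j)]
    have h1 : ∀ r ∈ M, ∀ j ∈ M.erase r, ((β r : ℚ) + β j) * s2 r j + ((β j : ℚ) + β r) * s2 j r =
        (β r + β j - 2 - ((1 / (β r : ℚ)) * β j + (1 / (β j : ℚ)) * β r)) + e r j := by
      intro r hr j hj
      have := posSum₂_reciprocity (hβ r hr) (hβ j (Finset.mem_of_mem_erase hj))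
      have h1 := (hβpos r hr).ne'
      have h2 := (hβpos j (Finset.mem_of_mem_erase hj)).ne'
      have h3 : ((β r : ℚ) + β j) * (1 - 1 / (β r : ℚ) - 1 / β j) =
          (β r + β j - 2 - ((1 / (β r : ℚ)) * β j + (1 / (β j : ℚ)) * β r)) := by
        field_simp
        ring
      rw [h3] at this
      simp only [hs2, he]
      rw [← this]
      ring
    rw [Finset.sum_congr rfl fun r hr => Finset.sum_congr rfl (h1 r hr)]
    simp_rw [Finset.sum_add_distrib]
    congr 1
    have h2 : ∑ r ∈ M, ∑ j ∈ M.erase r, (β r : ℚ) = (m - 1) * n := sum_offDiag_fst M _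
    have h3 : ∑ r ∈ M, ∑ j ∈ M.erase r, (β j : ℚ) = (m - 1) * n := by
      rw [sum_offDiag_comm M (fun r j => (β j : ℚ)), h2]
    have h4 : ∑ r ∈ M, ∑ j ∈ M.erase r, (2 : ℚ) = 2 * m * (m - 1) := by
      rw [sum_offDiag_fst M (fun _ => 2)]
      simp [hm]
      ring
    have h5 : ∑ r ∈ M, ∑ j ∈ M.erase r, (1 / (β r : ℚ)) * β j = n * σ - m := by
      have : ∀ r ∈ M, ∑ j ∈ M.erase r, (1 / (β r : ℚ)) * β j = n * (1 / (β r : ℚ)) - 1 := by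
        intro r hr
        rw [← Finset.mul_sum, sum_erase_const_add M (fun j => (β j : ℚ)) hr]
        rw [← hn]
        have := (hβpos r hr).ne'
        field_simp
      rw [Finset.sum_congr rfl this, Finset.sum_sub_distrib, ← Finset.mul_sum]
      simp [hm, hσ]
    have h6 : ∑ r ∈ M, ∑ j ∈ M.erase r, (1 / (β j : ℚ)) * β r = n * σ - m := by
      rw [sum_offDiag_comm M (fun r j => (1 / (β j : ℚ)) * β r), h5]
    simp_rw [Finset.sum_sub_distrib, Finset.sum_add_distrib]
    rw [h2, h3, h4, h5, h6]
    ring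
  have t3 : ∑ r ∈ M, ∑ j ∈ M.erase r, ∑ l ∈ (M.erase r).erase j,
      ((β r : ℚ) + β j + β l) * s3 r j l = -2 * ((m - 1) * (m - 2) * n) +
        (n * ∑ r ∈ M, ∑ j ∈ M.erase r, e r j -
          ∑ r ∈ M, ∑ j ∈ M.erase r, ((β r : ℚ) + β j) * e r j) := by
    -- The sum over ordered triples is averaged over which of the three parts is the one being cut;
    -- this produces the left side of `posSum₃_reciprocity`.
    refine mul_left_cancel₀ (show (3 : ℚ) ≠ 0 by norm_num) ?_
    rw [sum_triples_symm M (fun r j l => ((β r : ℚ) + β j + β l) * s3 r j l)]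
    have h1 : ∀ r ∈ M, ∀ j ∈ M.erase r, ∀ l ∈ (M.erase r).erase j,
        ((β r : ℚ) + β j + β l) * s3 r j l + ((β j : ℚ) + β r + β l) * s3 j r l +
          ((β l : ℚ) + β r + β j) * s3 l r j =
        -2 * ((β r : ℚ) + β j + β l) + β l * e r j + β j * e r l + β r * e j l := by
      intro r hr j hj l hl
      have hl' := Finset.mem_of_mem_erase hl
      have := posSum₃_reciprocity (hβ r hr) (hβ j (Finset.mem_of_mem_erase hj))
        (hβ l (Finset.mem_of_mem_erase hl'))
      simp only [hs3, he]
      rw [← this]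
      ring
    rw [Finset.sum_congr rfl fun r hr => Finset.sum_congr rfl fun j hj =>
      Finset.sum_congr rfl (h1 r hr j hj)]
    simp_rw [Finset.sum_add_distrib, ← Finset.mul_sum, Finset.sum_add_distrib]
    have a1 : ∑ r ∈ M, ∑ j ∈ M.erase r, ∑ l ∈ (M.erase r).erase j, (β r : ℚ) =
        (m - 1) * (m - 2) * n := sum_triples_fst M _
    have a2 : ∑ r ∈ M, ∑ j ∈ M.erase r, ∑ l ∈ (M.erase r).erase j, (β j : ℚ) =
        (m - 1) * (m - 2) * n := by
      rw [sum_triples_swap_left M (fun r j l => (β j : ℚ)), a1]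
    have a3 : ∑ r ∈ M, ∑ j ∈ M.erase r, ∑ l ∈ (M.erase r).erase j, (β l : ℚ) =
        (m - 1) * (m - 2) * n := by
      rw [sum_triples_swap_right M (fun r j l => (β l : ℚ)), a2]
    have b1 : ∑ r ∈ M, ∑ j ∈ M.erase r, ∑ l ∈ (M.erase r).erase j, (β l : ℚ) * e r j =
        n * ∑ r ∈ M, ∑ j ∈ M.erase r, e r j -
          ∑ r ∈ M, ∑ j ∈ M.erase r, ((β r : ℚ) + β j) * e r j := by
      rw [Finset.mul_sum, ← Finset.sum_sub_distrib]
      refine Finset.sum_congr rfl fun r hr => ?_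
      rw [Finset.mul_sum, ← Finset.sum_sub_distrib]
      refine Finset.sum_congr rfl fun j hj => ?_
      rw [← Finset.sum_mul, sum_erase_const_add _ (fun l => (β l : ℚ)) hj,
        sum_erase_const_add _ (fun l => (β l : ℚ)) hr]
      ring
    have b2 : ∑ r ∈ M, ∑ j ∈ M.erase r, ∑ l ∈ (M.erase r).erase j, (β j : ℚ) * e r l =
        n * ∑ r ∈ M, ∑ j ∈ M.erase r, e r j -
          ∑ r ∈ M, ∑ j ∈ M.erase r, ((β r : ℚ) + β j) * e r j := by
      rw [sum_triples_swap_right M (fun r j l => (β j : ℚ) * e r l), b1]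
    have b3 : ∑ r ∈ M, ∑ j ∈ M.erase r, ∑ l ∈ (M.erase r).erase j, (β r : ℚ) * e j l =
        n * ∑ r ∈ M, ∑ j ∈ M.erase r, e r j -
          ∑ r ∈ M, ∑ j ∈ M.erase r, ((β r : ℚ) + β j) * e r j := by
      rw [sum_triples_swap_left M (fun r j l => (β r : ℚ) * e j l), b2]
    simp_rw [← Finset.mul_sum] at b3 ⊢
    simp_rw [← Finset.mul_sum] at b2
    rw [a1, a2, a3, b1, b2, b3]
    ring
  rw [t1, t2, t3]
  -- All powers are expressed through n^(m-4). The exponent may be negative, which is harmless since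
  -- n ≠ 0.
  have z4 : n ^ ((M.card : ℤ) - 3) = n ^ ((M.card : ℤ) - 4) * n := by
    rw [← zpow_add_one₀ hn0]
    congr 1
    ring
  have z3 : n ^ ((M.card : ℤ) - 2) = n ^ ((M.card : ℤ) - 4) * n * n := by
    rw [← zpow_add_one₀ hn0, ← zpow_add_one₀ hn0]
    congr 1
    ring
  rw [z3, z4]
  ring

end GenusZero

/-! ### Sums over lists of letters -/

section ListSum

variable {α : Type*}

/-- The sum of `F` over all words of length `j` with letters in `s`. -/
def listSum (s : Finset α) : ℕ → (List α → ℚ) → ℚ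
  | 0, F => F []
  | j + 1, F => ∑ x ∈ s, listSum s j fun l => F (x :: l)

theorem listSum_congr {s : Finset α} : ∀ {j : ℕ} {F G : List α → ℚ},
    (∀ l : List α, (∀ x ∈ l, x ∈ s) → F l = G l) → listSum s j F = listSum s j G
  | 0, _, _, h => h [] (by simp)
  | j + 1, F, G, h => by
    refine Finset.sum_congr rfl fun x hx => listSum_congr fun l hl => h _ ?_
    simpa [hx] using hl

theorem listSum_zero (s : Finset α) : ∀ j : ℕ, listSum s j (fun _ => 0) = 0
  | 0 => rfl
  | j + 1 => by simp only [listSum, listSum_zero s j, Finset.sum_const_zero]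

theorem listSum_add (s : Finset α) : ∀ (j : ℕ) (F G : List α → ℚ),
    listSum s j (fun l => F l + G l) = listSum s j F + listSum s j G
  | 0, _, _ => rfl
  | j + 1, F, G => by simp only [listSum, listSum_add s j, Finset.sum_add_distrib]

theorem listSum_sum {κ : Type*} (t : Finset κ) (s : Finset α) : ∀ (j : ℕ) (F : κ → List α → ℚ),
    listSum s j (fun l => ∑ i ∈ t, F i l) = ∑ i ∈ t, listSum s j (F i)
  | 0, _ => rfl
  | j + 1, F => by
    simp only [listSum, listSum_sum t s j]
    exact Finset.sum_comm

theorem listSum_of_subset {s s' : Finset α} (hs : s' ⊆ s) : ∀ {j : ℕ} {F : List α → ℚ},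
    (∀ l : List α, (∃ x ∈ l, x ∉ s') → F l = 0) → listSum s j F = listSum s' j F
  | 0, _, _ => rfl
  | j + 1, F, h => by
    simp only [listSum]
    rw [← Finset.sum_subset hs]
    · refine Finset.sum_congr rfl fun x _ => listSum_of_subset hs fun l hl => h _ ?_
      obtain ⟨y, hy, hys⟩ := hl
      exact ⟨y, List.mem_cons_of_mem _ hy, hys⟩
    · intro x _ hx
      rw [← listSum_zero s j]
      exact listSum_congr fun l _ => h _ ⟨x, by simp, hx⟩

/-- Words with letters in a disjoint union, counted by their subwords. -/
theorem listSum_shuffle [DecidableEq α] {s t : Finset α} (p : α → Bool)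
    (hs : ∀ x ∈ s, p x = true) (ht : ∀ x ∈ t, p x = false) : ∀ (j : ℕ) (F G : List α → ℚ),
    listSum (s ∪ t) j (fun l => F (l.filter p) * G (l.filter fun x => !p x)) =
      ∑ i ∈ antidiagonal j, (j.choose i.1 : ℚ) * (listSum s i.1 F * listSum t i.2 G)
  | 0, F, G => by simp [listSum]
  | j + 1, F, G => by
    have hdisj : Disjoint s t := by
      rw [Finset.disjoint_left]
      intro x hx hx'
      have := ht x hx'
      rw [hs x hx] at this
      exact Bool.noConfusion this
    simp only [listSum]
    rw [Finset.sum_union hdisj, Finset.sum_antidiagonal_choose_succ_mul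
      (fun a b => listSum s a F * listSum t b G), add_comm]
    congr 1
    · have h1 : ∀ x ∈ t, listSum (s ∪ t) j
          (fun l => F ((x :: l).filter p) * G ((x :: l).filter fun x => !p x)) =
          ∑ i ∈ antidiagonal j, (j.choose i.1 : ℚ) *
            (listSum s i.1 F * listSum t i.2 fun l => G (x :: l)) := by
        intro x hx
        rw [← listSum_shuffle p hs ht j F fun l => G (x :: l)]
        refine listSum_congr fun l _ => ?_
        simp [ht x hx]
      rw [Finset.sum_congr rfl h1, Finset.sum_comm]
      refine Finset.sum_congr rfl fun i _ => ?_
      simp only [listSum, Finset.mul_sum]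
    · have h1 : ∀ x ∈ s, listSum (s ∪ t) j
          (fun l => F ((x :: l).filter p) * G ((x :: l).filter fun x => !p x)) =
          ∑ i ∈ antidiagonal j, (j.choose i.1 : ℚ) *
            (listSum s i.1 (fun l => F (x :: l)) * listSum t i.2 G) := by
        intro x hx
        rw [← listSum_shuffle p hs ht j (fun l => F (x :: l)) G]
        refine listSum_congr fun l _ => ?_
        simp [hs x hx]
      rw [Finset.sum_congr rfl h1, Finset.sum_comm]
      refine Finset.sum_congr rfl fun i hi => ?_
      rw [HasAntidiagonal.mem_antidiagonal] at hi
      simp only [listSum, Finset.sum_mul, Finset.mul_sum]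
      rw [← hi, Nat.choose_symm_add]

/-- Each letter in the image has c preimages, so a word of length j has c^j. The values used are c =
1 for relabelling and c = 2 for passing from ordered pairs to transpositions. -/
theorem listSum_map {γ : Type*} [DecidableEq γ] (φ : α → γ) (c : ℕ) {s : Finset α}
    (hc : ∀ y ∈ s.image φ, (s.filter fun x => φ x = y).card = c) :
    ∀ (j : ℕ) (F : List γ → ℚ),
      listSum s j (fun l => F (l.map φ)) = (c : ℚ) ^ j * listSum (s.image φ) j F
  | 0, F => by simp [listSum]
  | j + 1, F => by
    simp only [listSum, List.map_cons]
    have h1 : ∀ x ∈ s, listSum s j (fun l => F (φ x :: l.map φ)) =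
        (c : ℚ) ^ j * listSum (s.image φ) j fun l => F (φ x :: l) := fun x _ =>
      listSum_map φ c hc j fun l => F (φ x :: l)
    rw [Finset.sum_congr rfl h1, ← Finset.mul_sum, ← Finset.sum_fiberwise_of_maps_to
      (g := φ) (t := s.image φ) (fun x hx => Finset.mem_image_of_mem φ hx), Finset.mul_sum,
      Finset.mul_sum]
    refine Finset.sum_congr rfl fun y hy => ?_
    have h2 : ∀ x ∈ s.filter (fun x => φ x = y), listSum (s.image φ) j (fun l => F (φ x :: l)) =
        listSum (s.image φ) j fun l => F (y :: l) := by
      intro x hx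
      rw [(Finset.mem_filter.1 hx).2]
    rw [Finset.sum_congr rfl h2, Finset.sum_const, hc y hy, nsmul_eq_mul, pow_succ]
    ring

theorem listSum_eq_sum_ofFn (s : Finset α) : ∀ (j : ℕ) (F : List α → ℚ),
    listSum s j F = ∑ σ ∈ Fintype.piFinset (fun _ : Fin j => s), F (List.ofFn σ)
  | 0, F => by simp [listSum]
  | j + 1, F => by
    simp only [listSum, listSum_eq_sum_ofFn s j]
    rw [Finset.sum_sigma']
    refine Finset.sum_nbij' (fun x => Fin.cons x.1 x.2) (fun σ => ⟨σ 0, Fin.tail σ⟩) ?_ ?_ ?_ ?_ ?_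
    · rintro ⟨x, σ⟩ h
      simp only [mem_sigma, Fintype.mem_piFinset] at h ⊢
      intro i
      refine Fin.cases ?_ (fun i => ?_) i
      · exact h.1
      · exact h.2 i
    · intro σ h
      simp only [mem_sigma, Fintype.mem_piFinset] at h ⊢
      exact ⟨h 0, fun i => h i.succ⟩
    · rintro ⟨x, σ⟩ _
      simp
    · intro σ _
      exact Fin.cons_self_tail σ
    · rintro ⟨x, σ⟩ _
      simp

end ListSum

/-! ### Counting connected factorizations -/

section Count

variable {X : Type*} [DecidableEq X]

/-- The product of the transpositions given by a list of pairs. -/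
def swapProd (l : List (X × X)) : Equiv.Perm X := (l.map fun x => Equiv.swap x.1 x.2).prod

theorem swapProd_cons (x : X × X) (l : List (X × X)) :
    swapProd (x :: l) = Equiv.swap x.1 x.2 * swapProd l := by
  simp [swapProd]

/-- A set is closed for a list of edges if no edge leaves it. -/
def EdgeClosed (l : List (X × X)) (S : Set X) : Prop := ∀ x ∈ l, x.1 ∈ S ↔ x.2 ∈ S

/-- The edges in `l` connect the points of `A`. -/
def Conn (A : Finset X) (l : List (X × X)) : Prop :=
  ∀ S : Set X, EdgeClosed l S → (∃ a ∈ A, a ∈ S) → ∀ a ∈ A, a ∈ S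

open Classical in
/-- The number of lists of `j` pairs of distinct points of `A` that connect `A` and for which the
product of the transpositions agrees with `π` on `A`. -/
def cnt (A : Finset X) (j : ℕ) (π : Equiv.Perm X) : ℚ :=
  listSum A.offDiag j fun l => if (∀ y ∈ A, swapProd l y = π y) ∧ Conn A l then 1 else 0

omit [DecidableEq X] in
theorem EdgeClosed.cons_iff {x : X × X} {l : List (X × X)} {S : Set X} :
    EdgeClosed (x :: l) S ↔ (x.1 ∈ S ↔ x.2 ∈ S) ∧ EdgeClosed l S := by
  simp [EdgeClosed]

/-- The part of a list of edges inside or outside `B`. -/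
def edgesIn (B : Finset X) (l : List (X × X)) : List (X × X) := l.filter fun x => x.1 ∈ B

/-- The part of a list of edges outside `B`. -/
def edgesOut (B : Finset X) (l : List (X × X)) : List (X × X) :=
  l.filter fun x => !decide (x.1 ∈ B)

/-- Removing the first edge from a connected list of edges. -/
theorem conn_cons_iff {A : Finset X} {x : X × X} {l : List (X × X)} (hx : x ∈ A.offDiag)
    (hl : ∀ y ∈ l, y ∈ A.offDiag) (hn : ¬ Conn A l) : Conn A (x :: l) ↔
      ∃ B ⊆ A, x.1 ∈ B ∧ x.2 ∉ B ∧ EdgeClosed l (B : Set X) ∧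
        Conn B (edgesIn B l) ∧ Conn (A \ B) (edgesOut B l) := by
  classical
  rw [mem_offDiag] at hx
  constructor
  · intro hc
    -- B is the connected component of x.1 in the graph with edge list l.
    set B : Finset X := A.filter fun y => ∀ S : Set X, EdgeClosed l S → x.1 ∈ S → y ∈ S with hB
    have hBA : B ⊆ A := Finset.filter_subset _ _
    have h1 : x.1 ∈ B := mem_filter.2 ⟨hx.1, fun S _ h => h⟩
    have hmin : ∀ S : Set X, EdgeClosed l S → x.1 ∈ S → ∀ y ∈ B, y ∈ S :=
      fun S hS h y hy => (mem_filter.1 hy).2 S hS h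
    have hcl : EdgeClosed l (B : Set X) := by
      intro y hy
      have hyA := mem_offDiag.1 (hl y hy)
      simp only [hB, Finset.mem_coe, mem_filter]
      constructor
      · rintro ⟨_, h⟩
        exact ⟨hyA.2.1, fun S hS h' => (hS y hy).1 (h S hS h')⟩
      · rintro ⟨_, h⟩
        exact ⟨hyA.1, fun S hS h' => (hS y hy).2 (h S hS h')⟩
    have hin : Conn B (edgesIn B l) := by
      intro S hS
      rintro ⟨b, hbB, hbS⟩
      have hS' : ∀ y ∈ l, y.1 ∈ B → (y.1 ∈ S ↔ y.2 ∈ S) := fun y hy hyB =>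
        hS y (List.mem_filter.2 ⟨hy, by simpa using hyB⟩)
      have hcl' : ∀ y ∈ l, y.1 ∈ B ↔ y.2 ∈ B := hcl
      have hx1 : x.1 ∈ S := by
        by_contra hx1
        refine hmin {y | y ∈ B → y ∉ S} ?_ (fun _ => hx1) b hbB hbB hbS
        intro y hy
        simp only [Set.mem_ofPred_eq]
        have := hS' y hy
        have := hcl' y hy
        tauto
      intro y hy
      refine hmin {y | y ∈ B → y ∈ S} ?_ (fun _ => hx1) y hy hy
      intro y hy
      simp only [Set.mem_ofPred_eq]
      have := hS' y hy
      have := hcl' y hy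
      tauto
    -- Otherwise B would be closed for all edges of x :: l, hence would contain A, and l alone would
    -- connect A.
    have h2 : x.2 ∉ B := by
      intro h2
      have hAB : ∀ a ∈ A, a ∈ (B : Set X) :=
        hc _ (EdgeClosed.cons_iff.2 ⟨⟨fun _ => h2, fun _ => h1⟩, hcl⟩) ⟨x.1, hx.1, h1⟩
      apply hn
      rintro S hS ⟨a, haA, haS⟩ b hb
      exact hin S (fun y hy => hS y (List.mem_filter.1 hy).1) ⟨a, hAB a haA, haS⟩ b (hAB b hb)
    refine ⟨B, hBA, h1, h2, hcl, hin, ?_⟩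
    rintro S hS ⟨a, haA, haS⟩
    have haA' := mem_sdiff.1 haA
    have hS' : ∀ y ∈ l, y.1 ∉ B → (y.1 ∈ S ↔ y.2 ∈ S) := fun y hy hyB =>
      hS y (List.mem_filter.2 ⟨hy, by simpa using hyB⟩)
    have hcl' : ∀ y ∈ l, y.1 ∈ B ↔ y.2 ∈ B := hcl
    -- x is the only edge that leaves B; if its outer end were not in S, the points of S outside B
    -- would form a closed set missing x.1.
    have hx2 : x.2 ∈ S := by
      by_contra hx2
      have := hc {y | y ∉ B ∧ y ∈ S} ?_ ⟨a, haA'.1, haA'.2, haS⟩ x.1 hx.1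
      · exact this.1 h1
      · rw [EdgeClosed.cons_iff]
        refine ⟨by simp only [Set.mem_ofPred_eq]; tauto, ?_⟩
        intro y hy
        simp only [Set.mem_ofPred_eq]
        have := hS' y hy
        have := hcl' y hy
        tauto
    intro b hb
    have hb' := mem_sdiff.1 hb
    have := hc {y | y ∈ B ∨ y ∈ S} ?_ ⟨x.1, hx.1, Or.inl h1⟩ b hb'.1
    · exact this.resolve_left hb'.2
    · rw [EdgeClosed.cons_iff]
      refine ⟨by simp only [Set.mem_ofPred_eq]; tauto, ?_⟩
      intro y hy
      simp only [Set.mem_ofPred_eq]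
      have := hS' y hy
      have := hcl' y hy
      tauto
  · rintro ⟨B, hBA, h1, h2, hcl, hcB, hcA⟩ S hS ⟨a, haA, haS⟩
    rw [EdgeClosed.cons_iff] at hS
    have hSB : EdgeClosed (edgesIn B l) S := fun y hy => hS.2 y (List.mem_filter.1 hy).1
    have hSA : EdgeClosed (edgesOut B l) S := fun y hy => hS.2 y (List.mem_filter.1 hy).1
    have hx2 : x.2 ∈ A \ B := mem_sdiff.2 ⟨hx.2.1, h2⟩
    have key : (∀ b ∈ B, b ∈ S) ∧ ∀ b ∈ A \ B, b ∈ S := by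
      by_cases haB : a ∈ B
      · have h3 := hcB S hSB ⟨a, haB, haS⟩
        exact ⟨h3, hcA S hSA ⟨x.2, hx2, hS.1.1 (h3 _ h1)⟩⟩
      · have h3 := hcA S hSA ⟨a, mem_sdiff.2 ⟨haA, haB⟩, haS⟩
        exact ⟨hcB S hSB ⟨x.1, h1, hS.1.2 (h3 _ hx2)⟩, h3⟩
    intro b hb
    by_cases hbB : b ∈ B
    · exact key.1 b hbB
    · exact key.2 b (mem_sdiff.2 ⟨hb, hbB⟩)

open Classical in
-- The set B of `conn_cons_iff` is unique, being the component of x.1, so at most one term of the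
-- sum is nonzero; all vanish when l already connects A.
theorem conn_cons_indicator {A : Finset X} {x : X × X} {l : List (X × X)} (hx : x ∈ A.offDiag)
    (hl : ∀ y ∈ l, y ∈ A.offDiag) : (if Conn A (x :: l) then 1 else 0 : ℚ) =
      (if Conn A l then 1 else 0) + ∑ B ∈ A.powerset.filter fun B => x.1 ∈ B ∧ x.2 ∉ B,
        if EdgeClosed l (B : Set X) ∧ Conn B (edgesIn B l) ∧ Conn (A \ B) (edgesOut B l)
          then 1 else 0 := by
  by_cases hn : Conn A l
  · have h1 : Conn A (x :: l) := fun S hS => hn S (EdgeClosed.cons_iff.1 hS).2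
    rw [if_pos h1, if_pos hn, Finset.sum_eq_zero, add_zero]
    intro B hB
    simp only [mem_filter, mem_powerset] at hB
    rw [if_neg]
    rintro ⟨hcl, -, -⟩
    exact hB.2.2 (hn B hcl ⟨x.1, (mem_offDiag.1 hx).1, hB.2.1⟩ _ (mem_offDiag.1 hx).2.1)
  · rw [if_neg hn, zero_add]
    by_cases hc : Conn A (x :: l)
    · obtain ⟨B, hBA, h1, h2, hcl, hin, hout⟩ := (conn_cons_iff hx hl hn).1 hc
      rw [if_pos hc, Finset.sum_eq_single B, if_pos ⟨hcl, hin, hout⟩]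
      · intro B' hB' hne
        simp only [mem_filter, mem_powerset] at hB'
        rw [if_neg]
        rintro ⟨hcl', hin', -⟩
        apply hne
        apply Finset.Subset.antisymm
        · exact hin' B (fun y hy => hcl y (List.mem_filter.1 hy).1) ⟨x.1, hB'.2.1, h1⟩
        · exact hin B' (fun y hy => hcl' y (List.mem_filter.1 hy).1) ⟨x.1, h1, hB'.2.1⟩
      · intro h
        exact absurd (by simp [hBA, h1, h2]) h
    · rw [if_neg hc, Finset.sum_eq_zero]
      intro B hB
      simp only [mem_filter, mem_powerset] at hB
      rw [if_neg]
      rintro ⟨hcl, hin, hout⟩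
      exact hc ((conn_cons_iff hx hl hn).2 ⟨B, hB.1, hB.2.1, hB.2.2, hcl, hin, hout⟩)

theorem swapProd_mem_iff {B : Finset X} : ∀ {l : List (X × X)}, EdgeClosed l (B : Set X) →
    ∀ y, swapProd l y ∈ B ↔ y ∈ B
  | [], _, _ => Iff.rfl
  | x :: l, h, y => by
    rw [EdgeClosed.cons_iff] at h
    have h1 : x.1 ∈ B ↔ x.2 ∈ B := h.1
    rw [swapProd_cons, Equiv.Perm.mul_apply, ← swapProd_mem_iff h.2 y]
    rcases Equiv.swap_apply_eq_iff.1 (rfl : Equiv.swap x.1 x.2 (swapProd l y) = _) with _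
    by_cases ha : swapProd l y = x.1
    · rw [ha, Equiv.swap_apply_left, h1]
    by_cases hb : swapProd l y = x.2
    · rw [hb, Equiv.swap_apply_right, h1]
    rw [Equiv.swap_apply_of_ne_of_ne ha hb]

theorem swapProd_edgesIn {B : Finset X} : ∀ {l : List (X × X)}, EdgeClosed l (B : Set X) →
    ∀ y ∈ B, swapProd (edgesIn B l) y = swapProd l y
  | [], _, _, _ => rfl
  | x :: l, h, y, hy => by
    have h' := EdgeClosed.cons_iff.1 h
    have h1 : x.1 ∈ B ↔ x.2 ∈ B := h'.1
    have ih := swapProd_edgesIn h'.2 y hy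
    have hm := (swapProd_mem_iff h'.2 y).2 hy
    by_cases hx : x.1 ∈ B
    · rw [edgesIn, List.filter_cons_of_pos (by simpa using hx), swapProd_cons, swapProd_cons,
        Equiv.Perm.mul_apply, Equiv.Perm.mul_apply, ← edgesIn, ih]
    · rw [edgesIn, List.filter_cons_of_neg (by simpa using hx), swapProd_cons,
        Equiv.Perm.mul_apply, ← edgesIn, ih, Equiv.swap_apply_of_ne_of_ne]
      · rintro he
        exact hx (he ▸ hm)
      · rintro he
        exact hx (h1.2 (he ▸ hm))

theorem swapProd_edgesOut {B : Finset X} : ∀ {l : List (X × X)}, EdgeClosed l (B : Set X) →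
    ∀ y ∉ B, swapProd (edgesOut B l) y = swapProd l y
  | [], _, _, _ => rfl
  | x :: l, h, y, hy => by
    have h' := EdgeClosed.cons_iff.1 h
    have h1 : x.1 ∈ B ↔ x.2 ∈ B := h'.1
    have ih := swapProd_edgesOut h'.2 y hy
    have hm := (not_congr (swapProd_mem_iff h'.2 y)).2 hy
    by_cases hx : x.1 ∈ B
    · rw [edgesOut, List.filter_cons_of_neg (by simpa using hx), swapProd_cons,
        Equiv.Perm.mul_apply, ← edgesOut, ih, Equiv.swap_apply_of_ne_of_ne]
      · rintro he
        exact hm (he ▸ hx)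
      · rintro he
        exact hm (he ▸ h1.1 hx)
    · rw [edgesOut, List.filter_cons_of_pos (by simpa using hx), swapProd_cons, swapProd_cons,
        Equiv.Perm.mul_apply, Equiv.Perm.mul_apply, ← edgesOut, ih]

open Classical in
-- A list with no edge leaving B is a shuffle of a list inside B and a list inside the complement.
-- The product condition and the connectivity conditions separate accordingly, and the binomial
-- coefficient counts the shuffles.
theorem listSum_split {A B : Finset X} (hB : B ⊆ A) (j : ℕ) (π : Equiv.Perm X) :
    listSum A.offDiag j (fun l => if (∀ y ∈ A, swapProd l y = π y) ∧ EdgeClosed l (B : Set X) ∧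
      Conn B (edgesIn B l) ∧ Conn (A \ B) (edgesOut B l) then 1 else 0) =
      ∑ i ∈ antidiagonal j, (j.choose i.1 : ℚ) * (cnt B i.1 π * cnt (A \ B) i.2 π) := by
  have hsub : B.offDiag ∪ (A \ B).offDiag ⊆ A.offDiag :=
    Finset.union_subset (Finset.offDiag_mono hB) (Finset.offDiag_mono Finset.sdiff_subset)
  have hmem : ∀ x ∈ A.offDiag, (x ∈ B.offDiag ∪ (A \ B).offDiag ↔ (x.1 ∈ B ↔ x.2 ∈ B)) := by
    intro x hx
    rw [mem_offDiag] at hx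
    simp only [mem_union, mem_offDiag, mem_sdiff]
    tauto
  have h1 : listSum A.offDiag j (fun l => if (∀ y ∈ A, swapProd l y = π y) ∧
      EdgeClosed l (B : Set X) ∧ Conn B (edgesIn B l) ∧ Conn (A \ B) (edgesOut B l)
        then (1 : ℚ) else 0) =
      listSum A.offDiag j (fun l => if (∀ x ∈ l, x ∈ B.offDiag ∪ (A \ B).offDiag) then
        (if (∀ y ∈ A, swapProd l y = π y) ∧ EdgeClosed l (B : Set X) ∧ Conn B (edgesIn B l) ∧
          Conn (A \ B) (edgesOut B l) then (1 : ℚ) else 0) else 0) := by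
    refine listSum_congr fun l hl => ?_
    by_cases h : ∀ x ∈ l, x ∈ B.offDiag ∪ (A \ B).offDiag
    · rw [if_pos h]
    · rw [if_neg h, if_neg]
      rintro ⟨-, hcl, -⟩
      exact h fun x hx => (hmem x (hl x hx)).2 (hcl x hx)
  rw [h1, listSum_of_subset hsub]
  · refine Eq.trans ?_ (listSum_shuffle (s := B.offDiag) (t := (A \ B).offDiag)
      (fun x : X × X => decide (x.1 ∈ B)) (fun x hx => by simpa using (mem_offDiag.1 hx).1)
      (fun x hx => by simpa using (mem_sdiff.1 (mem_offDiag.1 hx).1).2) j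
      (fun l => if (∀ y ∈ B, swapProd l y = π y) ∧ Conn B l then 1 else 0)
      (fun l => if (∀ y ∈ A \ B, swapProd l y = π y) ∧ Conn (A \ B) l then 1 else 0))
    refine listSum_congr fun l hl => ?_
    have hcl : EdgeClosed l (B : Set X) := fun x hx => (hmem x (hsub (hl x hx))).1 (hl x hx)
    rw [if_pos hl]
    have e1 : (l.filter fun x => decide (x.1 ∈ B)) = edgesIn B l := rfl
    have e2 : (l.filter fun x => !decide (x.1 ∈ B)) = edgesOut B l := rfl
    rw [e1, e2]
    have h1 : (∀ y ∈ A, swapProd l y = π y) ↔ (∀ y ∈ B, swapProd (edgesIn B l) y = π y) ∧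
        ∀ y ∈ A \ B, swapProd (edgesOut B l) y = π y := by
      constructor
      · intro h
        refine ⟨fun y hy => ?_, fun y hy => ?_⟩
        · rw [swapProd_edgesIn hcl y hy, h y (hB hy)]
        · rw [swapProd_edgesOut hcl y (mem_sdiff.1 hy).2, h y (mem_sdiff.1 hy).1]
      · rintro ⟨h, h'⟩ y hy
        by_cases hyB : y ∈ B
        · rw [← swapProd_edgesIn hcl y hyB, h y hyB]
        · rw [← swapProd_edgesOut hcl y hyB, h' y (mem_sdiff.2 ⟨hy, hyB⟩)]
    rw [ite_zero_mul_ite_zero, mul_one]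
    refine if_congr ?_ rfl rfl
    rw [h1]
    tauto
  · rintro l ⟨x, hx, hxs⟩
    rw [if_neg]
    intro h
    exact hxs (h x hx)

/-- The combinatorial core: the first edge x is stripped off, the remaining product being (x.1
x.2)π, and the rest of the list either connects A or has exactly two components, separating the ends
of x. -/
theorem cnt_succ (A : Finset X) (j : ℕ) (π : Equiv.Perm X) :
    cnt A (j + 1) π = ∑ x ∈ A.offDiag, (cnt A j (Equiv.swap x.1 x.2 * π) +
      ∑ B ∈ A.powerset.filter fun B => x.1 ∈ B ∧ x.2 ∉ B,
        ∑ i ∈ antidiagonal j, (j.choose i.1 : ℚ) * (cnt B i.1 (Equiv.swap x.1 x.2 * π) *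
          cnt (A \ B) i.2 (Equiv.swap x.1 x.2 * π))) := by
  classical
  rw [cnt, listSum]
  refine Finset.sum_congr rfl fun x hx => ?_
  have h1 : ∀ B ∈ A.powerset.filter fun B => x.1 ∈ B ∧ x.2 ∉ B, _ = _ := fun B hB =>
    (listSum_split (mem_powerset.1 (mem_filter.1 hB).1) j (Equiv.swap x.1 x.2 * π)).symm
  rw [Finset.sum_congr rfl h1, ← listSum_sum, cnt, ← listSum_add]
  refine listSum_congr fun l hl => ?_
  have h2 : (∀ y ∈ A, swapProd (x :: l) y = π y) ↔
      ∀ y ∈ A, swapProd l y = (Equiv.swap x.1 x.2 * π) y := by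
    refine forall₂_congr fun y _ => ?_
    rw [swapProd_cons, Equiv.Perm.mul_apply, Equiv.Perm.mul_apply, Equiv.swap_apply_eq_iff]
  simp only [h2]
  by_cases hp : ∀ y ∈ A, swapProd l y = (Equiv.swap x.1 x.2 * π) y
  · refine (if_congr (and_iff_right hp) rfl rfl).trans ((conn_cons_indicator hx hl).trans ?_)
    exact congrArg₂ _ (if_congr (and_iff_right hp) rfl rfl).symm
      (Finset.sum_congr rfl fun B _ => (if_congr (and_iff_right hp) rfl rfl).symm)
  · rw [if_neg fun h => hp h.1, if_neg fun h => hp h.1, Finset.sum_eq_zero, add_zero]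
    exact fun B _ => if_neg fun h => hp h.1

end Count

/-! ### Cycles of the product with a transposition -/

section Cycles

variable {X : Type*} [DecidableEq X] [Finite X] (π : Equiv.Perm X)

omit [DecidableEq X] in
theorem minimalPeriod_pos (a : X) : 0 < Function.minimalPeriod π a := by
  refine Function.minimalPeriod_pos_of_mem_periodicPts ⟨orderOf π, orderOf_pos π, ?_⟩
  rw [Function.IsPeriodicPt, Function.IsFixedPt, ← Equiv.Perm.coe_pow, pow_orderOf_eq_one]
  rfl

variable {π}

omit [DecidableEq X] [Finite X] in
theorem pow_apply_injOn {a : X} {i j : ℕ} (hi : i < Function.minimalPeriod π a)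
    (hj : j < Function.minimalPeriod π a) (h : (π ^ i) a = (π ^ j) a) : i = j := by
  rw [Equiv.Perm.coe_pow, Equiv.Perm.coe_pow] at h
  exact Function.iterate_injOn_Iio_minimalPeriod hi hj h

omit [DecidableEq X] [Finite X] in
theorem pow_minimalPeriod_apply (a : X) : (π ^ Function.minimalPeriod π a) a = a := by
  rw [Equiv.Perm.coe_pow]
  exact Function.iterate_minimalPeriod

omit [DecidableEq X] in
theorem sameCycle_iff_exists_pow {a y : X} :
    π.SameCycle a y ↔ ∃ k < Function.minimalPeriod π a, (π ^ k) a = y := by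
  constructor
  · intro h
    obtain ⟨k, hk⟩ := h.exists_nat_pow_eq
    refine ⟨k % Function.minimalPeriod π a, Nat.mod_lt _ (minimalPeriod_pos π a), ?_⟩
    rw [← hk, Equiv.Perm.coe_pow, Equiv.Perm.coe_pow]
    exact Function.iterate_mod_minimalPeriod_eq
  · rintro ⟨k, -, rfl⟩
    exact Equiv.Perm.sameCycle_pow_right.2 (Equiv.Perm.SameCycle.refl _ _)

omit [DecidableEq X] [Finite X] in
theorem sameCycle_apply_self (σ : Equiv.Perm X) (x : X) : σ.SameCycle x (σ x) :=
  Equiv.Perm.sameCycle_apply_right.2 (Equiv.Perm.SameCycle.refl _ _)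

omit [DecidableEq X] in
/-- A property preserved by `σ` holds on a cycle as soon as it holds at one point. -/
theorem SameCycle.induct {σ : Equiv.Perm X} {P : X → Prop} {x y : X} (h : σ.SameCycle x y)
    (hx : P x) (hs : ∀ z, P z → P (σ z)) : P y := by
  obtain ⟨k, rfl⟩ := h.exists_nat_pow_eq
  induction k with
  | zero => exact hx
  | succ k ih =>
    rw [pow_succ', Equiv.Perm.mul_apply]
    exact hs _ (ih (Equiv.Perm.sameCycle_pow_right.2 (Equiv.Perm.SameCycle.refl _ _)))

omit [DecidableEq X] in
theorem SameCycle.of_step {σ : Equiv.Perm X} {x y : X} (h : π.SameCycle x y)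
    (hs : ∀ z, π.SameCycle x z → σ.SameCycle z (π z)) : σ.SameCycle x y := by
  have := SameCycle.induct (P := fun z => π.SameCycle x z ∧ σ.SameCycle x z) h
    ⟨Equiv.Perm.SameCycle.refl _ _, Equiv.Perm.SameCycle.refl _ _⟩ fun z hz =>
      ⟨hz.1.trans (sameCycle_apply_self π z), hz.2.trans (hs z hz.1)⟩
  exact this.2

/-- Starting at b, the new permutation follows the old cycle of b up to its last point, whose image
is redirected from b to a. -/
theorem sameCycle_swap_mul_join {a b : X} (h : ¬ π.SameCycle a b) :
    (Equiv.swap a b * π).SameCycle a b := by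
  have hlt : ∀ k, k < Function.minimalPeriod π b →
      (Equiv.swap a b * π).SameCycle b ((π ^ k) b) := by
    intro k
    induction k with
    | zero => intro _; exact Equiv.Perm.SameCycle.refl _ _
    | succ k ih =>
      intro hk
      refine (ih (by omega)).trans ?_
      have h1 : (Equiv.swap a b * π) ((π ^ k) b) = (π ^ (k + 1)) b := by
        rw [Equiv.Perm.mul_apply, ← Equiv.Perm.mul_apply π, ← pow_succ',
          Equiv.swap_apply_of_ne_of_ne]
        · intro he
          apply h
          rw [Equiv.Perm.sameCycle_comm, ← he]
          exact Equiv.Perm.sameCycle_pow_right.2 (Equiv.Perm.SameCycle.refl _ _)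
        · intro he
          have := pow_apply_injOn (j := 0) hk (by omega) he
          omega
      rw [← h1]
      exact sameCycle_apply_self _ _
  have hpos := minimalPeriod_pos π b
  have h1 := hlt (Function.minimalPeriod π b - 1) (by omega)
  have h2 : (Equiv.swap a b * π) ((π ^ (Function.minimalPeriod π b - 1)) b) = a := by
    rw [Equiv.Perm.mul_apply, ← Equiv.Perm.mul_apply π, ← pow_succ', Nat.sub_add_cancel hpos,
      pow_minimalPeriod_apply, Equiv.swap_apply_right]
  rw [Equiv.Perm.sameCycle_comm]
  refine h1.trans ?_
  conv => rhs; rw [← h2]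
  exact sameCycle_apply_self _ _

omit [Finite X] in
theorem sameCycle_swap_mul_step {a b z : X} (ha : π z ≠ a) (hb : π z ≠ b) :
    (Equiv.swap a b * π).SameCycle z (π z) := by
  have h1 : (Equiv.swap a b * π) z = π z := by
    rw [Equiv.Perm.mul_apply, Equiv.swap_apply_of_ne_of_ne ha hb]
  rw [← h1]
  exact sameCycle_apply_self _ _

/-- Only the steps arriving at a or b change: they are redirected to the other of the two, which now
lies on the same cycle. -/
theorem sameCycle_swap_mul_of_sameCycle {a b x y : X} (h : ¬ π.SameCycle a b)
    (hxy : π.SameCycle x y) : (Equiv.swap a b * π).SameCycle x y := by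
  have hab := sameCycle_swap_mul_join h
  refine SameCycle.of_step hxy fun z _ => ?_
  by_cases ha : π z = a
  · have h1 : (Equiv.swap a b * π) z = b := by
      rw [Equiv.Perm.mul_apply, ha, Equiv.swap_apply_left]
    have h2 := sameCycle_apply_self (Equiv.swap a b * π) z
    rw [h1] at h2
    rw [ha]
    exact h2.trans hab.symm
  by_cases hb : π z = b
  · have h1 : (Equiv.swap a b * π) z = a := by
      rw [Equiv.Perm.mul_apply, hb, Equiv.swap_apply_right]
    have h2 := sameCycle_apply_self (Equiv.swap a b * π) z
    rw [h1] at h2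
    rw [hb]
    exact h2.trans hab
  exact sameCycle_swap_mul_step ha hb

/-- The cycle of `a` after cutting it at `b = π ^ p a`. -/
theorem sameCycle_swap_mul_cut_iff {a y : X} {p : ℕ} (hp : 0 < p)
    (hpN : p < Function.minimalPeriod π a) :
    (Equiv.swap a ((π ^ p) a) * π).SameCycle a y ↔ ∃ k < p, (π ^ k) a = y := by
  have hstep : ∀ k, k + 1 < p →
      (Equiv.swap a ((π ^ p) a) * π) ((π ^ k) a) = (π ^ (k + 1)) a := by
    intro k hk
    rw [Equiv.Perm.mul_apply, ← Equiv.Perm.mul_apply π, ← pow_succ',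
      Equiv.swap_apply_of_ne_of_ne]
    · intro he
      have := pow_apply_injOn (j := 0) (by omega) (by omega) he
      omega
    · intro he
      have := pow_apply_injOn (by omega) (by omega) he
      omega
  constructor
  · intro h
    refine SameCycle.induct (P := fun y => ∃ k < p, (π ^ k) a = y) h ⟨0, hp, rfl⟩ ?_
    rintro z ⟨k, hk, rfl⟩
    by_cases hk1 : k + 1 < p
    · exact ⟨k + 1, hk1, (hstep k hk1).symm⟩
    · refine ⟨0, hp, ?_⟩
      have : k + 1 = p := by omega
      rw [Equiv.Perm.mul_apply, ← Equiv.Perm.mul_apply π, ← pow_succ', this,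
        Equiv.swap_apply_right]
      rfl
  · rintro ⟨k, hk, rfl⟩
    induction k with
    | zero => exact Equiv.Perm.SameCycle.refl _ _
    | succ k ih =>
      refine (ih (by omega)).trans ?_
      rw [← hstep k hk]
      exact sameCycle_apply_self _ _

theorem not_sameCycle_swap_mul_cut {a : X} {p : ℕ} (hp : 0 < p)
    (hpN : p < Function.minimalPeriod π a) :
    ¬ (Equiv.swap a ((π ^ p) a) * π).SameCycle a ((π ^ p) a) := by
  rw [sameCycle_swap_mul_cut_iff hp hpN]
  rintro ⟨k, hk, he⟩
  have := pow_apply_injOn (by omega) hpN he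
  omega

theorem sameCycle_of_sameCycle_swap_mul {a b x y : X} (hab : π.SameCycle a b)
    (h : (Equiv.swap a b * π).SameCycle x y) : π.SameCycle x y := by
  refine SameCycle.of_step h fun z _ => ?_
  have h1 := sameCycle_apply_self π z
  rw [Equiv.Perm.mul_apply]
  by_cases ha : π z = a
  · rw [ha] at h1 ⊢
    rw [Equiv.swap_apply_left]
    exact h1.trans hab
  by_cases hb : π z = b
  · rw [hb] at h1 ⊢
    rw [Equiv.swap_apply_right]
    exact h1.trans hab.symm
  rwa [Equiv.swap_apply_of_ne_of_ne ha hb]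

/-- The cut produces no third piece: walking along the old cycle, one changes pieces only on
arriving at a or at b. -/
theorem sameCycle_swap_mul_or {a b x : X} (h : π.SameCycle a x) :
    (Equiv.swap a b * π).SameCycle a x ∨ (Equiv.swap a b * π).SameCycle b x := by
  refine SameCycle.induct (P := fun x => (Equiv.swap a b * π).SameCycle a x ∨
    (Equiv.swap a b * π).SameCycle b x) h (Or.inl (Equiv.Perm.SameCycle.refl _ _)) ?_
  intro z hz
  by_cases ha : π z = a
  · rw [ha]
    exact Or.inl (Equiv.Perm.SameCycle.refl _ _)
  by_cases hb : π z = b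
  · rw [hb]
    exact Or.inr (Equiv.Perm.SameCycle.refl _ _)
  have h1 := sameCycle_swap_mul_step (π := π) ha hb
  exact hz.imp (fun h => h.trans h1) fun h => h.trans h1

theorem sameCycle_swap_mul_of_not {a b x y : X} (hab : π.SameCycle a b)
    (hx : ¬ π.SameCycle a x) (h : π.SameCycle x y) : (Equiv.swap a b * π).SameCycle x y := by
  refine SameCycle.of_step h fun z hz => ?_
  have h1 := hz.trans (sameCycle_apply_self π z)
  apply sameCycle_swap_mul_step
  · intro he
    rw [he] at h1
    exact hx h1.symm
  · intro he
    rw [he] at h1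
    exact hx (hab.trans h1.symm)

end Cycles

/-! ### Labellings of the cycles -/

section Labels

variable {X : Type*} [DecidableEq X] {ι : Type*} [DecidableEq ι]

/-- The function `f` labels the cycles of `π` in the invariant set `A`. -/
structure CycleLabels (A : Finset X) (π : Equiv.Perm X) (f : X → ι) : Prop where
  maps : ∀ x ∈ A, π x ∈ A
  eq_iff : ∀ x ∈ A, ∀ y ∈ A, f x = f y ↔ π.SameCycle x y

/-- The number of points of `A` with a given label. -/
def fiberCard (A : Finset X) (f : X → ι) (i : ι) : ℕ := (A.filter fun x => f x = i).card

/-- The multiset of the sizes of the fibers. -/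
def fiberType (A : Finset X) (f : X → ι) : Multiset ℕ := (A.image f).val.map (fiberCard A f)

omit [DecidableEq X] in
theorem fiberType_filter {A : Finset X} {f : X → ι} {S : Finset ι} (hS : S ⊆ A.image f) :
    fiberType (A.filter fun x => f x ∈ S) f = S.val.map (fiberCard A f) := by
  have h1 : (A.filter fun x => f x ∈ S).image f = S := by
    ext i
    simp only [mem_image, mem_filter]
    constructor
    · rintro ⟨x, ⟨-, hx⟩, rfl⟩
      exact hx
    · intro hi
      obtain ⟨x, hx, rfl⟩ := mem_image.1 (hS hi)
      exact ⟨x, ⟨hx, hi⟩, rfl⟩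
  rw [fiberType, h1]
  refine Multiset.map_congr rfl fun i hi => ?_
  rw [fiberCard, fiberCard, Finset.filter_filter]
  congr 1
  refine Finset.filter_congr fun x _ => ?_
  constructor
  · exact fun h => h.2
  · rintro rfl
    exact ⟨hi, rfl⟩

variable [Finite X] {A : Finset X} {π : Equiv.Perm X} {f : X → ι}

omit [DecidableEq X] [DecidableEq ι] in
theorem CycleLabels.mem_of_sameCycle (h : CycleLabels A π f) {x y : X} (hx : x ∈ A)
    (hxy : π.SameCycle x y) : y ∈ A :=
  SameCycle.induct (P := fun y => y ∈ A) hxy hx fun z hz => h.maps z hz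

omit [Finite X] [DecidableEq X] [DecidableEq ι] in
theorem CycleLabels.apply_eq (h : CycleLabels A π f) {x : X} (hx : x ∈ A) : f (π x) = f x :=
  (h.eq_iff _ (h.maps x hx) _ hx).2 (sameCycle_apply_self π x).symm

omit [DecidableEq X] in
theorem CycleLabels.filter (h : CycleLabels A π f) (S : Finset ι) :
    CycleLabels (A.filter fun x => f x ∈ S) π f where
  maps x hx := by
    rw [mem_filter] at hx ⊢
    exact ⟨h.maps x hx.1, by rw [h.apply_eq hx.1]; exact hx.2⟩
  eq_iff x hx y hy := h.eq_iff x (mem_filter.1 hx).1 y (mem_filter.1 hy).1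

/-- The fiber of a label is a cycle. -/
theorem CycleLabels.fiberCard_eq (h : CycleLabels A π f) {a : X} (ha : a ∈ A) :
    fiberCard A f (f a) = Function.minimalPeriod π a := by
  have h1 : A.filter (fun x => f x = f a) =
      (Finset.range (Function.minimalPeriod π a)).image fun k => (π ^ k) a := by
    ext x
    simp only [mem_filter, mem_image, mem_range]
    rw [← sameCycle_iff_exists_pow]
    constructor
    · rintro ⟨hx, he⟩
      exact ((h.eq_iff x hx a ha).1 he).symm
    · intro hs
      have hx := h.mem_of_sameCycle ha hs
      exact ⟨hx, (h.eq_iff x hx a ha).2 hs.symm⟩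
  rw [fiberCard, h1, Finset.card_image_of_injOn, card_range]
  intro i hi j hj hij
  exact pow_apply_injOn (by simpa using hi) (by simpa using hj) hij

/-- The other points of a cycle. -/
theorem CycleLabels.sum_fiber (h : CycleLabels A π f) {a : X} (ha : a ∈ A) (F : X → ℚ) :
    ∑ b ∈ A.filter (fun b => b ≠ a ∧ f b = f a), F b =
      ∑ p ∈ posAnti (fiberCard A f (f a)), F ((π ^ p.1) a) := by
  rw [h.fiberCard_eq ha]
  symm
  refine Finset.sum_nbij (fun p : ℕ × ℕ => (π ^ p.1) a) ?_ ?_ ?_ fun _ _ => rfl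
  · rintro p hp
    obtain ⟨h1, h2, h3⟩ := mem_posAnti.1 hp
    have hs : π.SameCycle a ((π ^ p.1) a) :=
      Equiv.Perm.sameCycle_pow_right.2 (Equiv.Perm.SameCycle.refl _ _)
    have hx := h.mem_of_sameCycle ha hs
    rw [mem_filter]
    refine ⟨hx, ?_, (h.eq_iff _ hx _ ha).2 hs.symm⟩
    intro he
    have := pow_apply_injOn (j := 0) (by omega) (by omega) he
    omega
  · rintro ⟨p, q⟩ hp ⟨p', q'⟩ hp' he
    obtain ⟨h1, h2, h3⟩ := mem_posAnti.1 hp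
    obtain ⟨h1', h2', h3'⟩ := mem_posAnti.1 hp'
    simp only at h1 h2 h3 h1' h2' h3'
    have : p = p' := pow_apply_injOn (by omega) (by omega) he
    subst this
    simp only [Prod.mk.injEq, true_and]
    omega
  · intro b hb
    rw [Finset.mem_coe, mem_filter] at hb
    have hs := ((h.eq_iff b hb.1 a ha).1 hb.2.2).symm
    obtain ⟨k, hk, hkb⟩ := sameCycle_iff_exists_pow.1 hs
    refine ⟨(k, Function.minimalPeriod π a - k), ?_, hkb⟩
    rw [Finset.mem_coe, mem_posAnti]
    refine ⟨by simp only; omega, ?_, by simp only; omega⟩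
    rintro rfl
    exact hb.2.1 hkb.symm

omit [DecidableEq ι] [Finite X] in
theorem CycleLabels.swap_maps (h : CycleLabels A π f) {a b : X} (ha : a ∈ A) (hb : b ∈ A) :
    ∀ x ∈ A, (Equiv.swap a b * π) x ∈ A := by
  intro x hx
  rw [Equiv.Perm.mul_apply]
  by_cases h1 : π x = a
  · rwa [h1, Equiv.swap_apply_left]
  by_cases h2 : π x = b
  · rwa [h2, Equiv.swap_apply_right]
  rw [Equiv.swap_apply_of_ne_of_ne h1 h2]
  exact h.maps x hx

/-- The labels after joining the cycles of `a` and `b`. -/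
def joinLabel (f : X → ι) (a b : X) : X → ι := fun x => if f x = f b then f a else f x

/-- The label of b disappears: every point that carried it is now on the cycle of a. Equality of the
new labels reduces to equality of old labels after replacing such points by a. -/
theorem CycleLabels.join (h : CycleLabels A π f) {a b : X} (ha : a ∈ A) (hb : b ∈ A)
    (hab : f a ≠ f b) : CycleLabels A (Equiv.swap a b * π) (joinLabel f a b) where
  maps := h.swap_maps ha hb
  eq_iff x hx y hy := by
    have hn : ¬ π.SameCycle a b := fun hs => hab ((h.eq_iff a ha b hb).2 hs)
    have hj := sameCycle_swap_mul_join hn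
    constructor
    · intro he
      have key : ∀ z ∈ A, ∃ t ∈ A, f t = joinLabel f a b z ∧
          (Equiv.swap a b * π).SameCycle z t := by
        intro z hz
        by_cases hzb : f z = f b
        · refine ⟨a, ha, by rw [joinLabel, if_pos hzb], ?_⟩
          exact (sameCycle_swap_mul_of_sameCycle hn ((h.eq_iff z hz b hb).1 hzb)).trans hj.symm
        · exact ⟨z, hz, by rw [joinLabel, if_neg hzb], Equiv.Perm.SameCycle.refl _ _⟩
      obtain ⟨t, ht, ht1, ht2⟩ := key x hx
      obtain ⟨u, hu, hu1, hu2⟩ := key y hy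
      have h1 : f t = f u := by rw [ht1, hu1, he]
      exact ht2.trans ((sameCycle_swap_mul_of_sameCycle hn ((h.eq_iff t ht u hu).1 h1)).trans
        hu2.symm)
    · intro hs
      have := SameCycle.induct (P := fun z => z ∈ A ∧ joinLabel f a b x = joinLabel f a b z) hs
        ⟨hx, rfl⟩ ?_
      · exact this.2
      rintro z ⟨hz, he⟩
      refine ⟨h.swap_maps ha hb z hz, ?_⟩
      rw [he, Equiv.Perm.mul_apply]
      have hfz := h.apply_eq hz
      by_cases h1 : π z = a
      · rw [h1] at hfz
        rw [h1, Equiv.swap_apply_left]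
        simp [joinLabel, ← hfz]
      by_cases h2 : π z = b
      · rw [h2] at hfz
        rw [h2, Equiv.swap_apply_right]
        simp [joinLabel, ← hfz]
      rw [Equiv.swap_apply_of_ne_of_ne h1 h2]
      simp [joinLabel, hfz]

omit [Finite X] in
theorem fiberType_join {a b : X} (ha : a ∈ A) (hb : b ∈ A) (hab : f a ≠ f b) :
    fiberType A (joinLabel f a b) = (fiberCard A f (f a) + fiberCard A f (f b)) ::ₘ
      (((A.image f).erase (f a)).erase (f b)).val.map (fiberCard A f) := by
  have himg : A.image (joinLabel f a b) =
      insert (f a) (((A.image f).erase (f a)).erase (f b)) := by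
    ext i
    simp only [mem_image, mem_insert, mem_erase, joinLabel]
    constructor
    · rintro ⟨x, hx, rfl⟩
      by_cases h1 : f x = f b
      · simp [h1]
      · by_cases h2 : f x = f a
        · simp [h2]
        · right
          simp only [if_neg h1]
          exact ⟨h1, h2, x, hx, rfl⟩
    · rintro (rfl | ⟨h1, h2, x, hx, rfl⟩)
      · exact ⟨a, ha, by simp⟩
      · exact ⟨x, hx, by simp [h1]⟩
  rw [fiberType, himg, Finset.insert_val_of_notMem (by simp), Multiset.map_cons]
  congr 1
  · rw [fiberCard, fiberCard, fiberCard, ← Finset.card_union_of_disjoint]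
    · congr 1
      ext x
      rw [mem_union, mem_filter, mem_filter, mem_filter, joinLabel]
      by_cases h1 : f x = f b
      · rw [if_pos h1]
        tauto
      · rw [if_neg h1]
        tauto
    · rw [Finset.disjoint_filter]
      intro x _ h1 h2
      exact hab (h1.symm.trans h2)
  · refine Multiset.map_congr rfl fun i hi => ?_
    have hi' : i ∈ ((A.image f).erase (f a)).erase (f b) := hi
    simp only [mem_erase] at hi'
    rw [fiberCard, fiberCard]
    congr 1
    refine Finset.filter_congr fun x _ => ?_
    simp only [joinLabel]
    split_ifs with h1
    · rw [h1]
      exact ⟨fun h => absurd h.symm hi'.2.1, fun h => absurd h.symm hi'.1⟩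
    · rfl

open Classical in
/-- The labels after cutting the cycle of `a` at `b`: the cycle of `b` gets the label `none`. -/
def cutLabel (π : Equiv.Perm X) (f : X → ι) (a b : X) : X → Option ι := fun x =>
  if (Equiv.swap a b * π).SameCycle b x then none else some (f x)

/-- Two points of the old cycle outside the new cycle of b both lie on the new cycle of a; on the
other cycles nothing changes. -/
theorem CycleLabels.cut (h : CycleLabels A π f) {a b : X} (ha : a ∈ A) (hb : b ∈ A)
    (hab : f b = f a) : CycleLabels A (Equiv.swap a b * π) (cutLabel π f a b) where
  maps := h.swap_maps ha hb
  eq_iff x hx y hy := by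
    have hs : π.SameCycle a b := ((h.eq_iff b hb a ha).1 hab).symm
    constructor
    · intro he
      simp only [cutLabel] at he
      split_ifs at he with h1 h2 h2
      · exact h1.symm.trans h2
      · simp only [Option.some.injEq] at he
        have hxy := (h.eq_iff x hx y hy).1 he
        by_cases hax : π.SameCycle a x
        · have e1 := (sameCycle_swap_mul_or (b := b) hax).resolve_right h1
          have e2 := (sameCycle_swap_mul_or (b := b) (hax.trans hxy)).resolve_right h2
          exact e1.symm.trans e2
        · exact sameCycle_swap_mul_of_not hs hax hxy
    · intro hxy
      have h1 : (Equiv.swap a b * π).SameCycle b x ↔ (Equiv.swap a b * π).SameCycle b y :=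
        ⟨fun h => h.trans hxy, fun h => h.trans hxy.symm⟩
      have h2 : f x = f y := (h.eq_iff x hx y hy).2 (sameCycle_of_sameCycle_swap_mul hs hxy)
      simp only [cutLabel, h2]
      by_cases h3 : (Equiv.swap a b * π).SameCycle b x
      · rw [if_pos h3, if_pos (h1.1 h3)]
      · rw [if_neg h3, if_neg fun h4 => h3 (h1.2 h4)]

section CutCards

variable (h : CycleLabels A π f) {a : X} (ha : a ∈ A) {p : ℕ} (hp : 0 < p)
  (hpN : p < Function.minimalPeriod π a)

include h ha hp hpN

omit [DecidableEq ι] in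
theorem cutLabel_eq_none_iff {x : X} (hx : x ∈ A) :
    cutLabel π f a ((π ^ p) a) x = none ↔
      f x = f a ∧ ¬ (Equiv.swap a ((π ^ p) a) * π).SameCycle a x := by
  have hs : π.SameCycle a ((π ^ p) a) :=
    Equiv.Perm.sameCycle_pow_right.2 (Equiv.Perm.SameCycle.refl _ _)
  simp only [cutLabel, ite_eq_left_iff, reduceCtorEq, imp_false, not_not]
  constructor
  · intro h1
    refine ⟨(h.eq_iff x hx a ha).2 (hs.trans (sameCycle_of_sameCycle_swap_mul hs h1)).symm, ?_⟩
    intro h2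
    exact not_sameCycle_swap_mul_cut hp hpN (h2.trans h1.symm)
  · rintro ⟨h1, h2⟩
    exact (sameCycle_swap_mul_or ((h.eq_iff x hx a ha).1 h1).symm).resolve_left h2

theorem cutLabel_self : cutLabel π f a ((π ^ p) a) a = some (f a) := by
  rw [cutLabel, if_neg]
  intro h1
  exact not_sameCycle_swap_mul_cut hp hpN h1.symm

omit [DecidableEq ι] [Finite X] h ha hp hpN in
theorem cutLabel_cut : cutLabel π f a ((π ^ p) a) ((π ^ p) a) = none := by
  rw [cutLabel, if_pos (Equiv.Perm.SameCycle.refl _ _)]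

theorem cutLabel_eq_some_iff {x : X} (hx : x ∈ A) {i : ι} (hi : i ≠ f a) :
    cutLabel π f a ((π ^ p) a) x = some i ↔ f x = i := by
  have h1 := cutLabel_eq_none_iff h ha hp hpN hx
  constructor
  · intro h2
    rw [cutLabel] at h2
    split_ifs at h2
    exact Option.some.inj h2
  · intro h2
    have h3 : cutLabel π f a ((π ^ p) a) x ≠ none := fun h4 => hi (h2 ▸ (h1.1 h4).1)
    rw [cutLabel] at h3 ⊢
    split_ifs at h3 ⊢ with h5
    · exact absurd rfl h3
    · rw [h2]

theorem cutLabel_eq_some_self_iff {x : X} (hx : x ∈ A) :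
    cutLabel π f a ((π ^ p) a) x = some (f a) ↔
      (Equiv.swap a ((π ^ p) a) * π).SameCycle a x := by
  have hs : π.SameCycle a ((π ^ p) a) :=
    Equiv.Perm.sameCycle_pow_right.2 (Equiv.Perm.SameCycle.refl _ _)
  have h1 := cutLabel_eq_none_iff h ha hp hpN hx
  constructor
  · intro h2
    by_contra h3
    have h4 : f x = f a := by
      rw [cutLabel] at h2
      split_ifs at h2
      exact Option.some.inj h2
    rw [h1.2 ⟨h4, h3⟩] at h2
    simp at h2
  · intro h2
    have h3 : cutLabel π f a ((π ^ p) a) x ≠ none := fun h4 => (h1.1 h4).2 h2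
    have h4 : f x = f a := (h.eq_iff x hx a ha).2 (sameCycle_of_sameCycle_swap_mul hs h2).symm
    rw [cutLabel] at h3 ⊢
    split_ifs at h3 ⊢ with h5
    · exact absurd rfl h3
    · rw [h4]

theorem fiberCard_cut_self : fiberCard A (cutLabel π f a ((π ^ p) a)) (some (f a)) = p := by
  have h1 : A.filter (fun x => cutLabel π f a ((π ^ p) a) x = some (f a)) =
      (Finset.range p).image fun k => (π ^ k) a := by
    ext x
    simp only [mem_filter, mem_image, mem_range]
    rw [← sameCycle_swap_mul_cut_iff hp hpN]
    constructor
    · rintro ⟨hx, he⟩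
      exact (cutLabel_eq_some_self_iff h ha hp hpN hx).1 he
    · intro hs
      have hx : x ∈ A := by
        obtain ⟨k, -, rfl⟩ := (sameCycle_swap_mul_cut_iff hp hpN).1 hs
        exact h.mem_of_sameCycle ha
          (Equiv.Perm.sameCycle_pow_right.2 (Equiv.Perm.SameCycle.refl _ _))
      exact ⟨hx, (cutLabel_eq_some_self_iff h ha hp hpN hx).2 hs⟩
  rw [fiberCard, h1, Finset.card_image_of_injOn, card_range]
  intro i hi j hj hij
  have hi' : i < p := by simpa using hi
  have hj' : j < p := by simpa using hj
  exact pow_apply_injOn (by omega) (by omega) hij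

/-- The two new cycles partition the old one, and the part containing a has p points. -/
theorem fiberCard_cut_none : fiberCard A (cutLabel π f a ((π ^ p) a)) none =
    Function.minimalPeriod π a - p := by
  have h1 : fiberCard A (cutLabel π f a ((π ^ p) a)) none +
      fiberCard A (cutLabel π f a ((π ^ p) a)) (some (f a)) = fiberCard A f (f a) := by
    rw [fiberCard, fiberCard, fiberCard, ← Finset.card_union_of_disjoint]
    · congr 1
      rw [← Finset.filter_or]
      refine Finset.filter_congr fun x hx => ?_
      rw [cutLabel_eq_none_iff h ha hp hpN hx, cutLabel_eq_some_self_iff h ha hp hpN hx]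
      have hs : π.SameCycle a ((π ^ p) a) :=
        Equiv.Perm.sameCycle_pow_right.2 (Equiv.Perm.SameCycle.refl _ _)
      constructor
      · rintro (h1 | h1)
        · exact h1.1
        · exact (h.eq_iff x hx a ha).2 (sameCycle_of_sameCycle_swap_mul hs h1).symm
      · intro h1
        by_cases h2 : (Equiv.swap a ((π ^ p) a) * π).SameCycle a x
        · exact Or.inr h2
        · exact Or.inl ⟨h1, h2⟩
    · rw [Finset.disjoint_filter]
      intro x _ h1 h2
      rw [h1] at h2
      simp at h2
  rw [fiberCard_cut_self h ha hp hpN, h.fiberCard_eq ha] at h1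
  omega

theorem fiberCard_cut_some {i : ι} (hi : i ≠ f a) :
    fiberCard A (cutLabel π f a ((π ^ p) a)) (some i) = fiberCard A f i := by
  rw [fiberCard, fiberCard]
  congr 1
  exact Finset.filter_congr fun x hx => cutLabel_eq_some_iff h ha hp hpN hx hi

theorem image_cutLabel : A.image (cutLabel π f a ((π ^ p) a)) = insertNone (A.image f) := by
  have hs : π.SameCycle a ((π ^ p) a) :=
    Equiv.Perm.sameCycle_pow_right.2 (Equiv.Perm.SameCycle.refl _ _)
  ext o
  rcases o with _ | i
  · simp only [mem_image, Finset.none_mem_insertNone, iff_true]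
    exact ⟨(π ^ p) a, h.mem_of_sameCycle ha hs, cutLabel_cut⟩
  · rw [Finset.some_mem_insertNone, mem_image, mem_image]
    constructor
    · rintro ⟨x, hx, he⟩
      rw [cutLabel] at he
      split_ifs at he
      exact ⟨x, hx, Option.some.inj he⟩
    · rintro ⟨x, hx, rfl⟩
      by_cases hxa : f x = f a
      · exact ⟨a, ha, by rw [cutLabel_self h ha hp hpN, hxa]⟩
      · exact ⟨x, hx, (cutLabel_eq_some_iff h ha hp hpN hx hxa).2 rfl⟩

end CutCards

end Labels

/-! ### Transport of the counting functions -/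

section Transport

variable {X Y : Type*} [DecidableEq X] [DecidableEq Y]

theorem swapProd_map {g : Y → X} (hg : Function.Injective g) (y : Y) : ∀ l : List (Y × Y),
    swapProd (l.map (Prod.map g g)) (g y) = g (swapProd l y)
  | [] => rfl
  | x :: l => by
    rw [List.map_cons, swapProd_cons, swapProd_cons, Equiv.Perm.mul_apply, Equiv.Perm.mul_apply,
      swapProd_map hg y l, Prod.map_fst, Prod.map_snd, hg.map_swap]

omit [DecidableEq Y] in
theorem conn_map_iff {g : Y → X} (hg : Function.Injective g) (B : Finset Y) (l : List (Y × Y)) :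
    Conn (B.image g) (l.map (Prod.map g g)) ↔ Conn B l := by
  constructor
  · rintro h S hS ⟨a, ha, haS⟩ b hb
    have h1 : EdgeClosed (l.map (Prod.map g g)) (g '' S) := by
      intro x hx
      obtain ⟨z, hz, rfl⟩ := List.mem_map.1 hx
      simpa [hg.mem_set_image] using hS z hz
    have := h _ h1 ⟨g a, mem_image_of_mem g ha, Set.mem_image_of_mem g haS⟩ (g b)
      (mem_image_of_mem g hb)
    rwa [hg.mem_set_image] at this
  · rintro h S hS ⟨a, ha, haS⟩ b hb
    obtain ⟨a, ha', rfl⟩ := mem_image.1 ha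
    obtain ⟨b, hb', rfl⟩ := mem_image.1 hb
    exact h (g ⁻¹' S) (fun x hx => hS _ (List.mem_map_of_mem hx)) ⟨a, ha', haS⟩ b hb'

/-- The count depends only on the action of π on the set, up to relabelling the points; this gives
both the restriction to an invariant subset and the invariance under conjugation. -/
theorem cnt_image {g : Y → X} (hg : Function.Injective g) (B : Finset Y) (j : ℕ)
    {π : Equiv.Perm X} {ρ : Equiv.Perm Y} (h : ∀ y ∈ B, π (g y) = g (ρ y)) :
    cnt (B.image g) j π = cnt B j ρ := by
  classical
  have h1 : (B.image g).offDiag = B.offDiag.image (Prod.map g g) := by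
    ext ⟨x, y⟩
    simp only [mem_offDiag, mem_image, Prod.exists, Prod.map_apply, Prod.mk.injEq]
    constructor
    · rintro ⟨⟨a, ha, rfl⟩, ⟨b, hb, rfl⟩, hab⟩
      exact ⟨a, b, ⟨ha, hb, fun h => hab (h ▸ rfl)⟩, rfl, rfl⟩
    · rintro ⟨a, b, ⟨ha, hb, hab⟩, rfl, rfl⟩
      exact ⟨⟨a, ha, rfl⟩, ⟨b, hb, rfl⟩, fun h => hab (hg h)⟩
  have h2 := listSum_map (Prod.map g g) 1 (s := B.offDiag) (fun y hy => by
    obtain ⟨x, hx, rfl⟩ := mem_image.1 hy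
    rw [Finset.card_eq_one]
    refine ⟨x, ?_⟩
    ext z
    rw [mem_filter, mem_singleton, (hg.prodMap hg).eq_iff]
    exact ⟨fun h => h.2, fun h => ⟨h ▸ hx, h⟩⟩) j
    (fun l => if (∀ y ∈ B.image g, swapProd l y = π y) ∧ Conn (B.image g) l then 1 else 0)
  rw [Nat.cast_one, one_pow, one_mul, ← h1] at h2
  rw [cnt, cnt, ← h2]
  refine listSum_congr fun l _ => if_congr (and_congr ?_ (conn_map_iff hg B l)) rfl rfl
  simp only [mem_image, forall_exists_index, and_imp, forall_apply_eq_imp_iff₂]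
  refine forall₂_congr fun y hy => ?_
  rw [swapProd_map hg, h y hy, hg.eq_iff]

end Transport

/-! ### Counting on a finite type -/

section Univ

variable {Y : Type*} [DecidableEq Y] [Fintype Y]

omit [Fintype Y] in
-- Sets closed under the edges are invariant under the group generated by the transpositions,
-- because they are invariant under each generator.
theorem range_get_map_swap (l : List (Y × Y)) (S : Set Y)
    (hS : EdgeClosed l S) {σ : Equiv.Perm Y}
    (hσ : σ ∈ Subgroup.closure {τ | τ ∈ l.map fun x => Equiv.swap x.1 x.2}) :
    ∀ y, σ y ∈ S ↔ y ∈ S := by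
  induction hσ using Subgroup.closure_induction with
  | mem τ hτ =>
    obtain ⟨x, hx, rfl⟩ := List.mem_map.1 hτ
    intro y
    have h1 := hS x hx
    by_cases hy1 : y = x.1
    · rw [hy1, Equiv.swap_apply_left, h1]
    by_cases hy2 : y = x.2
    · rw [hy2, Equiv.swap_apply_right, h1]
    rw [Equiv.swap_apply_of_ne_of_ne hy1 hy2]
  | one => exact fun y => Iff.rfl
  | mul τ τ' _ _ h1 h2 => exact fun y => (h1 _).trans (h2 y)
  | inv τ _ h1 => exact fun y => by rw [← h1 (τ⁻¹ y), ← Equiv.Perm.mul_apply, mul_inv_cancel, Equiv.Perm.one_apply]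

/-- A transitive group generated by transpositions is the full symmetric group. Conversely the full
group contains every transposition, so a nonempty closed set contains all points. -/
theorem conn_univ_iff {l : List (Y × Y)} (hl : ∀ x ∈ l, x ∈ (univ : Finset Y).offDiag) :
    Conn univ l ↔
      Subgroup.closure {τ | τ ∈ l.map fun x => Equiv.swap x.1 x.2} = ⊤ := by
  set G := Subgroup.closure {τ | τ ∈ l.map fun x => Equiv.swap x.1 x.2} with hG
  constructor
  · intro h
    have hS : ∀ σ ∈ {τ | τ ∈ l.map fun x => Equiv.swap x.1 x.2}, Equiv.Perm.IsSwap σ := by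
      rintro σ hσ
      obtain ⟨x, hx, rfl⟩ := List.mem_map.1 hσ
      exact ⟨x.1, x.2, (mem_offDiag.1 (hl x hx)).2.2, rfl⟩
    have hp : MulAction.IsPretransitive G Y := by
      refine ⟨fun a b => ?_⟩
      have h1 := h (MulAction.orbit G a) ?_ ⟨a, mem_univ a, MulAction.mem_orbit_self a⟩ b
        (mem_univ b)
      · exact h1
      · intro x hx
        have hm : Equiv.swap x.1 x.2 ∈ G := Subgroup.subset_closure (List.mem_map.2 ⟨x, hx, rfl⟩)
        have h2 : (⟨_, hm⟩ : G) • x.1 = x.2 := Equiv.swap_apply_left _ _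
        rw [← MulAction.orbit_eq_iff, ← MulAction.orbit_eq_iff, ← h2, MulAction.orbit_smul]
    exact closure_of_isSwap_of_isPretransitive hS
  · rintro h S hS ⟨a, -, ha⟩ b -
    have h1 := range_get_map_swap l S hS (σ := Equiv.swap a b) (by rw [← hG, h]; trivial) a
    rw [Equiv.swap_apply_left] at h1
    exact h1.2 ha

theorem ite_one_zero_congr {p q : Prop} {_ : Decidable p} {_ : Decidable q} (h : p ↔ q) :
    (if p then (1 : ℚ) else 0) = if q then 1 else 0 := by
  split_ifs <;> tauto

/-- The power of 2 appears because every transposition comes from exactly two ordered pairs. -/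
theorem cnt_univ_eq {n : ℕ} (j : ℕ) (π : Equiv.Perm (Fin n)) :
    cnt univ j π = 2 ^ j * ((transitiveFactorizations j π).ncard : ℚ) := by
  classical
  set φ : Fin n × Fin n → Equiv.Perm (Fin n) := fun x => Equiv.swap x.1 x.2 with hφ
  have h2 := listSum_map φ 2 (s := (univ : Finset (Fin n)).offDiag) (fun y hy => by
    obtain ⟨x, hx, rfl⟩ := mem_image.1 hy
    have hne := (mem_offDiag.1 hx).2.2
    rw [Finset.card_eq_two]
    refine ⟨x, x.swap, fun h => hne (congrArg Prod.fst h), ?_⟩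
    ext z
    rw [mem_filter, mem_insert, mem_singleton]
    constructor
    · rintro ⟨hz, he⟩
      have hz1 := (mem_offDiag.1 hz).2.2
      have h1 : Equiv.swap x.1 x.2 z.1 = z.2 := by
        rw [show Equiv.swap x.1 x.2 = φ z from he.symm]
        exact Equiv.swap_apply_left _ _
      have h2 : Equiv.swap x.1 x.2 z.1 ≠ z.1 := h1 ▸ hz1.symm
      rcases (Equiv.swap_apply_ne_self_iff.1 h2).2 with h3 | h3
      · rw [h3, Equiv.swap_apply_left] at h1
        exact Or.inl (Prod.ext h3 h1.symm)
      · rw [h3, Equiv.swap_apply_right] at h1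
        exact Or.inr (Prod.ext h3 h1.symm)
    · rintro (rfl | rfl)
      · exact ⟨hx, rfl⟩
      · exact ⟨by simpa using hne.symm, Equiv.swap_comm _ _⟩) j
    (fun l => if l.prod = π ∧ Subgroup.closure {τ | τ ∈ l} = ⊤ then 1 else 0)
  unfold cnt
  trans listSum (univ : Finset (Fin n)).offDiag j (fun l =>
    if (l.map φ).prod = π ∧ Subgroup.closure {τ | τ ∈ l.map φ} = ⊤ then 1 else 0)
  · refine listSum_congr fun l hl => ite_one_zero_congr (and_congr ?_ (conn_univ_iff hl))
    simp only [mem_univ, true_imp_iff]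
    exact ⟨fun h => Equiv.ext h, fun h y => congrArg (fun σ => σ y) h⟩
  · rw [h2, listSum_eq_sum_ofFn, Finset.sum_boole]
    norm_num
    rw [← Set.ncard_coe_finset]
    congr 2
    ext σ
    simp only [transitiveFactorizations, coe_filter, Fintype.mem_piFinset, mem_image,
      mem_offDiag, mem_univ, true_and, Set.mem_ofPred_eq]
    have h3 : ∀ i, (∃ a : Fin n × Fin n, a.1 ≠ a.2 ∧ φ a = σ i) ↔ (σ i).IsSwap := fun i => by
      simp [Equiv.Perm.IsSwap, hφ, eq_comm]
    have h4 : {τ | ∃ i, σ i = τ} = Set.range σ := rfl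
    have h5 : (∀ i, ∃ a : Fin n × Fin n, a.1 ≠ a.2 ∧ φ a = σ i) ↔ ∀ i, (σ i).IsSwap :=
      forall_congr' h3
    rw [h5]
    rw [h4, eq_comm (a := π)]
    tauto

end Univ

/-! ### Cycle types and labels -/

section CycleType

/-- Two labellings with the same fibers differ by an injective renaming of labels, which does not
affect the multiset of values. -/
theorem map_val_image_eq {X ι ι' : Type*} [DecidableEq ι] [DecidableEq ι'] {s : Finset X}
    {f : X → ι} {f' : X → ι'} (h : ∀ x ∈ s, ∀ y ∈ s, f x = f y ↔ f' x = f' y) {g : ι → ℕ}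
    {g' : ι' → ℕ} (hg : ∀ x ∈ s, g (f x) = g' (f' x)) :
    (s.image f).val.map g = (s.image f').val.map g' := by
  classical
  rcases s.eq_empty_or_nonempty with rfl | ⟨x0, hx0⟩
  · simp
  have hφ : ∃ φ : ι → ι', ∀ x ∈ s, φ (f x) = f' x := by
    refine ⟨fun i => if hi : ∃ x ∈ s, f x = i then f' hi.choose else f' x0, fun x hx => ?_⟩
    have hi : ∃ y ∈ s, f y = f x := ⟨x, hx, rfl⟩
    refine (dif_pos hi).trans ?_
    exact (h _ hi.choose_spec.1 x hx).1 hi.choose_spec.2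
  obtain ⟨φ, hφ⟩ := hφ
  have h1 : s.image f' = (s.image f).image φ := by
    rw [Finset.image_image]
    exact Finset.image_congr fun x hx => (hφ x hx).symm
  rw [h1, Finset.image_val_of_injOn (s := s.image f), Multiset.map_map]
  · refine Multiset.map_congr rfl fun i hi => ?_
    obtain ⟨x, hx, rfl⟩ := mem_image.1 (show i ∈ s.image f from hi)
    rw [Function.comp_apply, hφ x hx, hg x hx]
  · intro i hi k hk hik
    obtain ⟨x, hx, rfl⟩ := mem_image.1 (Finset.mem_coe.1 hi)
    obtain ⟨y, hy, rfl⟩ := mem_image.1 (Finset.mem_coe.1 hk)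
    rw [hφ x hx, hφ y hy] at hik
    exact (h x hx y hy).2 hik

variable {Y ι : Type*} [DecidableEq Y] [Fintype Y] [DecidableEq ι]

theorem cycleFactorsFinset_eq_image (ρ : Equiv.Perm Y) :
    ρ.cycleFactorsFinset = ρ.support.image ρ.cycleOf := by
  ext c
  rw [mem_image]
  constructor
  · intro hc
    obtain ⟨x, hx⟩ := (Equiv.Perm.mem_cycleFactorsFinset_iff.1 hc).1.nonempty_support
    have h1 := Equiv.Perm.cycle_is_cycleOf hx hc
    refine ⟨x, ?_, h1.symm⟩
    rwa [← Equiv.Perm.cycleOf_mem_cycleFactorsFinset_iff, ← h1]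
  · rintro ⟨x, hx, rfl⟩
    exact Equiv.Perm.cycleOf_mem_cycleFactorsFinset_iff.2 hx

/-- `Equiv.Perm.cycleType` omits fixed points, hence the filter. On the support, labels and cycle
factors have the same fibers. -/
theorem CycleLabels.cycleType_eq {ρ : Equiv.Perm Y} {f : Y → ι} (h : CycleLabels univ ρ f) :
    ρ.cycleType = (fiberType univ f).filter fun k => 2 ≤ k := by
  have h1 : ∀ x, x ∈ ρ.support ↔ 2 ≤ fiberCard univ f (f x) := fun x => by
    have h2 := minimalPeriod_pos ρ x
    have h3 : Function.minimalPeriod ρ x = 1 ↔ ρ x = x :=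
      Function.minimalPeriod_eq_one_iff_isFixedPt
    rw [h.fiberCard_eq (mem_univ x), Equiv.Perm.mem_support, Ne, ← h3]
    omega
  have h2 : (univ.image f).filter (fun i => 2 ≤ fiberCard univ f i) = ρ.support.image f := by
    ext i
    simp only [mem_filter, mem_image, mem_univ, true_and]
    constructor
    · rintro ⟨⟨x, rfl⟩, h3⟩
      exact ⟨x, (h1 x).2 h3, rfl⟩
    · rintro ⟨x, hx, rfl⟩
      exact ⟨⟨x, rfl⟩, (h1 x).1 hx⟩
  have h3 : (fiberType univ f).filter (fun k => 2 ≤ k) =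
      (ρ.support.image f).val.map (fiberCard univ f) := by
    rw [fiberType, Multiset.filter_map, ← h2]
    rfl
  rw [h3, Equiv.Perm.cycleType_def, cycleFactorsFinset_eq_image]
  symm
  apply map_val_image_eq
  · intro x hx y hy
    rw [h.eq_iff x (mem_univ x) y (mem_univ y)]
    exact ⟨fun hs => hs.cycleOf_eq, fun hs => by
      have := (Equiv.Perm.mem_support_cycleOf_iff' (Equiv.Perm.mem_support.1 hy)).2
        (Equiv.Perm.SameCycle.refl ρ y)
      rw [← hs] at this
      exact (Equiv.Perm.mem_support_cycleOf_iff.1 this).1⟩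
  · intro x hx
    rw [fiberCard, Function.comp_apply]
    congr 1
    ext y
    rw [mem_filter, Equiv.Perm.mem_support_cycleOf_iff' (Equiv.Perm.mem_support.1 hx),
      h.eq_iff y (mem_univ y) x (mem_univ x)]
    exact ⟨fun hs => hs.2.symm, fun hs => ⟨mem_univ y, hs.symm⟩⟩

end CycleType

/-! ### The weighted number of transitive factorizations -/

/-- A multiset of positive numbers as a partition. -/
def partitionOf (s : Multiset ℕ) (h : 0 ∉ s) : s.sum.Partition where
  parts := s
  parts_pos hi := Nat.pos_of_ne_zero fun h0 => h (h0 ▸ hi)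
  parts_sum := rfl

/-- The number of transitive factorizations into `j` transpositions of a permutation with cycle
lengths `s`, divided by `j!` and by the product of the cycle lengths. -/
def hur (j : ℕ) (s : Multiset ℕ) : ℚ :=
  if h : 0 ∉ s ∧ s ≠ 0 then
    (transitiveFactorizations j (conjClass_nonempty (partitionOf s h.1)).some).ncard /
      (j.factorial * s.prod)
  else 0

section CountHur

variable {X ι : Type*} [DecidableEq X] [DecidableEq ι] {A : Finset X} {π : Equiv.Perm X} {f : X → ι}

omit [DecidableEq X] in
theorem fiberType_sum (A : Finset X) (f : X → ι) : (fiberType A f).sum = A.card :=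
  (Finset.card_eq_sum_card_image f A).symm

omit [DecidableEq X] in
theorem zero_notMem_fiberType (A : Finset X) (f : X → ι) : 0 ∉ fiberType A f := by
  intro h
  obtain ⟨i, hi, h0⟩ := Multiset.mem_map.1 h
  obtain ⟨x, hx, rfl⟩ := mem_image.1 (show i ∈ A.image f from hi)
  rw [fiberCard, Finset.card_eq_zero] at h0
  exact notMem_empty x (h0 ▸ mem_filter.2 ⟨hx, rfl⟩ : x ∈ (∅ : Finset X))

omit [DecidableEq X] in
theorem fiberType_ne_zero (hA : A.Nonempty) : fiberType A f ≠ 0 := by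
  intro h
  have := fiberType_sum A f
  rw [h, Multiset.sum_zero] at this
  exact hA.card_ne_zero this.symm

omit [DecidableEq ι] in
theorem CycleLabels.comp {Y : Type*} [Finite X] [DecidableEq Y] [Fintype Y] (h : CycleLabels A π f)
    {e : Y → X} (he : Function.Injective e) (hA : univ.image e = A) {ρ : Equiv.Perm Y}
    (hρ : ∀ y, π (e y) = e (ρ y)) : CycleLabels univ ρ (f ∘ e) where
  maps _ _ := mem_univ _
  eq_iff x _ y _ := by
    have hm : ∀ y, e y ∈ A := fun y => hA ▸ mem_image_of_mem e (mem_univ y)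
    rw [Function.comp_apply, Function.comp_apply, h.eq_iff _ (hm x) _ (hm y)]
    have hk : ∀ (k : ℕ) (y : Y), (π ^ k) (e y) = e ((ρ ^ k) y) := by
      intro k
      induction k with
      | zero => exact fun y => rfl
      | succ k ih =>
        intro y
        rw [pow_succ, pow_succ, Equiv.Perm.mul_apply, hρ, ih, Equiv.Perm.mul_apply]
    constructor
    · intro hs
      obtain ⟨k, hk'⟩ := hs.exists_nat_pow_eq
      rw [hk, he.eq_iff] at hk'
      exact ⟨k, by rw [zpow_natCast, hk']⟩
    · intro hs
      obtain ⟨k, hk'⟩ := hs.exists_nat_pow_eq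
      exact ⟨k, by rw [zpow_natCast, hk, hk']⟩

omit [DecidableEq X] in
theorem fiberType_comp {Y : Type*} [Fintype Y] [DecidableEq X]
    {e : Y → X} (he : Function.Injective e) (hA : univ.image e = A) :
    fiberType univ (f ∘ e) = fiberType A f := by
  subst hA
  rw [fiberType, fiberType, Finset.image_image]
  refine Multiset.map_congr rfl fun i _ => ?_
  rw [fiberCard, fiberCard, Finset.filter_image, Finset.card_image_of_injective _ he]
  rfl

/-- Transporting A to `Fin n` turns π into a permutation conjugate to the representative chosen in
`hur`; thus the count depends on the cycle lengths only. -/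
theorem CycleLabels.cnt_eq [Finite X] (h : CycleLabels A π f) (hA : A.Nonempty) (j : ℕ) :
    cnt A j π = 2 ^ j * j.factorial * ((fiberType A f).prod : ℚ) * hur j (fiberType A f) := by
  classical
  set s := fiberType A f with hs
  have hs0 : 0 ∉ s ∧ s ≠ 0 := ⟨zero_notMem_fiberType A f, fiberType_ne_zero hA⟩
  rw [hur, dif_pos hs0]
  set ρ := (conjClass_nonempty (partitionOf s hs0.1)).some with hρ
  have hρs : ρ.partition.parts = s := (conjClass_nonempty (partitionOf s hs0.1)).some_mem
  have hcard : A.card = s.sum := (fiberType_sum A f).symm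
  let e := (A.equivFinOfCardEq hcard).symm
  have hmem : ∀ x, π x ∈ A ↔ x ∈ A := by
    intro x
    refine ⟨fun hx => ?_, h.maps x⟩
    exact h.mem_of_sameCycle hx (sameCycle_apply_self π x).symm
  let ρ' : Equiv.Perm (Fin s.sum) := e.symm.permCongr (π.subtypePerm hmem)
  have hρ' : ∀ y, π (e y) = e (ρ' y) := by
    intro y
    simp [ρ', Equiv.permCongr_apply]
  have hinj : Function.Injective fun y => (e y : X) :=
    Subtype.val_injective.comp e.injective
  have himg : univ.image (fun y => (e y : X)) = A := by
    ext x
    rw [mem_image]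
    constructor
    · rintro ⟨y, -, rfl⟩
      exact (e y).2
    · intro hx
      exact ⟨e.symm ⟨x, hx⟩, mem_univ _, by simp⟩
  have hl := h.comp hinj himg hρ'
  -- Conjugacy is decided by the parts of size at least 2, which agree on both sides.
  have hconj : IsConj ρ ρ' := by
    have h1 := Equiv.Perm.filter_parts_partition_eq_cycleType (σ := ρ)
    have h2 := hl.cycleType_eq
    have h3 := fiberType_comp (f := f) hinj himg
    rw [hρs] at h1
    rw [Equiv.Perm.isConj_iff_cycleType_eq, ← h1, h2]
    exact congrArg _ h3.symm
  obtain ⟨c, hc⟩ := isConj_iff.1 hconj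
  have h1 : cnt A j π = cnt univ j ρ := by
    rw [← himg, cnt_image hinj univ j fun y _ => hρ' y]
    conv_lhs => rw [← Finset.image_univ_of_surjective c.surjective]
    refine cnt_image c.injective univ j fun y _ => ?_
    rw [← hc]
    simp
  have hp : (s.prod : ℚ) ≠ 0 := by
    exact_mod_cast fun h0 => hs0.1 (Multiset.prod_eq_zero_iff.1 h0)
  have hj : (j.factorial : ℚ) ≠ 0 := by exact_mod_cast j.factorial_ne_zero
  rw [h1, cnt_univ_eq]
  field_simp

end CountHur

/-! ### The join-cut recursion for the weighted counts -/

section Recursion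

variable {X : Type*} [DecidableEq X]

/-- A product of transpositions of points of B preserves B, so no list is counted unless π does as
well. -/
theorem invariant_of_cnt_ne_zero {B : Finset X} {j : ℕ} {π : Equiv.Perm X} (h : cnt B j π ≠ 0) :
    ∀ y ∈ B, π y ∈ B := by
  classical
  by_contra hn
  apply h
  refine (listSum_congr fun l hl => if_neg fun h1 => hn fun y hy => ?_).trans
    (listSum_zero B.offDiag j)
  have hc : EdgeClosed l (B : Set X) := fun x hx => by
    have := mem_offDiag.1 (hl x hx)
    exact ⟨fun _ => this.2.1, fun _ => this.1⟩
  rw [← h1.1 y hy]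
  exact (swapProd_mem_iff hc y).2 hy

variable [Finite X] {A : Finset X} {π : Equiv.Perm X}

/-- A sum over the invariant subsets is a sum over the sets of labels. -/
theorem CycleLabels.sum_invariant {κ : Type*} [DecidableEq κ] {g : X → κ} (h : CycleLabels A π g)
    {a b : X} (ha : a ∈ A) (hb : b ∈ A) (G : Finset X → ℚ)
    (hG : ∀ B, (¬ ∀ y ∈ B, π y ∈ B) → G B = 0) :
    ∑ B ∈ A.powerset.filter (fun B => a ∈ B ∧ b ∉ B), G B =
      ∑ S ∈ (A.image g).powerset.filter (fun S => g a ∈ S ∧ g b ∉ S),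
        G (A.filter fun x => g x ∈ S) := by
  classical
  symm
  refine Finset.sum_of_injOn (fun S => A.filter fun x => g x ∈ S) ?_ ?_ ?_ fun _ _ => rfl
  · intro S hS T hT hST
    have key : ∀ S T : Finset κ, S ⊆ A.image g →
        (A.filter fun x => g x ∈ S) = (A.filter fun x => g x ∈ T) → S ⊆ T := by
      intro S T hS hST i hi
      obtain ⟨x, hx, rfl⟩ := mem_image.1 (hS hi)
      exact (mem_filter.1 (hST ▸ mem_filter.2 ⟨hx, hi⟩ : x ∈ A.filter fun x => g x ∈ T)).2
    have hS' := mem_powerset.1 (mem_filter.1 (Finset.mem_coe.1 hS)).1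
    have hT' := mem_powerset.1 (mem_filter.1 (Finset.mem_coe.1 hT)).1
    exact (key S T hS' hST).antisymm (key T S hT' hST.symm)
  · intro S hS
    have hS' := (mem_filter.1 (Finset.mem_coe.1 hS)).2
    simp only [coe_filter, mem_powerset, Set.mem_ofPred_eq, filter_subset, mem_filter, ha, hb,
      true_and]
    exact hS'
  · intro B hB hn
    obtain ⟨hBA, haB, hbB⟩ := mem_filter.1 hB
    rw [mem_powerset] at hBA
    refine hG B fun hinv => hn ?_
    have hcyc : ∀ x ∈ B, ∀ y, π.SameCycle x y → y ∈ B := fun x hx y hxy =>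
      SameCycle.induct (P := fun y => y ∈ B) hxy hx fun z hz => hinv z hz
    have hmem : ∀ x ∈ A, (g x ∈ B.image g ↔ x ∈ B) := by
      intro x hx
      refine ⟨fun hg => ?_, fun hx => mem_image_of_mem g hx⟩
      obtain ⟨y, hy, hxy⟩ := mem_image.1 hg
      exact hcyc y hy x ((h.eq_iff y (hBA hy) x hx).1 hxy)
    refine ⟨B.image g, ?_, ?_⟩
    · rw [Finset.mem_coe, mem_filter, mem_powerset, hmem a ha, hmem b hb]
      exact ⟨Finset.image_subset_image hBA, haB, hbB⟩
    · ext x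
      rw [mem_filter]
      exact ⟨fun hx => (hmem x hx.1).1 hx.2, fun hx => ⟨hBA hx, (hmem x (hBA hx)).2 hx⟩⟩

variable {ι : Type*} [DecidableEq ι] {f : X → ι}

/-- After a cut, the label `some r` belongs to the piece of a and `none` to the piece of b. A
separating set of labels is therefore a choice of which other cycles go with a. -/
theorem sum_insertNone_powerset {M : Finset ι} {r : ι} (hr : r ∈ M) (G : Finset (Option ι) → ℚ) :
    ∑ S ∈ (insertNone M).powerset.filter (fun S => some r ∈ S ∧ none ∉ S), G S =
      ∑ S ∈ (M.erase r).powerset, G ((insert r S).map Function.Embedding.some) := by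
  classical
  symm
  refine Finset.sum_nbij' (fun S => (insert r S).map Function.Embedding.some)
    (fun S => (eraseNone S).erase r) ?_ ?_ ?_ ?_ fun _ _ => rfl
  · intro S hS
    rw [mem_powerset] at hS
    rw [mem_filter, mem_powerset]
    refine ⟨fun o ho => ?_, by simp, by simp⟩
    obtain ⟨i, hi, rfl⟩ := mem_map.1 ho
    rw [Function.Embedding.some_apply, some_mem_insertNone]
    rcases mem_insert.1 hi with rfl | hi
    · exact hr
    · exact mem_of_mem_erase (hS hi)
  · intro S hS
    rw [mem_filter, mem_powerset] at hS
    rw [mem_powerset]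
    refine Finset.erase_subset_erase r fun i hi => ?_
    rw [mem_eraseNone] at hi
    exact some_mem_insertNone.1 (hS.1 hi)
  · intro S hS
    rw [mem_powerset] at hS
    rw [eraseNone_map_some, Finset.erase_insert fun h => (mem_erase.1 (hS h)).1 rfl]
  · intro S hS
    rw [mem_filter] at hS
    rw [Finset.insert_erase (mem_eraseNone.2 hS.2.1), map_some_eraseNone,
      Finset.erase_eq_of_notMem hS.2.2]

omit [DecidableEq ι] in
theorem prod_cons_map (x : ℕ) (S : Finset ι) (β : ι → ℕ) :
    ((x ::ₘ S.val.map β).prod : ℚ) = x * ∏ i ∈ S, (β i : ℚ) := by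
  rw [Multiset.prod_cons, Nat.cast_mul]
  congr 1
  exact Nat.cast_prod ..

/-- The contribution of a transposition that joins two cycles. -/
theorem CycleLabels.cnt_succ_join (h : CycleLabels A π f) {a b : X} (ha : a ∈ A) (hb : b ∈ A)
    (hab : f a ≠ f b) (j : ℕ) :
    cnt A j (Equiv.swap a b * π) + ∑ B ∈ A.powerset.filter (fun B => a ∈ B ∧ b ∉ B),
      ∑ i ∈ antidiagonal j, (j.choose i.1 : ℚ) * (cnt B i.1 (Equiv.swap a b * π) *
        cnt (A \ B) i.2 (Equiv.swap a b * π)) =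
    2 ^ j * j.factorial * ((fiberCard A f (f a) + fiberCard A f (f b) : ℚ) *
      ∏ i ∈ ((A.image f).erase (f a)).erase (f b), (fiberCard A f i : ℚ)) *
      hur j ((fiberCard A f (f a) + fiberCard A f (f b)) ::ₘ
        (((A.image f).erase (f a)).erase (f b)).val.map (fiberCard A f)) := by
  have hn : ¬ π.SameCycle a b := fun hs => hab ((h.eq_iff a ha b hb).2 hs)
  have hj := sameCycle_swap_mul_join hn
  rw [Finset.sum_eq_zero, add_zero, (h.join ha hb hab).cnt_eq ⟨a, ha⟩, fiberType_join ha hb hab,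
    prod_cons_map]
  · push_cast
    ring
  · intro B hB
    obtain ⟨-, haB, hbB⟩ := mem_filter.1 hB
    refine Finset.sum_eq_zero fun i _ => ?_
    -- After the join a and b share a cycle, so no invariant set separates them.
    have h0 : cnt B i.1 (Equiv.swap a b * π) = 0 := by
      by_contra h1
      exact hbB (SameCycle.induct (P := fun y => y ∈ B) hj haB fun z hz =>
        invariant_of_cnt_ne_zero h1 z hz)
    rw [h0, zero_mul, mul_zero]

/-- The contribution of a transposition that cuts a cycle into cycles of lengths `p` and `q`. -/
theorem CycleLabels.cnt_succ_cut (h : CycleLabels A π f) {a : X} (ha : a ∈ A) {p q : ℕ}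
    (hp : p ≠ 0) (hq : q ≠ 0) (hpq : p + q = fiberCard A f (f a)) (j : ℕ) :
    cnt A j (Equiv.swap a ((π ^ p) a) * π) +
      ∑ B ∈ A.powerset.filter (fun B => a ∈ B ∧ (π ^ p) a ∉ B),
      ∑ i ∈ antidiagonal j, (j.choose i.1 : ℚ) * (cnt B i.1 (Equiv.swap a ((π ^ p) a) * π) *
        cnt (A \ B) i.2 (Equiv.swap a ((π ^ p) a) * π)) =
    2 ^ j * j.factorial * (p * q * ∏ i ∈ (A.image f).erase (f a), (fiberCard A f i : ℚ)) *
      (hur j (p ::ₘ q ::ₘ ((A.image f).erase (f a)).val.map (fiberCard A f)) +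
        ∑ S ∈ ((A.image f).erase (f a)).powerset, ∑ i ∈ antidiagonal j,
          hur i.1 (p ::ₘ S.val.map (fiberCard A f)) *
          hur i.2 (q ::ₘ (((A.image f).erase (f a)) \ S).val.map (fiberCard A f))) := by
  classical
  set b := (π ^ p) a with hb'
  have hpN : p < Function.minimalPeriod π a := by
    rw [← h.fiberCard_eq ha]
    omega
  have hp0 : 0 < p := Nat.pos_of_ne_zero hp
  have hs : π.SameCycle a b := Equiv.Perm.sameCycle_pow_right.2 (Equiv.Perm.SameCycle.refl _ _)
  have hb : b ∈ A := h.mem_of_sameCycle ha hs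
  have hab : f b = f a := (h.eq_iff b hb a ha).2 hs.symm
  set M := A.image f with hM
  set r := f a with hr
  have hrM : r ∈ M := mem_image_of_mem f ha
  have hl := h.cut ha hb hab
  set g := cutLabel π f a b with hg
  have hgM : A.image g = insertNone M := image_cutLabel h ha hp0 hpN
  have hga : g a = some r := cutLabel_self h ha hp0 hpN
  have hgb : g b = none := cutLabel_cut
  have hcn : fiberCard A g none = q := by
    have h1 := h.fiberCard_eq ha
    rw [← hr] at h1
    rw [fiberCard_cut_none h ha hp0 hpN, ← h1]
    omega
  have hcr : fiberCard A g (some r) = p := fiberCard_cut_self h ha hp0 hpN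
  have hci : ∀ i, i ≠ r → fiberCard A g (some i) = fiberCard A f i := fun i hi =>
    fiberCard_cut_some h ha hp0 hpN hi
  have hcS : ∀ S ⊆ M.erase r, (S.map Function.Embedding.some).val.map (fiberCard A g) =
      S.val.map (fiberCard A f) := by
    intro S hS
    rw [Finset.map_val, Multiset.map_map]
    exact Multiset.map_congr rfl fun i hi => hci i (mem_erase.1 (hS hi)).1
  have hcB : ∀ S ⊆ M.erase r, ((insert r S).map Function.Embedding.some).val.map (fiberCard A g) =
      p ::ₘ S.val.map (fiberCard A f) := by
    intro S hS
    rw [← hcS S hS, Finset.map_insert, Finset.insert_val_of_notMem, Multiset.map_cons]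
    · rw [Function.Embedding.some_apply, hcr]
    · rw [Finset.mem_map' ]
      exact fun h1 => (mem_erase.1 (hS h1)).1 rfl
  have hcC : ∀ S ⊆ M.erase r, (insertNone S).val.map (fiberCard A g) =
      q ::ₘ S.val.map (fiberCard A f) := by
    intro S hS
    rw [← hcS S hS]
    change (none ::ₘ _).map _ = _
    rw [Multiset.map_cons, hcn]
  have hA : fiberType A g = p ::ₘ q ::ₘ (M.erase r).val.map (fiberCard A f) := by
    rw [fiberType, hgM]
    have h1 : insertNone M = insert none ((insert r (M.erase r)).map Function.Embedding.some) := by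
      rw [Finset.insert_erase hrM]
      ext o
      rcases o with _ | o <;> simp
    rw [h1, Finset.insert_val_of_notMem (by simp), Multiset.map_cons, hcB _ subset_rfl, hcn,
      Multiset.cons_swap]
  rw [hl.sum_invariant ha hb, hga, hgb, hgM, sum_insertNone_powerset hrM, hl.cnt_eq ⟨a, ha⟩, hA,
    mul_add]
  · congr 1
    · rw [Multiset.prod_cons, Nat.cast_mul, prod_cons_map]
      ring
    · rw [Finset.mul_sum]
      refine Finset.sum_congr rfl fun S hS => ?_
      rw [mem_powerset] at hS
      rw [Finset.mul_sum]
      refine Finset.sum_congr rfl fun i hi => ?_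
      set S' := (insert r S).map Function.Embedding.some with hS'
      have hsub : S' ⊆ A.image g := by
        rw [hgM]
        intro o ho
        obtain ⟨i, hi, rfl⟩ := mem_map.1 ho
        rw [Function.Embedding.some_apply, some_mem_insertNone]
        rcases mem_insert.1 hi with rfl | hi
        · exact hrM
        · exact mem_of_mem_erase (hS hi)
      have hsub2 : insertNone ((M.erase r) \ S) ⊆ A.image g := by
        rw [hgM]
        exact insertNone.monotone (Finset.sdiff_subset.trans (Finset.erase_subset _ _))
      have hcompl : A \ (A.filter fun x => g x ∈ S') =
          A.filter fun x => g x ∈ insertNone ((M.erase r) \ S) := by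
        ext x
        rw [mem_sdiff, mem_filter, mem_filter]
        by_cases hx : x ∈ A
        · have h1 : g x ∈ insertNone M := hgM ▸ mem_image_of_mem g hx
          rcases hgx : g x with _ | i
          · simp [hx, hS']
          · rw [hgx, some_mem_insertNone] at h1
            rw [some_mem_insertNone, mem_sdiff, mem_erase]
            simp [hx, hS', h1]
        · simp [hx]
      have hB1 : (A.filter fun x => g x ∈ S').Nonempty :=
        ⟨a, mem_filter.2 ⟨ha, by rw [hga, hS']; simp⟩⟩
      have hB2 : (A.filter fun x => g x ∈ insertNone ((M.erase r) \ S)).Nonempty :=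
        ⟨b, mem_filter.2 ⟨hb, by rw [hgb]; simp⟩⟩
      rw [hcompl, (hl.filter S').cnt_eq hB1, (hl.filter _).cnt_eq hB2, fiberType_filter hsub,
        fiberType_filter hsub2, hcB S hS, hcC _ Finset.sdiff_subset, prod_cons_map, prod_cons_map,
        ← Finset.prod_sdiff hS]
      have hij : i.1 + i.2 = j := HasAntidiagonal.mem_antidiagonal.1 hi
      -- The factorials from the two components combine with the shuffle coefficient to j!, which is
      -- why `hur` is normalized by j!.
      have hfac : (j.choose i.1 : ℚ) * i.1.factorial * i.2.factorial = j.factorial := by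
        have h1 := Nat.choose_mul_factorial_mul_factorial (show i.1 ≤ j by omega)
        rw [show j - i.1 = i.2 by omega] at h1
        exact_mod_cast h1
      rw [← hfac, ← hij, pow_add]
      ring
  · intro B hB
    refine Finset.sum_eq_zero fun i _ => ?_
    have h0 : cnt B i.1 (Equiv.swap a b * π) = 0 := by
      by_contra h1
      exact hB (invariant_of_cnt_ne_zero h1)
    rw [h0, zero_mul, mul_zero]

end Recursion

section Recursion

variable {X : Type*} {A : Finset X} {ι : Type*} [DecidableEq ι] {f : X → ι}

theorem sum_label (A : Finset X) (f : X → ι) (F : ι → ℚ) :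
    ∑ a ∈ A, F (f a) = ∑ r ∈ A.image f, (fiberCard A f r : ℚ) * F r := by
  rw [Finset.sum_comp]
  exact Finset.sum_congr rfl fun r _ => by rw [nsmul_eq_mul, fiberCard]

theorem sum_label_ne (A : Finset X) (f : X → ι) (r : ι) (F : ι → ℚ) :
    ∑ b ∈ A.filter (fun b => f b ≠ r), F (f b) =
      ∑ s ∈ (A.image f).erase r, (fiberCard A f s : ℚ) * F s := by
  classical
  have h4 : (A.filter fun b => f b ≠ r).image f = (A.image f).erase r := by
    ext i
    simp only [mem_image, mem_filter, mem_erase]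
    constructor
    · rintro ⟨x, ⟨hx, hxa⟩, rfl⟩
      exact ⟨hxa, x, hx, rfl⟩
    · rintro ⟨hxa, x, hx, rfl⟩
      exact ⟨x, ⟨hx, hxa⟩, rfl⟩
  rw [sum_label, h4]
  refine Finset.sum_congr rfl fun s hs => ?_
  rw [mem_erase] at hs
  congr 2
  rw [fiberCard, fiberCard, Finset.filter_filter]
  congr 1
  refine Finset.filter_congr fun x _ => ?_
  exact ⟨fun hx => hx.2, fun hx => ⟨hx ▸ hs.1, hx⟩⟩

variable [DecidableEq X]

theorem sum_offDiag_label (A : Finset X) (f : X → ι) (F : X × X → ℚ) :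
    ∑ x ∈ A.offDiag, F x =
      ∑ a ∈ A, (∑ b ∈ A.filter (fun b => f b ≠ f a), F (a, b) +
        ∑ b ∈ A.filter (fun b => b ≠ a ∧ f b = f a), F (a, b)) := by
  rw [Finset.sum_finset_product A.offDiag A (fun a => A.filter fun b => b ≠ a)]
  · refine Finset.sum_congr rfl fun a _ => ?_
    rw [← Finset.sum_filter_add_sum_filter_not _ (fun b => f b ≠ f a), Finset.filter_filter,
      Finset.filter_filter]
    congr 1
    · refine Finset.sum_congr (Finset.filter_congr fun b _ => ?_) fun _ _ => rfl
      exact ⟨fun h => h.2, fun h => ⟨fun he => h (he ▸ rfl), h⟩⟩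
    · simp only [not_not]
  · rintro ⟨a, b⟩
    simp only [mem_offDiag, mem_filter]
    tauto

variable [Finite X] {π : Equiv.Perm X}

/-- The ordered pairs (a, b) are sorted by whether they join or cut. A label r is carried by β_r
points, and these multiplicities restore the full product of the cycle lengths, by which one can
divide. The ratio of the normalizations is 2 (j + 1). -/
theorem CycleLabels.hur_succ (h : CycleLabels A π f) (hA : A.Nonempty) (j : ℕ) {M : Finset ι}
    (hM : A.image f = M) {β : ι → ℕ} (hβ : fiberCard A f = β) :
    2 * ((j : ℚ) + 1) * hur (j + 1) (M.val.map β) =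
      ∑ r ∈ M, ∑ s ∈ M.erase r, ((β r : ℚ) + β s) *
        hur j ((β r + β s) ::ₘ ((M.erase r).erase s).val.map β) +
      ∑ r ∈ M, ∑ p ∈ posAnti (β r), (p.1 : ℚ) * p.2 *
        (hur j (p.1 ::ₘ p.2 ::ₘ (M.erase r).val.map β) +
          ∑ S ∈ (M.erase r).powerset, ∑ i ∈ antidiagonal j,
            hur i.1 (p.1 ::ₘ S.val.map β) * hur i.2 (p.2 ::ₘ ((M.erase r) \ S).val.map β)) := by
  have hβ0 : ∀ r ∈ M, (β r : ℚ) ≠ 0 := by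
    intro r hr h0
    refine zero_notMem_fiberType A f (Multiset.mem_map.2 ⟨r, hM ▸ hr, ?_⟩)
    rw [hβ]
    exact_mod_cast h0
  set P : ℚ := ∏ i ∈ M, (β i : ℚ) with hP
  have hP0 : P ≠ 0 := Finset.prod_ne_zero_iff.2 hβ0
  have hPe : ∀ r ∈ M, (β r : ℚ) * ∏ i ∈ M.erase r, (β i : ℚ) = P := fun r hr =>
    Finset.mul_prod_erase M (fun i => (β i : ℚ)) hr
  have hc0 : (2 : ℚ) ^ j * j.factorial ≠ 0 := by positivity
  have h1 := h.cnt_eq hA (j + 1)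
  have hft : fiberType A f = M.val.map β := by rw [fiberType, hM, hβ]
  have hprod : ((M.val.map β).prod : ℚ) = P := Nat.cast_prod ..
  rw [cnt_succ, hft, hprod, sum_offDiag_label A f] at h1
  have h3 : ∀ a ∈ A, (∑ b ∈ A.filter (fun b => f b ≠ f a), (cnt A j (Equiv.swap a b * π) +
      ∑ B ∈ A.powerset.filter (fun B => a ∈ B ∧ b ∉ B),
        ∑ i ∈ antidiagonal j, (j.choose i.1 : ℚ) * (cnt B i.1 (Equiv.swap a b * π) *
        cnt (A \ B) i.2 (Equiv.swap a b * π)))) =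
      ∑ s ∈ M.erase (f a), (β s : ℚ) * (2 ^ j * j.factorial * ((β (f a) + β s : ℚ) *
      ∏ i ∈ (M.erase (f a)).erase s, (β i : ℚ)) *
      hur j ((β (f a) + β s) ::ₘ ((M.erase (f a)).erase s).val.map β)) := by
    intro a ha
    have h5 := sum_label_ne A f (f a) fun s => 2 ^ j * j.factorial * ((β (f a) + β s : ℚ) *
      ∏ i ∈ (M.erase (f a)).erase s, (β i : ℚ)) *
      hur j ((β (f a) + β s) ::ₘ ((M.erase (f a)).erase s).val.map β)
    rw [hM, hβ] at h5
    rw [← h5]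
    refine Finset.sum_congr rfl fun b hb => ?_
    obtain ⟨hb, hab⟩ := mem_filter.1 hb
    have h6 := h.cnt_succ_join ha hb hab.symm j
    rwa [hM, hβ] at h6
  have h6 : ∀ a ∈ A, (∑ b ∈ A.filter (fun b => b ≠ a ∧ f b = f a),
      (cnt A j (Equiv.swap a b * π) +
      ∑ B ∈ A.powerset.filter (fun B => a ∈ B ∧ b ∉ B),
        ∑ i ∈ antidiagonal j, (j.choose i.1 : ℚ) * (cnt B i.1 (Equiv.swap a b * π) *
        cnt (A \ B) i.2 (Equiv.swap a b * π)))) =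
      ∑ p ∈ posAnti (β (f a)), 2 ^ j * j.factorial * (p.1 * p.2 * ∏ i ∈ M.erase (f a), (β i : ℚ)) *
      (hur j (p.1 ::ₘ p.2 ::ₘ (M.erase (f a)).val.map β) +
        ∑ S ∈ (M.erase (f a)).powerset, ∑ i ∈ antidiagonal j,
          hur i.1 (p.1 ::ₘ S.val.map β) * hur i.2 (p.2 ::ₘ ((M.erase (f a)) \ S).val.map β)) := by
    intro a ha
    have h5 := h.sum_fiber ha fun b => cnt A j (Equiv.swap a b * π) +
      ∑ B ∈ A.powerset.filter (fun B => a ∈ B ∧ b ∉ B),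
        ∑ i ∈ antidiagonal j, (j.choose i.1 : ℚ) * (cnt B i.1 (Equiv.swap a b * π) *
        cnt (A \ B) i.2 (Equiv.swap a b * π))
    rw [hβ] at h5
    rw [h5]
    refine Finset.sum_congr rfl fun p hp => ?_
    obtain ⟨hpq, hp1, hp2⟩ := mem_posAnti.1 hp
    have h7 := h.cnt_succ_cut ha hp1 hp2 (hβ ▸ hpq) j
    rwa [hM, hβ] at h7
  rw [Finset.sum_congr rfl fun a ha => congrArg₂ (· + ·) (h3 a ha) (h6 a ha),
    Finset.sum_add_distrib, sum_label A f fun r => ∑ s ∈ M.erase r, (β s : ℚ) *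
      (2 ^ j * j.factorial * ((β r + β s : ℚ) * ∏ i ∈ (M.erase r).erase s, (β i : ℚ)) *
      hur j ((β r + β s) ::ₘ ((M.erase r).erase s).val.map β)),
    sum_label A f fun r => ∑ p ∈ posAnti (β r), 2 ^ j * j.factorial *
      (p.1 * p.2 * ∏ i ∈ M.erase r, (β i : ℚ)) *
      (hur j (p.1 ::ₘ p.2 ::ₘ (M.erase r).val.map β) +
        ∑ S ∈ (M.erase r).powerset, ∑ i ∈ antidiagonal j,
          hur i.1 (p.1 ::ₘ S.val.map β) * hur i.2 (p.2 ::ₘ ((M.erase r) \ S).val.map β)),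
    hM, hβ] at h1
  apply mul_left_cancel₀ (mul_ne_zero hc0 hP0)
  have h7 : (j + 1).factorial = (j + 1) * j.factorial := Nat.factorial_succ j
  calc _ = 2 ^ (j + 1) * ((j + 1).factorial : ℚ) * P * hur (j + 1) (M.val.map β) := by
        rw [h7]
        push_cast
        ring
    _ = _ := by
        rw [← h1, mul_add]
        congr 1
        · rw [Finset.mul_sum]
          refine Finset.sum_congr rfl fun r hr => ?_
          rw [Finset.mul_sum, Finset.mul_sum]
          refine Finset.sum_congr rfl fun s hs => ?_
          rw [← hPe r hr, ← Finset.mul_prod_erase _ _ hs]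
          ring
        · rw [Finset.mul_sum]
          refine Finset.sum_congr rfl fun r hr => ?_
          rw [Finset.mul_sum, Finset.mul_sum]
          refine Finset.sum_congr rfl fun p hp => ?_
          rw [← hPe r hr]
          ring

end Recursion

/-! ### Realization of cycle labels -/

open Fin.NatCast Fin.CommRing in
theorem exists_perm_fin_sameCycle (n : ℕ) :
    ∃ σ : Equiv.Perm (Fin n), ∀ x y, σ.SameCycle x y := by
  rcases n with _ | n
  · exact ⟨1, fun x => x.elim0⟩
  · refine ⟨Equiv.addRight 1, fun x y => ⟨((y - x : Fin (n + 1)) : ℕ), ?_⟩⟩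
    have h : ∀ m : ℕ, ((Equiv.addRight (1 : Fin (n + 1))) ^ m) x = x + (m : Fin (n + 1)) := by
      intro m
      induction m with
      | zero => simp
      | succ m ih =>
        rw [pow_succ', Equiv.Perm.mul_apply, ih, Nat.cast_succ]
        exact add_assoc x (m : Fin (n + 1)) 1
    rw [zpow_natCast, h, Fin.cast_val_eq_self]
    abel

/-- Every list of positive cycle lengths is realized by a disjoint union of cyclic shifts, labelled
by the index of the summand, so the recursion holds for all of them. -/
theorem hur_succ {ι : Type*} [DecidableEq ι] {M : Finset ι} (hM : M.Nonempty) {β : ι → ℕ}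
    (hβ : ∀ i ∈ M, β i ≠ 0) (j : ℕ) :
    2 * ((j : ℚ) + 1) * hur (j + 1) (M.val.map β) =
      ∑ r ∈ M, ∑ s ∈ M.erase r, ((β r : ℚ) + β s) *
        hur j ((β r + β s) ::ₘ ((M.erase r).erase s).val.map β) +
      ∑ r ∈ M, ∑ p ∈ posAnti (β r), (p.1 : ℚ) * p.2 *
        (hur j (p.1 ::ₘ p.2 ::ₘ (M.erase r).val.map β) +
          ∑ S ∈ (M.erase r).powerset, ∑ i ∈ antidiagonal j,
            hur i.1 (p.1 ::ₘ S.val.map β) * hur i.2 (p.2 ::ₘ ((M.erase r) \ S).val.map β)) := by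
  choose σ hσ using exists_perm_fin_sameCycle
  let τ : ∀ i : M, Equiv.Perm (Fin (β i)) := fun i => σ (β i)
  let π : Equiv.Perm (Σ i : M, Fin (β i)) := Equiv.Perm.sigmaCongrRightHom (fun i : M => Fin (β i)) τ
  let f : (Σ i : M, Fin (β i)) → ι := fun x => x.1
  have hpow : ∀ (k : ℤ) (x : Σ i : M, Fin (β i)), (π ^ k) x = ⟨x.1, (σ (β x.1) ^ k) x.2⟩ := by
    intro k x
    simp only [π, ← map_zpow]
    rfl
  have hl : CycleLabels univ π f := by
    refine ⟨fun _ _ => mem_univ _, fun x _ y _ => ⟨?_, ?_⟩⟩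
    · obtain ⟨i, x⟩ := x
      obtain ⟨i', y⟩ := y
      intro hxy
      obtain rfl : i = i' := Subtype.ext hxy
      obtain ⟨k, hk⟩ := hσ _ x y
      exact ⟨k, by rw [hpow, hk]⟩
    · rintro ⟨k, hk⟩
      rw [hpow] at hk
      rw [← hk]
  have hcard : ∀ i ∈ M, fiberCard univ f i = β i := by
    intro i hi
    have h1 : (univ.filter fun x => f x = i) =
        univ.image fun y : Fin (β i) => (⟨⟨i, hi⟩, y⟩ : Σ i : M, Fin (β i)) := by
      ext ⟨⟨k, hk⟩, y⟩
      simp only [mem_filter, mem_univ, true_and, mem_image, f]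
      constructor
      · rintro rfl
        exact ⟨y, rfl⟩
      · rintro ⟨z, hz⟩
        exact (congrArg (fun x : Σ i : M, Fin (β i) => (x.1 : ι)) hz).symm
    rw [fiberCard, h1, Finset.card_image_of_injective _ fun y z h => by simpa using h,
      card_univ, Fintype.card_fin]
  have himg : univ.image f = M := by
    ext i
    simp only [mem_image, mem_univ, true_and]
    constructor
    · rintro ⟨x, rfl⟩
      exact x.1.2
    · intro hi
      exact ⟨⟨⟨i, hi⟩, ⟨0, Nat.pos_of_ne_zero (hβ i hi)⟩⟩, rfl⟩
  have hne : (univ : Finset (Σ i : M, Fin (β i))).Nonempty := by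
    rw [← Finset.image_nonempty (f := f), himg]
    exact hM
  have key := hl.hur_succ hne j himg rfl
  have hmap : ∀ S ⊆ M, S.val.map (fiberCard univ f) = S.val.map β := fun S hS =>
    Multiset.map_congr rfl fun i hi => hcard i (hS hi)
  have he : ∀ r, M.erase r ⊆ M := fun r => Finset.erase_subset _ _
  rw [hmap M subset_rfl] at key
  rw [key]
  congr 1
  · refine Finset.sum_congr rfl fun r hr => Finset.sum_congr rfl fun s hs => ?_
    rw [hcard r hr, hcard s (he r hs), hmap _ ((Finset.erase_subset _ _).trans (he r))]
  · refine Finset.sum_congr rfl fun r hr => ?_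
    rw [hcard r hr, hmap _ (he r)]
    refine Finset.sum_congr rfl fun p _ => ?_
    congr 2
    refine Finset.sum_congr rfl fun S hS => ?_
    rw [hmap S ((mem_powerset.1 hS).trans (he r)),
      hmap _ (Finset.sdiff_subset.trans (he r))]

/-! ### Vanishing and the genus -/

theorem hur_of_zero_mem {j : ℕ} {s : Multiset ℕ} (h : 0 ∈ s) : hur j s = 0 :=
  dif_neg fun h1 => h1.1 h

theorem hur_empty (j : ℕ) : hur j 0 = 0 := dif_neg fun h1 => h1.2 rfl

theorem mem_of_hur_ne_zero {j : ℕ} {s : Multiset ℕ} (h : hur j s ≠ 0) : 0 ∉ s ∧ s ≠ 0 := by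
  by_contra h1
  exact h (dif_neg h1)

theorem card_le_sum_of_zero_notMem {s : Multiset ℕ} (h : 0 ∉ s) : Multiset.card s ≤ s.sum := by
  induction s using Multiset.induction_on with
  | empty => simp
  | cons a s ih =>
    rw [Multiset.mem_cons, not_or] at h
    have := ih h.2
    rw [Multiset.card_cons, Multiset.sum_cons]
    omega

theorem eq_singleton_one {s : Multiset ℕ} (h : 0 ∉ s) (h0 : s ≠ 0) (hs : s.sum ≤ 1) : s = {1} := by
  have h1 := card_le_sum_of_zero_notMem h
  have h2 : 0 < Multiset.card s := Multiset.card_pos.2 h0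
  obtain ⟨a, rfl⟩ := Multiset.card_eq_one.1 (by omega : Multiset.card s = 1)
  rw [Multiset.sum_singleton] at hs h1
  rw [Multiset.card_singleton] at h1
  rw [show a = 1 by omega]

/-- The empty list generates the trivial group, which is not the full symmetric group once there are
two points. -/
theorem eq_singleton_one_of_hur_zero {s : Multiset ℕ} (h : hur 0 s ≠ 0) : s = {1} := by
  have hs := mem_of_hur_ne_zero h
  refine eq_singleton_one hs.1 hs.2 ?_
  by_contra hlt
  rw [hur, dif_pos hs] at h
  apply h
  rw [show transitiveFactorizations 0 (conjClass_nonempty (partitionOf s hs.1)).some = ∅ from ?_,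
    Set.ncard_empty, Nat.cast_zero, zero_div]
  rw [Set.eq_empty_iff_forall_notMem]
  rintro σ ⟨-, -, h1⟩
  rw [Set.range_eq_empty, Subgroup.closure_empty] at h1
  have h2 : Equiv.swap (⟨0, by omega⟩ : Fin s.sum) ⟨1, by omega⟩ ∈
      (⊥ : Subgroup (Equiv.Perm (Fin s.sum))) := by
    rw [h1]
    trivial
  rw [Subgroup.mem_bot, Equiv.swap_eq_one_iff] at h2
  simp at h2

theorem hur_zero_one : hur 0 {1} = 1 := by
  have hs : (0 : ℕ) ∉ ({1} : Multiset ℕ) ∧ ({1} : Multiset ℕ) ≠ 0 := by simp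
  rw [hur, dif_pos hs]
  have hsub : Subsingleton (Fin ({1} : Multiset ℕ).sum) := by
    rw [Multiset.sum_singleton]
    infer_instance
  rw [show transitiveFactorizations 0 (conjClass_nonempty (partitionOf {1} hs.1)).some =
    {default} from ?_]
  · simp
  · ext σ
    simp only [Set.mem_singleton_iff]
    refine ⟨fun _ => Subsingleton.elim _ _, fun _ => ⟨Subsingleton.elim _ _, fun i => i.elim0, ?_⟩⟩
    exact Subsingleton.elim _ _

theorem exists_eq_map (s : Multiset ℕ) : ∃ (M : Finset (ℕ × ℕ)) (β : ℕ × ℕ → ℕ),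
    s = M.val.map β :=
  ⟨s.toEnumFinset, Prod.fst, (Multiset.map_toEnumFinset_fst s).symm⟩

section Vanish

variable {ι : Type*} [DecidableEq ι] {M : Finset ι} (β : ι → ℕ)

omit [DecidableEq ι] in
theorem card_cons_map (p : ℕ) (S : Finset ι) :
    Multiset.card (p ::ₘ S.val.map β) = S.card + 1 := by
  rw [Multiset.card_cons, Multiset.card_map, Finset.card_def]

omit [DecidableEq ι] in
theorem sum_cons_map (p : ℕ) (S : Finset ι) :
    (p ::ₘ S.val.map β).sum = p + ∑ i ∈ S, β i := Multiset.sum_cons _ _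

theorem join_sum_card {r s : ι} (hr : r ∈ M) (hs : s ∈ M.erase r) :
    ((β r + β s) ::ₘ ((M.erase r).erase s).val.map β).sum = (M.val.map β).sum ∧
    Multiset.card ((β r + β s) ::ₘ ((M.erase r).erase s).val.map β) + 1 =
      Multiset.card (M.val.map β) := by
  constructor
  · rw [sum_cons_map, add_assoc, Finset.add_sum_erase _ β hs, Finset.add_sum_erase _ β hr]
    rfl
  · rw [card_cons_map, Finset.card_erase_add_one hs, Finset.card_erase_add_one hr,
      Multiset.card_map, Finset.card_def]

theorem cut_sum_card {r : ι} (hr : r ∈ M) {p : ℕ × ℕ} (hp : p ∈ posAnti (β r)) :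
    (p.1 ::ₘ p.2 ::ₘ (M.erase r).val.map β).sum = (M.val.map β).sum ∧
    Multiset.card (p.1 ::ₘ p.2 ::ₘ (M.erase r).val.map β) = Multiset.card (M.val.map β) + 1 := by
  have h1 := (mem_posAnti.1 hp).1
  constructor
  · rw [Multiset.sum_cons, sum_cons_map, ← add_assoc, h1, Finset.add_sum_erase _ β hr]
    rfl
  · rw [Multiset.card_cons, card_cons_map, Finset.card_erase_add_one hr, Multiset.card_map,
      Finset.card_def]

theorem split_sum_card {r : ι} (hr : r ∈ M) {p : ℕ × ℕ} (hp : p ∈ posAnti (β r)) {S : Finset ι}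
    (hS : S ∈ (M.erase r).powerset) :
    (p.1 ::ₘ S.val.map β).sum + (p.2 ::ₘ ((M.erase r) \ S).val.map β).sum = (M.val.map β).sum ∧
    Multiset.card (p.1 ::ₘ S.val.map β) + Multiset.card (p.2 ::ₘ ((M.erase r) \ S).val.map β) =
      Multiset.card (M.val.map β) + 1 := by
  have h1 := (mem_posAnti.1 hp).1
  rw [mem_powerset] at hS
  have h2 : (M.val.map β).sum = ∑ i ∈ M, β i := rfl
  constructor
  · rw [sum_cons_map, sum_cons_map, h2, ← Finset.add_sum_erase _ β hr, ← Finset.sum_sdiff hS]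
    omega
  · have h3 := Finset.card_sdiff_add_card_eq_card hS
    have h4 := Finset.card_erase_add_one hr
    rw [card_cons_map, card_cons_map, Multiset.card_map, ← Finset.card_def]
    omega

end Vanish

/-- The Riemann–Hurwitz constraint. -/
theorem le_and_even_of_hur_ne_zero : ∀ {j : ℕ} {s : Multiset ℕ}, hur j s ≠ 0 →
    s.sum + Multiset.card s ≤ j + 2 ∧ Even (j + s.sum + Multiset.card s)
  | 0, s, h => by
    obtain rfl := eq_singleton_one_of_hur_zero h
    simp
  | j + 1, s, h => by
    have hs := mem_of_hur_ne_zero h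
    obtain ⟨M, β, rfl⟩ := exists_eq_map s
    have hM : M.Nonempty := by
      rw [Finset.nonempty_iff_ne_empty]
      rintro rfl
      exact hs.2 rfl
    have hβ : ∀ i ∈ M, β i ≠ 0 := fun i hi h0 => hs.1 (h0 ▸ Multiset.mem_map_of_mem β hi)
    by_contra hn
    apply h
    -- Induction on the number of transpositions: a join lowers the number of parts by one, a cut
    -- raises it by one, and a splitting distributes n and m + 1 over two factorizations. If the
    -- constraint fails for s, it fails in every term, so all of them vanish.
    have h1 := hur_succ hM hβ j
    rw [Finset.sum_eq_zero, Finset.sum_eq_zero, add_zero] at h1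
    · have : (2 * ((j : ℚ) + 1)) ≠ 0 := by positivity
      exact (mul_eq_zero.1 h1).resolve_left this
    · intro r hr
      refine Finset.sum_eq_zero fun p hp => ?_
      rw [Finset.sum_eq_zero, add_zero]
      · obtain ⟨e1, e2⟩ := cut_sum_card β hr hp
        by_contra h2
        obtain ⟨h3, h4⟩ := le_and_even_of_hur_ne_zero (right_ne_zero_of_mul h2)
        rw [e1, e2] at h3 h4
        refine hn ⟨by omega, ?_⟩
        rw [Nat.even_iff] at h4 ⊢
        omega
      · intro S hS
        refine Finset.sum_eq_zero fun i hi => ?_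
        obtain ⟨e1, e2⟩ := split_sum_card β hr hp hS
        have hi' : i.1 + i.2 = j := HasAntidiagonal.mem_antidiagonal.1 hi
        by_contra h2
        obtain ⟨h3, h4⟩ := le_and_even_of_hur_ne_zero (left_ne_zero_of_mul h2)
        obtain ⟨h5, h6⟩ := le_and_even_of_hur_ne_zero (right_ne_zero_of_mul h2)
        refine hn ⟨by omega, ?_⟩
        rw [Nat.even_iff] at h4 h6 ⊢
        omega
    · intro r hr
      refine Finset.sum_eq_zero fun s' hs' => ?_
      obtain ⟨e1, e2⟩ := join_sum_card β hr hs'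
      by_contra h2
      obtain ⟨h3, h4⟩ := le_and_even_of_hur_ne_zero (right_ne_zero_of_mul h2)
      refine hn ⟨by omega, ?_⟩
      rw [Nat.even_iff] at h4 ⊢
      omega

/-- The weighted number of transitive factorizations of genus `g`. -/
def hurG (g : ℕ) (s : Multiset ℕ) : ℚ := hur (s.sum + Multiset.card s + 2 * g - 2) s

theorem hurG_of_zero_mem {g : ℕ} {s : Multiset ℕ} (h : 0 ∈ s) : hurG g s = 0 := hur_of_zero_mem h

theorem two_le_sum_add_card {ι : Type*} (β : ι → ℕ) {p : ℕ} (hp : p ≠ 0) (S : Finset ι) :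
    2 ≤ (p ::ₘ S.val.map β).sum + Multiset.card (p ::ₘ S.val.map β) := by
  rw [sum_cons_map, card_cons_map]
  omega

/-- By the Riemann–Hurwitz constraint the nonzero terms are exactly indexed by a splitting of the
genus, each factor having its own admissible number of transpositions. -/
theorem sum_hur_mul_hur {s t : Multiset ℕ} (hs : 2 ≤ s.sum + Multiset.card s)
    (ht : 2 ≤ t.sum + Multiset.card t) {g j : ℕ}
    (hj : j + 4 = s.sum + Multiset.card s + (t.sum + Multiset.card t) + 2 * g) :
    ∑ i ∈ antidiagonal j, hur i.1 s * hur i.2 t = ∑ a ∈ antidiagonal g, hurG a.1 s * hurG a.2 t := by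
  symm
  refine Finset.sum_of_injOn (fun a => (s.sum + Multiset.card s + 2 * a.1 - 2,
    t.sum + Multiset.card t + 2 * a.2 - 2)) ?_ ?_ ?_ fun _ _ => rfl
  · rintro a - b - h
    rw [Prod.mk.injEq] at h
    exact Prod.ext (by omega) (by omega)
  · intro a ha
    have ha' : a.1 + a.2 = g := HasAntidiagonal.mem_antidiagonal.1 ha
    rw [Finset.mem_coe, HasAntidiagonal.mem_antidiagonal]
    dsimp only
    omega
  · intro i hi hn
    have hi' : i.1 + i.2 = j := HasAntidiagonal.mem_antidiagonal.1 hi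
    by_contra h2
    obtain ⟨h3, c, h4⟩ := le_and_even_of_hur_ne_zero (left_ne_zero_of_mul h2)
    obtain ⟨h5, d, h6⟩ := le_and_even_of_hur_ne_zero (right_ne_zero_of_mul h2)
    apply hn
    -- The parity conditions read i.1 + n₁ + m₁ = 2c and i.2 + n₂ + m₂ = 2d; these are the genera
    -- solving i = n + m + 2a - 2.
    refine ⟨(c + 1 - (s.sum + Multiset.card s), d + 1 - (t.sum + Multiset.card t)), ?_, ?_⟩
    · rw [Finset.mem_coe, HasAntidiagonal.mem_antidiagonal]
      dsimp only
      omega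
    · exact Prod.ext (by dsimp only; omega) (by dsimp only; omega)

/-- The cut-and-join recursion by genus. -/
theorem hurG_recursion {ι : Type*} [DecidableEq ι] {M : Finset ι} (hM : M.Nonempty) {β : ι → ℕ}
    (hβ : ∀ i ∈ M, β i ≠ 0) (g : ℕ) (hg : 3 ≤ ∑ i ∈ M, β i + M.card + 2 * g) :
    2 * (∑ i ∈ M, (β i : ℚ) + M.card + 2 * g - 2) * hurG g (M.val.map β) =
      ∑ r ∈ M, ∑ s ∈ M.erase r, ((β r : ℚ) + β s) *
        hurG g ((β r + β s) ::ₘ ((M.erase r).erase s).val.map β) +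
      ∑ r ∈ M, ∑ p ∈ posAnti (β r), (p.1 : ℚ) * p.2 *
        ((if g = 0 then 0 else hurG (g - 1) (p.1 ::ₘ p.2 ::ₘ (M.erase r).val.map β)) +
          ∑ S ∈ (M.erase r).powerset, ∑ a ∈ antidiagonal g,
            hurG a.1 (p.1 ::ₘ S.val.map β) * hurG a.2 (p.2 ::ₘ ((M.erase r) \ S).val.map β)) := by
  -- The number of transpositions is j + 1; the hypothesis ensures that there is a first one to
  -- remove.
  obtain ⟨j, hj⟩ : ∃ j, ∑ i ∈ M, β i + M.card + 2 * g = j + 3 := ⟨_, (Nat.sub_add_cancel hg).symm⟩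
  have hsum : (M.val.map β).sum = ∑ i ∈ M, β i := rfl
  have hcard : Multiset.card (M.val.map β) = M.card := Multiset.card_map ..
  have h1 := hur_succ hM hβ j
  have h2 : hurG g (M.val.map β) = hur (j + 1) (M.val.map β) := by
    rw [hurG, hsum, hcard, hj]
    rfl
  have h3 : (∑ i ∈ M, (β i : ℚ) + M.card + 2 * g - 2) = (j : ℚ) + 1 := by
    have : ((∑ i ∈ M, β i + M.card + 2 * g : ℕ) : ℚ) = ((j + 3 : ℕ) : ℚ) := by rw [hj]
    push_cast at this
    linarith
  rw [h2, h3, h1]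
  congr 1
  · refine Finset.sum_congr rfl fun r hr => Finset.sum_congr rfl fun s hs => ?_
    obtain ⟨e1, e2⟩ := join_sum_card β hr hs
    rw [hurG, e1]
    congr 2
    omega
  · refine Finset.sum_congr rfl fun r hr => Finset.sum_congr rfl fun p hp => ?_
    congr 2
    · obtain ⟨e1, e2⟩ := cut_sum_card β hr hp
      split_ifs with h0
      -- In genus zero the transpositions left after a cut cannot connect all points: they are too
      -- few by the Riemann–Hurwitz constraint.
      · by_contra h4
        have := (le_and_even_of_hur_ne_zero h4).1
        omega
      · rw [hurG, e1, e2]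
        congr 1
        omega
    · refine Finset.sum_congr rfl fun S hS => ?_
      obtain ⟨e1, e2⟩ := split_sum_card β hr hp hS
      obtain ⟨-, hp1, hp2⟩ := mem_posAnti.1 hp
      refine sum_hur_mul_hur (two_le_sum_add_card β hp1 S) (two_le_sum_add_card β hp2 _) ?_
      omega

/-- Hurwitz's formula. -/
theorem hurG_zero_eq_genusZero : ∀ (j : ℕ) (s : Multiset ℕ), 0 ∉ s → s ≠ 0 →
    s.sum + Multiset.card s = j + 2 → hurG 0 s = genusZero s
  | 0, s, h, h0, hj => by
    have hpos := Multiset.card_pos.2 h0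
    obtain rfl := eq_singleton_one h h0 (by omega)
    simp [hurG, hur_zero_one, genusZero, treeA]
  | j + 1, s, h, h0, hj => by
    obtain ⟨M, β, rfl⟩ := exists_eq_map s
    have hM : M.Nonempty := by
      rw [Finset.nonempty_iff_ne_empty]
      rintro rfl
      exact h0 rfl
    have hβ : ∀ i ∈ M, β i ≠ 0 := fun i hi h0 => h (h0 ▸ Multiset.mem_map_of_mem β hi)
    have hsum : (M.val.map β).sum = ∑ i ∈ M, β i := rfl
    have hcard : Multiset.card (M.val.map β) = M.card := Multiset.card_map ..
    have h1 := hurG_recursion hM hβ 0 (by omega)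
    have h2 := genusZero_recursion M β hβ hM
    -- The factor is 2 (j + 1), so the recursion determines the value, and every count on its right
    -- side involves fewer transpositions.
    have h3 : (2 * (∑ i ∈ M, (β i : ℚ) + M.card - 2)) ≠ 0 := by
      have : ((∑ i ∈ M, β i + M.card : ℕ) : ℚ) = ((j + 1 + 2 : ℕ) : ℚ) := by
        rw [← hj, hsum, hcard]
      push_cast at this
      have h4 : (2 * (∑ i ∈ M, (β i : ℚ) + M.card - 2)) = 2 * ((j : ℚ) + 1) := by linarith
      rw [h4]
      positivity
    apply mul_left_cancel₀ h3
    rw [h2]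
    rw [Nat.cast_zero, mul_zero, add_zero] at h1
    rw [h1]
    have hmem : ∀ S ⊆ M, 0 ∉ S.val.map β := by
      intro S hS h4
      obtain ⟨i, hi, h5⟩ := Multiset.mem_map.1 h4
      exact hβ i (hS hi) h5
    congr 1
    · refine Finset.sum_congr rfl fun r hr => Finset.sum_congr rfl fun s hs => ?_
      obtain ⟨e1, e2⟩ := join_sum_card β hr hs
      rw [hurG_zero_eq_genusZero j _ ?_ (Multiset.cons_ne_zero) (by omega)]
      rw [Multiset.mem_cons, not_or]
      have := hβ r hr
      exact ⟨by omega, hmem _ ((Finset.erase_subset _ _).trans (Finset.erase_subset _ _))⟩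
    · refine Finset.sum_congr rfl fun r hr => Finset.sum_congr rfl fun p hp => ?_
      rw [if_pos rfl, zero_add]
      congr 1
      refine Finset.sum_congr rfl fun S hS => ?_
      obtain ⟨e1, e2⟩ := split_sum_card β hr hp hS
      obtain ⟨-, hp1, hp2⟩ := mem_posAnti.1 hp
      have f1 := two_le_sum_add_card β hp1 S
      have f2 := two_le_sum_add_card β hp2 ((M.erase r) \ S)
      obtain ⟨k, hk⟩ := Nat.exists_eq_add_of_le' f1
      obtain ⟨l, hl⟩ := Nat.exists_eq_add_of_le' f2
      have hSM := (mem_powerset.1 hS).trans (Finset.erase_subset r M)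
      have hkj : k < j + 1 := by omega
      have hlj : l < j + 1 := by omega
      rw [HasAntidiagonal.antidiagonal_zero, Finset.sum_singleton,
        hurG_zero_eq_genusZero k _ ?_ Multiset.cons_ne_zero hk,
        hurG_zero_eq_genusZero l _ ?_ Multiset.cons_ne_zero hl]
      · rw [Multiset.mem_cons, not_or]
        exact ⟨hp2.symm, hmem _ (Finset.sdiff_subset.trans (Finset.erase_subset r M))⟩
      · rw [Multiset.mem_cons, not_or]
        exact ⟨hp1.symm, hmem _ hSM⟩
  termination_by j => j

/-! ### The coefficients of the symmetrized series -/

/-- The number of permutations of a listing of `s` that do not change it. -/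
def multFactorial (s : Multiset ℕ) : ℕ := ∏ k ∈ s.toFinset, (s.count k).factorial

/-- The centralizer has order equal to the product of the parts times the factorials of their
multiplicities. The class formula is available in terms of the cycle type, so the parts equal to 1
are treated separately. -/
theorem conjClass_ncard_mul {n : ℕ} (α : n.Partition) :
    (conjClass α).ncard * (α.parts.prod * multFactorial α.parts) = n.factorial := by
  classical
  set m := α.parts.filter fun k => 2 ≤ k with hm
  have h0 : 0 ∉ α.parts := fun h => lt_irrefl 0 (α.parts_pos h)
  have hone : α.parts.filter (fun k => ¬ 2 ≤ k) = Multiset.replicate (α.parts.count 1) 1 := by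
    rw [← Multiset.filter_eq']
    refine Multiset.filter_congr fun k hk => ?_
    have : k ≠ 0 := fun h => h0 (h ▸ hk)
    omega
  have hsplit := Multiset.filter_add_not (fun k => 2 ≤ k) α.parts
  rw [hone, ← hm] at hsplit
  have hsum : m.sum + α.parts.count 1 = n := by
    have h := congrArg Multiset.sum hsplit
    rw [Multiset.sum_add, α.parts_sum, Multiset.sum_replicate, smul_eq_mul, mul_one] at h
    exact h
  have hprod : m.prod = α.parts.prod := by
    have h := congrArg Multiset.prod hsplit
    rwa [Multiset.prod_add, Multiset.prod_replicate, one_pow, mul_one] at h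
  have hmult : (α.parts.count 1).factorial * ∏ k ∈ m.toFinset, (m.count k).factorial =
      multFactorial α.parts := by
    have h1 : m.toFinset = α.parts.toFinset.erase 1 := by
      ext k
      rw [Multiset.mem_toFinset, hm, Multiset.mem_filter, mem_erase, Multiset.mem_toFinset]
      constructor
      · rintro ⟨h1, h2⟩
        exact ⟨by omega, h1⟩
      · rintro ⟨h1, h2⟩
        have : k ≠ 0 := fun h => h0 (h ▸ h2)
        exact ⟨h2, by omega⟩
    have h2 : ∏ k ∈ m.toFinset, (m.count k).factorial =
        ∏ k ∈ α.parts.toFinset.erase 1, (α.parts.count k).factorial := by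
      rw [h1]
      refine Finset.prod_congr rfl fun k hk => ?_
      rw [← h1, Multiset.mem_toFinset, hm, Multiset.mem_filter] at hk
      rw [hm, Multiset.count_filter_of_pos hk.2]
    rw [h2, multFactorial]
    by_cases h3 : 1 ∈ α.parts.toFinset
    · exact Finset.mul_prod_erase _ (fun k => (α.parts.count k).factorial) h3
    · rw [Finset.erase_eq_of_notMem h3, Multiset.count_eq_zero.2 (by simpa using h3),
        Nat.factorial_zero, one_mul]
  have key := Equiv.Perm.card_of_cycleType_mul_eq (Fin n) m
  rw [if_pos ⟨by rw [Fintype.card_fin]; omega, fun a ha => (Multiset.mem_filter.1 ha).2⟩,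
    Fintype.card_fin, show n - m.sum = α.parts.count 1 by omega, hprod, mul_right_comm, ← mul_assoc,
    mul_comm (_ * _) α.parts.prod] at key
  rw [← key, ← hmult]
  have hset : conjClass α = ↑((univ : Finset (Equiv.Perm (Fin n))).filter fun g =>
      g.cycleType = m) := by
    ext π
    simp only [conjClass, Set.mem_ofPred_eq, coe_filter, mem_univ, true_and]
    rw [← Equiv.Perm.filter_parts_partition_eq_cycleType]
    constructor
    · intro h
      rw [h]
    · intro h
      have h1 := Multiset.filter_add_not (fun k => 2 ≤ k) π.partition.parts
      have h2 : π.partition.parts.filter (fun k => ¬ 2 ≤ k) =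
          Multiset.replicate (π.partition.parts.count 1) 1 := by
        rw [← Multiset.filter_eq']
        refine Multiset.filter_congr fun k hk => ?_
        have := π.partition.parts_pos hk
        omega
      have h3 := congrArg Multiset.sum h1
      rw [h2, Multiset.sum_add, π.partition.parts_sum, Multiset.sum_replicate, smul_eq_mul,
        mul_one, h] at h3
      have h4 : Fintype.card (Fin n) = n := Fintype.card_fin n
      rw [← h1, ← hsplit, h2, h, show π.partition.parts.count 1 = α.parts.count 1 by omega]
  rw [hset, Set.ncard_coe_finset]
  ring

/-- |C_α|/n! is the inverse of the product of the parts and of the multiplicity factorials; the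
former is part of `hur`, the latter is multiplied away. -/
theorem eval_phiCoeff (g : ℕ) {n : ℕ} (hn : n ≠ 0) (α : n.Partition) :
    (PhiCoeff g α).eval 1 * multFactorial α.parts = hurG g α.parts := by
  have h1 := conjClass_ncard_mul α
  rw [PhiCoeff, if_neg hn]
  simp only [Polynomial.eval_mul, Polynomial.eval_C, Polynomial.eval_pow, Polynomial.eval_X,
    one_pow, mul_one]
  obtain ⟨s, hpos, rfl⟩ := α
  have hs : 0 ∉ s ∧ s ≠ 0 := by
    refine ⟨fun h => lt_irrefl 0 (hpos h), ?_⟩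
    rintro rfl
    exact hn rfl
  have h2 : transFactCount g (⟨s, hpos, rfl⟩ : s.sum.Partition) =
    (transitiveFactorizations (s.sum + Multiset.card s + 2 * g - 2)
      (conjClass_nonempty (partitionOf s hs.1)).some).ncard := rfl
  rw [hurG, hur, dif_pos hs, h2]
  dsimp only at h1 ⊢
  have h3 : (s.sum.factorial : ℚ) ≠ 0 := by exact_mod_cast Nat.factorial_ne_zero _
  have h4 : (s.prod : ℚ) ≠ 0 := by
    exact_mod_cast fun h => hs.1 (Multiset.prod_eq_zero_iff.1 h)
  have h5 : ((s.sum + Multiset.card s + 2 * g - 2).factorial : ℚ) ≠ 0 := by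
    exact_mod_cast Nat.factorial_ne_zero _
  have h6 : ((conjClass (⟨s, hpos, rfl⟩ : s.sum.Partition)).ncard : ℚ) *
    (s.prod * multFactorial s) = s.sum.factorial := by exact_mod_cast h1
  field_simp
  rw [← h6]
  ring

/-- The permutations carrying a to b form a coset of the stabilizer of a, whose order is a product
of factorials, or the empty set if the multisets of values differ. -/
theorem count_perm_comp_eq {m : ℕ} (a b : Fin m → ℕ) :
    ((univ : Finset (Equiv.Perm (Fin m))).filter fun π : Equiv.Perm (Fin m) => a ∘ ⇑π = b).card =
      if (univ.val.map a : Multiset ℕ) = univ.val.map b then multFactorial (univ.val.map a)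
        else 0 := by
  classical
  have hcount : ∀ (c : Fin m → ℕ) (k : ℕ), (univ.val.map c : Multiset ℕ).count k =
      Fintype.card {i // c i = k} := by
    intro c k
    rw [Multiset.count_map, Fintype.card_subtype]
    exact congrArg Finset.card (Finset.filter_congr (s := univ) (p := fun i => k = c i)
      (q := fun i => c i = k) fun i _ => eq_comm)
  split_ifs with h
  · have he : ∀ k, Nonempty ({i // b i = k} ≃ {i // a i = k}) := fun k => by
      rw [← Fintype.card_eq, ← hcount, ← hcount, h]
    -- One permutation carrying a to b, assembled from bijections between the fibers; translating by
    -- it reduces to the stabilizer.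
    let π₀ : Equiv.Perm (Fin m) := Equiv.ofFiberEquiv fun k => (he k).some
    have hπ₀ : ∀ i, a (π₀ i) = b i := fun i => Equiv.ofFiberEquiv_map (fun k => (he k).some) i
    have h1 := DomMulAct.stabilizer_card' a
    rw [Fintype.card_subtype] at h1
    rw [multFactorial, show (univ.val.map a : Multiset ℕ).toFinset = univ.image a from rfl,
      Finset.prod_congr rfl fun k _ => by rw [hcount], ← h1]
    refine Finset.card_nbij' (fun π => π * π₀⁻¹) (fun π => π * π₀) ?_ ?_ ?_ ?_
    · intro π hπ
      simp only [coe_filter, mem_univ, true_and, Set.mem_ofPred_eq] at hπ ⊢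
      funext i
      have h2 := congrFun hπ (π₀⁻¹ i)
      have h3 := hπ₀ (π₀⁻¹ i)
      rw [← Equiv.Perm.mul_apply, mul_inv_cancel, Equiv.Perm.one_apply] at h3
      exact h2.trans h3.symm
    · intro π hπ
      simp only [coe_filter, mem_univ, true_and, Set.mem_ofPred_eq] at hπ ⊢
      funext i
      exact (congrFun hπ (π₀ i)).trans (hπ₀ i)
    · intro π _
      simp
    · intro π _
      simp
  · rw [Finset.card_eq_zero, Finset.filter_eq_empty_iff]
    rintro π - rfl
    apply h
    rw [← Multiset.map_map]
    congr 1
    exact (congrArg Finset.val (Finset.map_univ_equiv π)).symm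

/-- Only the partition formed by the exponents contributes; the number of permutations giving the
same monomial cancels the multiplicity factorials. If an exponent is zero, both sides vanish. -/
theorem coeff_psi (g m : ℕ) (β : Fin m →₀ ℕ) :
    MvPowerSeries.coeff β (Psi g m) = hurG g (univ.val.map β) := by
  classical
  have hdeg : β.degree = (univ.val.map β).sum := by
    rw [Finsupp.degree_eq_sum]
    rfl
  set s : Multiset ℕ := univ.val.map β with hs
  have hcard : Multiset.card s = m := by simp [hs]
  have hXi : ∀ α : β.degree.Partition, MvPowerSeries.coeff β (Xi m α) =
      if α.parts = s then (multFactorial α.parts : ℚ) else 0 := by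
    intro α
    rw [Xi]
    by_cases h1 : Multiset.card α.parts = m
    · rw [if_pos h1, map_sum]
      set a : Fin m → ℕ := fun i => (α.parts.sort (· ≥ ·)).getD i 0 with ha
      have hsort : (univ.val.map a : Multiset ℕ) = α.parts := by
        rw [Fin.univ_val_map]
        conv_rhs => rw [← Multiset.sort_eq α.parts (· ≥ ·)]
        congr 1
        have hlen : (α.parts.sort (· ≥ ·)).length = m := by rw [Multiset.length_sort, h1]
        refine List.ext_getElem (by rw [List.length_ofFn, hlen]) fun i h2 h3 => ?_
        rw [List.getElem_ofFn]
        exact List.getD_eq_getElem _ _ h3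
      have hmon : ∀ π : Equiv.Perm (Fin m), MvPowerSeries.coeff β (MvPowerSeries.monomial
          (Finsupp.equivFunOnFinite.symm fun i : Fin m =>
            (α.parts.sort (· ≥ ·)).getD (π i : ℕ) 0) (1 : ℚ)) =
          if a ∘ ⇑π = ⇑β then 1 else 0 := by
        intro π
        rw [MvPowerSeries.coeff_monomial]
        refine ite_one_zero_congr ?_
        rw [DFunLike.ext_iff, funext_iff]
        exact forall_congr' fun i => eq_comm
      rw [Finset.sum_congr rfl fun π _ => hmon π, Finset.sum_boole, count_perm_comp_eq, hsort,
        ← hs]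
      split_ifs <;> simp
    · rw [if_neg h1, if_neg fun h2 : α.parts = s => h1 (by rw [h2, hcard])]
      simp
  change ∑ α : β.degree.Partition, (PhiCoeff g α).eval 1 * MvPowerSeries.coeff β (Xi m α) = _
  simp only [hXi]
  by_cases h0 : 0 ∉ s
  · have hα : ∃ α : β.degree.Partition, α.parts = s :=
      ⟨⟨s, fun {i} hi => Nat.pos_of_ne_zero fun h => h0 (h ▸ hi), hdeg.symm⟩, rfl⟩
    obtain ⟨α, hα⟩ := hα
    rw [Finset.sum_eq_single α]
    · rw [if_pos hα]
      by_cases hn : β.degree = 0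
      · rw [PhiCoeff, if_pos hn, Polynomial.eval_zero, zero_mul]
        have : s = 0 := by
          rw [← Multiset.card_eq_zero]
          have := card_le_sum_of_zero_notMem h0
          omega
        rw [this, hurG, hur_empty]
      · rw [eval_phiCoeff g hn, hα]
    · intro α' _ hne
      rw [if_neg, mul_zero]
      intro h
      exact hne (Nat.Partition.ext (h.trans hα.symm))
    · simp
  · rw [not_not] at h0
    rw [hurG_of_zero_mem h0]
    refine Finset.sum_eq_zero fun α _ => ?_
    rw [if_neg, mul_zero]
    intro h
    exact lt_irrefl 0 (α.parts_pos (h ▸ h0))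

/-- The series `Ψ^{(g)}` in the variables `x_i`, `i ∈ S`. -/
def psiS (g : ℕ) (S : Finset ℕ) : Series := fun β =>
  if β.support = S then hurG g (S.val.map β) else 0

theorem coeff_psiS (g : ℕ) (S : Finset ℕ) (β : ℕ →₀ ℕ) : MvPowerSeries.coeff β (psiS g S) =
    if β.support = S then hurG g (S.val.map β) else 0 := rfl

/-- Every variable occurs in every monomial of Ψ, since a part equal to zero makes the count vanish.
The series therefore depends only on the set of its variables. -/
theorem psiAt_eq {g m : ℕ} {v : Fin m → ℕ} (hv : Function.Injective v) :
    PsiAt g m v = psiS g (univ.image v) := by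
  classical
  ext β
  rw [coeff_psiS]
  have hmap : (univ.image v).val = univ.val.map v := Finset.image_val_of_injOn hv.injOn
  by_cases h : ∃ γ : Fin m →₀ ℕ, Finsupp.embDomain ⟨v, hv⟩ γ = β
  · obtain ⟨γ, rfl⟩ := h
    have h1 : MvPowerSeries.coeff (Finsupp.embDomain ⟨v, hv⟩ γ) (PsiAt g m v) =
        MvPowerSeries.coeff γ (Psi g m) :=
      MvPowerSeries.coeff_embDomain_rename ⟨v, hv⟩ (Psi g m) γ
    have h2 : (univ.image v).val.map (Finsupp.embDomain ⟨v, hv⟩ γ) = univ.val.map γ := by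
      rw [hmap, Multiset.map_map]
      refine Multiset.map_congr rfl fun i _ => ?_
      exact Finsupp.embDomain_apply_self ⟨v, hv⟩ γ i
    rw [h1, coeff_psi, h2]
    split_ifs with h3
    · rfl
    · refine hurG_of_zero_mem ?_
      by_contra h4
      apply h3
      rw [Finsupp.support_embDomain]
      have h5 : γ.support = univ := by
        ext i
        simp only [Finsupp.mem_support_iff, mem_univ, iff_true]
        exact fun h => h4 (Multiset.mem_map.2 ⟨i, mem_univ i, h⟩)
      rw [h5, Finset.map_eq_image]
      rfl
  · rw [if_neg]
    · refine MvPowerSeries.coeff_rename_eq_zero v _ ?_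
      rintro ⟨γ, hγ⟩
      exact h ⟨γ, by rw [Finsupp.embDomain_eq_mapDomain]; exact hγ⟩
    · intro h1
      apply h
      refine ⟨β.comapDomain v hv.injOn, ?_⟩
      rw [Finsupp.embDomain_eq_mapDomain]
      refine Finsupp.mapDomain_comapDomain v hv β ?_
      rw [h1]
      simp

theorem psiS_empty (g : ℕ) : psiS g ∅ = 0 := by
  ext β
  rw [coeff_psiS]
  split_ifs
  · exact hur_empty _
  · rfl

/-! ### Coefficients of the terms of the equation -/

section Terms

variable (g : ℕ) {M : Finset ℕ}

theorem coeff_X_mul' (i : ℕ) (F : Series) (β : ℕ →₀ ℕ) :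
    MvPowerSeries.coeff β (MvPowerSeries.X i * F) =
      if β i = 0 then 0 else MvPowerSeries.coeff (β.update i (β i - 1)) F := by
  rw [X_eq_subst, coeff_subst_X_mul]
  split_ifs with h
  · rw [h]
    simp
  · rw [Finset.sum_eq_single (1, β i - 1)]
    · simp
    · rintro ⟨p, q⟩ hp hne
      rw [PowerSeries.coeff_X, if_neg, zero_mul]
      rintro h
      simp only at h
      subst h
      rw [HasAntidiagonal.mem_antidiagonal] at hp
      simp only at hp
      exact hne (by rw [show q = β i - 1 by omega])
    · intro h1
      refine absurd ?_ h1
      rw [HasAntidiagonal.mem_antidiagonal]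
      dsimp only
      omega

theorem coeff_xD_psiS_insert {r : ℕ} {S : Finset ℕ} (hr : r ∉ S) (β : ℕ →₀ ℕ) :
    MvPowerSeries.coeff β (xD r (psiS g (insert r S))) =
      if β.support = insert r S then (β r : ℚ) * hurG g (β r ::ₘ S.val.map β) else 0 := by
  rw [coeff_xD, coeff_psiS, Finset.insert_val_of_notMem hr, Multiset.map_cons]
  split_ifs
  · rfl
  · rw [mul_zero]

theorem map_val_congr {S : Finset ℕ} {β γ : ℕ → ℕ} (h : ∀ i ∈ S, β i = γ i) :
    S.val.map β = S.val.map γ := Multiset.map_congr rfl h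

/-- The two factors share only the variable x_r, so a factorization of a monomial amounts to
splitting the exponent of x_r into two positive parts. -/
theorem coeff_xD_mul_xD {a b r : ℕ} {S T : Finset ℕ} (hS : r ∉ S) (hT : r ∉ T)
    (hST : Disjoint S T) (β : ℕ →₀ ℕ) :
    MvPowerSeries.coeff β (xD r (psiS a (insert r S)) * xD r (psiS b (insert r T))) =
      if β.support = insert r (S ∪ T) then
        ∑ p ∈ posAnti (β r), (p.1 : ℚ) * p.2 *
          (hurG a (p.1 ::ₘ S.val.map β) * hurG b (p.2 ::ₘ T.val.map β))
      else 0 := by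
  classical
  rw [MvPowerSeries.coeff_mul]
  simp only [coeff_xD_psiS_insert _ hS, coeff_xD_psiS_insert _ hT]
  have hsupp : ∀ p ∈ antidiagonal β, p.1.support = insert r S → p.2.support = insert r T →
      β.support = insert r (S ∪ T) := by
    intro p hp h1 h2
    rw [HasAntidiagonal.mem_antidiagonal] at hp
    ext i
    have e1 := Finset.ext_iff.1 h1 i
    have e2 := Finset.ext_iff.1 h2 i
    rw [Finsupp.mem_support_iff] at e1 e2 ⊢
    rw [mem_insert] at e1 e2 ⊢
    rw [mem_union, ← hp, Finsupp.add_apply]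
    have : p.1 i + p.2 i ≠ 0 ↔ p.1 i ≠ 0 ∨ p.2 i ≠ 0 := by omega
    tauto
  split_ifs with hβ
  · symm
    -- The exponent of a factor: β on its private variables, and the prescribed share k at r.
    let e : (ℕ →₀ ℕ) → Finset ℕ → ℕ → (ℕ →₀ ℕ) := fun β S k =>
      (β.filter fun i => i ∈ S).update r k
    have her : ∀ U k, e β U k r = k := fun U k => by simp [e, Finsupp.update_apply]
    have hei : ∀ U k i, i ≠ r → e β U k i = if i ∈ U then β i else 0 := fun U k i hi => by
      simp [e, hi, Finsupp.update_apply, Finsupp.filter_apply]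
    have hβi : ∀ i, i ≠ r → (β i ≠ 0 ↔ i ∈ S ∨ i ∈ T) := fun i hi => by
      have := Finset.ext_iff.1 hβ i
      rw [Finsupp.mem_support_iff, mem_insert, mem_union] at this
      tauto
    have hes : ∀ (U : Finset ℕ) k, U ⊆ S ∪ T → r ∉ U → k ≠ 0 → (e β U k).support = insert r U := by
      intro U k hU hrU hk
      ext i
      rw [Finsupp.mem_support_iff, mem_insert]
      by_cases hi : i = r
      · rw [hi, her]
        simp [hk]
      · rw [hei U k i hi]
        by_cases hiU : i ∈ U
        · have := (hβi i hi).2 (mem_union.1 (hU hiU))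
          simp [hiU, this]
        · simp [hiU, hi]
    have hem : ∀ (U : Finset ℕ) k, r ∉ U → U.val.map (e β U k) = U.val.map β := by
      intro U k hrU
      refine map_val_congr fun i hi => ?_
      rw [hei U k i (fun h => hrU (h ▸ hi)), if_pos hi]
    refine Finset.sum_of_injOn (fun p => (e β S p.1, e β T p.2)) ?_ ?_ ?_ ?_
    · rintro p - q - h
      rw [Prod.mk.injEq] at h
      have h1 := congrArg (fun f => f r) h.1
      have h2 := congrArg (fun f => f r) h.2
      simp only [her] at h1 h2
      exact Prod.ext h1 h2
    · intro p hp
      have hp' := (mem_posAnti.1 (Finset.mem_coe.1 hp)).1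
      rw [Finset.mem_coe, HasAntidiagonal.mem_antidiagonal]
      ext i
      rw [Finsupp.add_apply]
      by_cases hi : i = r
      · rw [hi, her, her, hp']
      · rw [hei _ _ i hi, hei _ _ i hi]
        have h1 := hβi i hi
        have h2 : i ∈ S → i ∉ T := fun h => Finset.disjoint_left.1 hST h
        split_ifs <;> first | rfl | omega | tauto
    · intro p hp hn
      split_ifs with h1 h2
      · exfalso
        apply hn
        rw [HasAntidiagonal.mem_antidiagonal] at hp
        have hpi : ∀ i, p.1 i + p.2 i = β i := fun i => by rw [← hp, Finsupp.add_apply]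
        have e1 : ∀ i, p.1 i ≠ 0 ↔ i = r ∨ i ∈ S := fun i => by
          rw [← Finsupp.mem_support_iff, h1, mem_insert]
        have e2 : ∀ i, p.2 i ≠ 0 ↔ i = r ∨ i ∈ T := fun i => by
          rw [← Finsupp.mem_support_iff, h2, mem_insert]
        refine ⟨(p.1 r, p.2 r), ?_, Prod.ext ?_ ?_⟩
        · rw [Finset.mem_coe, mem_posAnti]
          exact ⟨hpi r, (e1 r).2 (Or.inl rfl), (e2 r).2 (Or.inl rfl)⟩
        · ext i
          by_cases hi : i = r
          · simp only [hi, her]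
          · dsimp only
            rw [hei _ _ i hi]
            have h3 : i ∈ S → i ∉ T := fun h => Finset.disjoint_left.1 hST h
            have h4 := e1 i
            have h5 := e2 i
            have h6 := hpi i
            split_ifs with h7
            · have : ¬ p.2 i ≠ 0 := by tauto
              omega
            · have : ¬ p.1 i ≠ 0 := by tauto
              omega
        · ext i
          by_cases hi : i = r
          · simp only [hi, her]
          · dsimp only
            rw [hei _ _ i hi]
            have h3 : i ∈ S → i ∉ T := fun h => Finset.disjoint_left.1 hST h
            have h4 := e1 i
            have h5 := e2 i
            have h6 := hpi i
            split_ifs with h7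
            · have : ¬ p.1 i ≠ 0 := by tauto
              omega
            · have : ¬ p.2 i ≠ 0 := by tauto
              omega
      · rw [mul_zero]
      · rw [zero_mul]
      · rw [zero_mul]
    · intro p hp
      obtain ⟨-, hp1, hp2⟩ := mem_posAnti.1 hp
      rw [if_pos (hes S p.1 subset_union_left hS hp1), if_pos (hes T p.2 subset_union_right hT hp2),
        her, her, hem S _ hS, hem T _ hT]
      ring
  · refine Finset.sum_eq_zero fun p hp => ?_
    by_cases h1 : p.1.support = insert r S
    · by_cases h2 : p.2.support = insert r T
      · exact absurd (hsupp p hp h1 h2) hβ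
      · rw [if_neg h2, mul_zero]
    · rw [if_neg h1, zero_mul]

theorem mapDomain_mergeIdx (a b : ℕ) (γ : ℕ →₀ ℕ) :
    Finsupp.mapDomain (mergeIdx a b) γ = γ.erase a + Finsupp.single b (γ a) := by
  conv_lhs => rw [← Finsupp.erase_add_single a γ, Finsupp.mapDomain_add,
    Finsupp.mapDomain_single]
  congr 1
  · conv_rhs => rw [← Finsupp.mapDomain_id (v := γ.erase a)]
    refine Finsupp.mapDomain_congr fun i hi => ?_
    rw [Finsupp.support_erase, mem_erase] at hi
    simp [mergeIdx, hi.1]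
  · simp [mergeIdx]

/-- Setting x_t = x_r adds the two exponents, so the coefficient collects all ways of writing β r as
an ordered sum of two positive parts, that is, all cuts. -/
theorem coeff_setEq {t r : ℕ} (hr : r ∈ M) (ht : t ∉ M) (β : ℕ →₀ ℕ) :
    MvPowerSeries.coeff β (setEq t r (xD r (xD t (psiS g (insert t M))))) =
      if β.support = M then ∑ p ∈ posAnti (β r), (p.1 : ℚ) * p.2 *
        hurG g (p.1 ::ₘ p.2 ::ₘ (M.erase r).val.map β) else 0 := by
  classical
  have htr : t ≠ r := fun h => ht (h ▸ hr)
  rw [setEq, MvPowerSeries.coeff_rename]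
  simp only [coeff_xD, coeff_psiS]
  have hmem : ∀ γ : ℕ →₀ ℕ, Finsupp.mapDomain (mergeIdx t r) γ = β ↔
      β t = 0 ∧ γ r + γ t = β r ∧ ∀ i, i ≠ t → i ≠ r → γ i = β i := by
    intro γ
    rw [mapDomain_mergeIdx, DFunLike.ext_iff]
    constructor
    · intro h
      refine ⟨?_, ?_, fun i hit hir => ?_⟩
      · rw [← h t]
        simp [htr]
      · rw [← h r]
        simp [htr.symm]
      · rw [← h i]
        simp [hit, hir]
    · rintro ⟨h1, h2, h3⟩ i
      rw [Finsupp.add_apply]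
      by_cases hit : i = t
      · rw [hit, h1]
        simp [htr]
      · by_cases hir : i = r
        · rw [hir, ← h2]
          simp [htr.symm]
        · rw [← h3 i hit hir]
          simp [hit, hir]
  split_ifs with hβ
  · symm
    have hβi : ∀ i, β i ≠ 0 ↔ i ∈ M := fun i => by rw [← Finsupp.mem_support_iff, hβ]
    have hβt : β t = 0 := by
      by_contra h
      exact ht ((hβi t).1 h)
    refine Finset.sum_of_injOn (fun p => (β.update r p.1).update t p.2) ?_ ?_ ?_ ?_
    · rintro p - q - h
      have h1 := DFunLike.congr_fun h r
      have h2 := DFunLike.congr_fun h t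
      simp only [Finsupp.update_apply, htr.symm, if_false, if_true] at h1 h2
      exact Prod.ext h1 h2
    · intro p hp
      have hp' := (mem_posAnti.1 (Finset.mem_coe.1 hp)).1
      rw [Finset.mem_coe, Set.Finite.mem_toFinset, Set.mem_preimage, Set.mem_singleton_iff, hmem]
      refine ⟨hβt, ?_, fun i hit hir => ?_⟩
      · simp [Finsupp.update_apply, htr.symm, hp']
      · simp [Finsupp.update_apply, hit, hir]
    · intro γ hγ hn
      rw [Set.Finite.mem_toFinset, Set.mem_preimage, Set.mem_singleton_iff, hmem] at hγ
      obtain ⟨h1, h2, h3⟩ := hγ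
      rw [if_neg, mul_zero, mul_zero]
      intro h4
      apply hn
      have e1 : ∀ i, γ i ≠ 0 ↔ i = t ∨ i ∈ M := fun i => by
        rw [← Finsupp.mem_support_iff, h4, mem_insert]
      refine ⟨(γ r, γ t), ?_, ?_⟩
      · rw [Finset.mem_coe, mem_posAnti]
        exact ⟨h2, (e1 r).2 (Or.inr hr), (e1 t).2 (Or.inl rfl)⟩
      · ext i
        simp only [Finsupp.update_apply]
        split_ifs with h5 h6
        · rw [h5]
        · rw [h6]
        · exact (h3 i h5 h6).symm
    · intro p hp
      obtain ⟨-, hp1, hp2⟩ := mem_posAnti.1 hp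
      set γ := (β.update r p.1).update t p.2 with hγ
      have hγr : γ r = p.1 := by simp [hγ, Finsupp.update_apply, htr.symm]
      have hγt : γ t = p.2 := by simp [hγ, Finsupp.update_apply]
      have hγi : ∀ i, i ≠ t → i ≠ r → γ i = β i := fun i hit hir => by
        simp [hγ, Finsupp.update_apply, hit, hir]
      rw [if_pos, hγr, hγt, Finset.insert_val_of_notMem ht, Multiset.map_cons, hγt]
      · have h1 : M.val.map γ = p.1 ::ₘ (M.erase r).val.map β := by
          conv_lhs => rw [← Finset.insert_erase hr]
          rw [Finset.insert_val_of_notMem (notMem_erase r M), Multiset.map_cons, hγr]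
          congr 1
          refine map_val_congr fun i hi => ?_
          rw [mem_erase] at hi
          exact hγi i (fun h => ht (h ▸ hi.2)) hi.1
        rw [h1, Multiset.cons_swap]
        ring
      · ext i
        rw [Finsupp.mem_support_iff, mem_insert]
        by_cases hit : i = t
        · simp [hit, hγt, hp2]
        · by_cases hir : i = r
          · simp [hir, hγr, hp1, hr]
          · rw [hγi i hit hir, hβi]
            simp [hit]
  · refine Finset.sum_eq_zero fun γ hγ => ?_
    rw [Set.Finite.mem_toFinset, Set.mem_preimage, Set.mem_singleton_iff, hmem] at hγ
    obtain ⟨h1, h2, h3⟩ := hγ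
    rw [if_neg, mul_zero, mul_zero]
    intro h4
    apply hβ
    have e1 : ∀ i, γ i ≠ 0 ↔ i = t ∨ i ∈ M := fun i => by
      rw [← Finsupp.mem_support_iff, h4, mem_insert]
    ext i
    rw [Finsupp.mem_support_iff]
    by_cases hit : i = t
    · simp [hit, h1, ht]
    · by_cases hir : i = r
      · have := (e1 r).2 (Or.inr hr)
        simp only [hir, hr, iff_true]
        omega
      · rw [← h3 i hit hir, e1]
        simp [hit]

/-- The join term. -/
def joinS (M : Finset ℕ) (r s : ℕ) : Series := fun β =>
  if β.support = M then ((β r : ℚ) + β s) *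
    hurG g ((β r + β s) ::ₘ ((M.erase r).erase s).val.map β) else 0

theorem coeff_joinS (r s : ℕ) (β : ℕ →₀ ℕ) : MvPowerSeries.coeff β (joinS g M r s) =
    if β.support = M then ((β r : ℚ) + β s) *
      hurG g ((β r + β s) ::ₘ ((M.erase r).erase s).val.map β) else 0 := rfl

/-- In x_r and x_s the coefficients of the join term depend only on the sum of the two exponents, so
multiplication by x_r - x_s telescopes: only monomials in which one of the two exponents is 1
survive. -/
theorem sub_mul_joinS {r s : ℕ} (hr : r ∈ M) (hs : s ∈ M) (hrs : r ≠ s) :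
    (MvPowerSeries.X r - MvPowerSeries.X s) * joinS g M r s =
      MvPowerSeries.X s * xD r (psiS g (M.erase s)) -
        MvPowerSeries.X r * xD s (psiS g (M.erase r)) := by
  classical
  ext β
  have hR : ∀ γ : ℕ →₀ ℕ, (∀ i, i ≠ r → i ≠ s → γ i = β i) → ∀ N : Finset ℕ,
      (∀ i, i ≠ r → i ≠ s → (i ∈ N ↔ i ∈ M)) →
      (γ.support = N ↔ (∀ i, i ≠ r → i ≠ s → (β i ≠ 0 ↔ i ∈ M)) ∧
        (γ r ≠ 0 ↔ r ∈ N) ∧ (γ s ≠ 0 ↔ s ∈ N)) := by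
    intro γ hγ N hN
    rw [Finset.ext_iff]
    simp only [Finsupp.mem_support_iff]
    constructor
    · intro h
      refine ⟨fun i hir his => ?_, h r, h s⟩
      rw [← hγ i hir his, h i, hN i hir his]
    · rintro ⟨h1, h2, h3⟩ i
      by_cases hir : i = r
      · rw [hir]
        exact h2
      · by_cases his : i = s
        · rw [his]
          exact h3
        · rw [hγ i hir his, h1 i hir his, hN i hir his]
  set L := ((M.erase r).erase s).val.map β with hL
  have hmap : ∀ γ : ℕ →₀ ℕ, (∀ i, i ≠ r → i ≠ s → γ i = β i) →
      ((M.erase r).erase s).val.map γ = L := by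
    intro γ hγ
    refine map_val_congr fun i hi => ?_
    simp only [mem_erase] at hi
    exact hγ i hi.2.1 hi.1
  have hMs : M.erase s = insert r ((M.erase r).erase s) := by
    rw [Finset.erase_right_comm, Finset.insert_erase (mem_erase.2 ⟨hrs, hr⟩)]
  have hMr : M.erase r = insert s ((M.erase r).erase s) := by
    rw [Finset.insert_erase (mem_erase.2 ⟨hrs.symm, hs⟩)]
  have hnr : r ∉ (M.erase r).erase s := by simp
  have hns : s ∉ (M.erase r).erase s := by simp
  have hJ : ∀ γ : ℕ →₀ ℕ, (∀ i, i ≠ r → i ≠ s → γ i = β i) →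
      MvPowerSeries.coeff γ (joinS g M r s) =
      if (∀ i, i ≠ r → i ≠ s → (β i ≠ 0 ↔ i ∈ M)) ∧ γ r ≠ 0 ∧ γ s ≠ 0 then
        ((γ r + γ s : ℕ) : ℚ) * hurG g ((γ r + γ s) ::ₘ L) else 0 := by
    intro γ hγ
    rw [coeff_joinS, hmap γ hγ, Nat.cast_add]
    refine if_congr ?_ rfl rfl
    rw [hR γ hγ M fun i _ _ => Iff.rfl]
    simp [hr, hs]
  have hDr : ∀ γ : ℕ →₀ ℕ, (∀ i, i ≠ r → i ≠ s → γ i = β i) →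
      MvPowerSeries.coeff γ (xD r (psiS g (M.erase s))) =
      if (∀ i, i ≠ r → i ≠ s → (β i ≠ 0 ↔ i ∈ M)) ∧ γ r ≠ 0 ∧ γ s = 0 then
        (γ r : ℚ) * hurG g (γ r ::ₘ L) else 0 := by
    intro γ hγ
    have h1 := hR γ hγ (M.erase s) fun i _ his => by simp [his]
    rw [hMs] at h1 ⊢
    rw [coeff_xD_psiS_insert g hnr, hmap γ hγ]
    refine if_congr ?_ rfl rfl
    rw [h1]
    simp [hrs.symm]
  have hDs : ∀ γ : ℕ →₀ ℕ, (∀ i, i ≠ r → i ≠ s → γ i = β i) →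
      MvPowerSeries.coeff γ (xD s (psiS g (M.erase r))) =
      if (∀ i, i ≠ r → i ≠ s → (β i ≠ 0 ↔ i ∈ M)) ∧ γ r = 0 ∧ γ s ≠ 0 then
        (γ s : ℚ) * hurG g (γ s ::ₘ L) else 0 := by
    intro γ hγ
    have h1 := hR γ hγ (M.erase r) fun i hir _ => by simp [hir]
    rw [hMr] at h1 ⊢
    rw [coeff_xD_psiS_insert g hns, hmap γ hγ]
    refine if_congr ?_ rfl rfl
    rw [h1]
    simp [hrs]
  have hur_ : ∀ k i, i ≠ r → i ≠ s → β.update r k i = β i := fun k i hir his => by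
    simp [Finsupp.update_apply, hir]
  have hus_ : ∀ k i, i ≠ r → i ≠ s → β.update s k i = β i := fun k i hir his => by
    simp [Finsupp.update_apply, his]
  rw [sub_mul, map_sub, map_sub, coeff_X_mul', coeff_X_mul', coeff_X_mul', coeff_X_mul',
    hJ _ (hur_ _), hJ _ (hus_ _), hDr _ (hus_ _), hDs _ (hur_ _)]
  simp only [Finsupp.update_apply, hrs, hrs.symm, if_true, if_false]
  generalize (∀ i, i ≠ r → i ≠ s → (β i ≠ 0 ↔ i ∈ M)) = R
  by_cases hRβ : R
  · simp only [hRβ, true_and]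
    generalize β r = a
    generalize β s = b
    rcases a with _ | _ | a <;> rcases b with _ | _ | b <;> simp
    · rw [show 1 + (b + 1) = b + 1 + 1 by ring]
      ring
    · rw [show a + 1 + (b + 1 + 1) = a + 1 + 1 + (b + 1) by ring]
      ring
  · simp only [hRβ, false_and, if_false, ite_self]

end Terms

/-! ### The join-cut equation as a differential equation -/

section PDE

/-- The cut-and-join equation for the series in the variables `x_i`, `i ∈ M`. -/
theorem psiS_cut_join {g : ℕ} (hg : 1 ≤ g) {M : Finset ℕ} (hM : M.Nonempty) {t : ℕ} (ht : t ∉ M) :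
    ∑ i ∈ M, xD i (psiS g M) + ((M.card : ℚ) + 2 * ((g : ℚ) - 1)) • psiS g M =
      (1 / 2 : ℚ) • (∑ r ∈ M, ∑ s ∈ M.erase r, joinS g M r s) +
      (1 / 2 : ℚ) • (∑ r ∈ M, setEq t r (xD r (xD t (psiS (g - 1) (insert t M))))) +
      (1 / 2 : ℚ) • (∑ r ∈ M, ∑ S ∈ (M.erase r).powerset, ∑ a ∈ antidiagonal g,
        xD r (psiS a.1 (insert r S)) * xD r (psiS a.2 (insert r ((M.erase r) \ S)))) := by
  classical
  ext β
  have hins : ∀ r ∈ M, ∀ S ∈ (M.erase r).powerset, insert r (S ∪ (M.erase r) \ S) = M := by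
    intro r hr S hS
    rw [Finset.union_sdiff_of_subset (mem_powerset.1 hS), Finset.insert_erase hr]
  simp only [map_add, map_sum, MvPowerSeries.coeff_smul, coeff_xD, coeff_psiS]
  rw [Finset.sum_congr rfl fun r hr => coeff_setEq (g - 1) hr ht β,
    Finset.sum_congr rfl fun r hr => Finset.sum_congr rfl fun S hS => Finset.sum_congr rfl
      fun a _ => (coeff_xD_mul_xD (a := a.1) (b := a.2)
        (fun h => (mem_erase.1 (mem_powerset.1 hS h)).1 rfl)
        (fun h => (mem_erase.1 (mem_sdiff.1 h).1).1 rfl) Finset.disjoint_sdiff β).trans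
        (by rw [hins r hr S hS])]
  simp only [coeff_joinS]
  by_cases hβ : β.support = M
  · simp only [hβ, if_true]
    have hβ0 : ∀ i ∈ M, β i ≠ 0 := fun i hi => by
      rwa [← Finsupp.mem_support_iff, hβ]
    have hpos : 1 ≤ ∑ i ∈ M, β i := by
      obtain ⟨i, hi⟩ := hM
      exact (Nat.one_le_iff_ne_zero.2 (hβ0 i hi)).trans
        (Finset.single_le_sum (f := fun i => β i) (fun _ _ => Nat.zero_le _) hi)
    -- Since g ≥ 1, the recursion applies even to a single part equal to 1; the equation is half of
    -- it, coefficient by coefficient.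
    have key := hurG_recursion hM hβ0 g (by omega)
    rw [← Finset.sum_mul, ← add_mul]
    have hLHS : (∑ i ∈ M, (β i : ℚ) + ((M.card : ℚ) + 2 * ((g : ℚ) - 1))) *
        hurG g (M.val.map β) =
        (1 / 2) * (2 * (∑ i ∈ M, (β i : ℚ) + M.card + 2 * g - 2) * hurG g (M.val.map β)) := by
      ring
    rw [hLHS, key, ← mul_add, ← mul_add, add_assoc]
    congr 2
    rw [← Finset.sum_add_distrib]
    refine Finset.sum_congr rfl fun r _ => ?_
    simp only [if_neg (show g ≠ 0 by omega), mul_add, Finset.sum_add_distrib]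
    congr 1
    simp only [Finset.mul_sum]
    exact Finset.sum_comm.trans (Finset.sum_congr rfl fun S _ => Finset.sum_comm)
  · simp only [hβ, if_false, mul_zero, Finset.sum_const_zero, add_zero]

end PDE

/-! ### The series of genus zero in one and two variables -/

theorem hurG_zero {s : Multiset ℕ} (h : 0 ∉ s) (h0 : s ≠ 0) : hurG 0 s = genusZero s := by
  have h1 := card_le_sum_of_zero_notMem h
  have h2 : 0 < Multiset.card s := Multiset.card_pos.2 h0
  obtain ⟨j, hj⟩ := Nat.exists_eq_add_of_le' (show 2 ≤ s.sum + Multiset.card s by omega)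
  exact hurG_zero_eq_genusZero j s h h0 hj

/-- By Hurwitz's formula the coefficient of x^b is b · b^(-2) · b^b/b! = b^(b-1)/b!, the coefficient
of the tree series. -/
theorem xD_psiS_singleton (r : ℕ) : xD r (psiS 0 {r}) = w r := by
  ext β
  rw [coeff_xD, coeff_psiS, coeff_w]
  by_cases h : β.support = {r}
  · obtain ⟨h1, h2⟩ := Finsupp.support_eq_singleton.1 h
    rw [if_pos h, if_pos h2]
    have h3 : ({r} : Finset ℕ).val.map β = {β r} := rfl
    have h4 : (β r : ℚ) ≠ 0 := by exact_mod_cast h1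
    have h5 := mul_treeT h1
    rw [h3, hurG_zero (by simpa using h1.symm) (by simp), genusZero]
    simp only [Multiset.sum_singleton, Multiset.card_singleton, Multiset.map_singleton,
      Multiset.prod_singleton]
    rw [← h5, show ((1 : ℕ) : ℤ) - 3 = -2 by norm_num, zpow_neg]
    field_simp
  · rw [if_neg h, mul_zero]
    split_ifs with h2
    · have : β r = 0 := by
        by_contra h1
        exact h (Finsupp.support_eq_singleton.2 ⟨h1, h2⟩)
      rw [this, treeT_zero]
    · rfl

/-- By Hurwitz's formula the coefficients are N a_N a_k/(N + k) with both exponents positive;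
subtracting W_r removes the terms of the κ-series without x_s. -/
theorem xD_psiS_pair {r s : ℕ} (hrs : r ≠ s) :
    xD r (psiS 0 {r, s}) = biSeries s r kappaCoeff - wFrac r := by
  ext β
  rw [map_sub, coeff_xD, coeff_psiS, coeff_biSeries, coeff_wFrac, kappaCoeff]
  by_cases hr : β r = 0
  · simp [hr]
  by_cases hs : β s = 0
  · have h1 : β.support ≠ {r, s} := fun h => by
      have : s ∈ β.support := by rw [h]; simp
      exact (Finsupp.mem_support_iff.1 this) hs
    have h2 : β.support ⊆ {s, r} ↔ β = Finsupp.single r (β r) := by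
      rw [Finsupp.eq_single_iff]
      constructor
      · intro h
        refine ⟨fun i hi => ?_, rfl⟩
        have := h hi
        rw [mem_insert, mem_singleton] at this
        rcases this with rfl | rfl
        · exact absurd hs (Finsupp.mem_support_iff.1 hi)
        · simp
      · rintro ⟨h, -⟩
        exact h.trans (by simp)
    have h3 : (β r : ℚ) ≠ 0 := by exact_mod_cast hr
    rw [if_neg h1, mul_zero]
    by_cases h4 : β = Finsupp.single r (β r)
    · rw [if_pos (h2.2 h4), if_pos h4, if_neg hr, if_neg hr, hs, treeA_zero, Nat.cast_zero]
      field_simp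
      ring
    · rw [if_neg fun h => h4 (h2.1 h), if_neg h4, sub_zero]
  · have h1 : β.support = {r, s} ↔ β.support ⊆ {s, r} := by
      rw [Finset.pair_comm r s]
      refine ⟨fun h => h.subset, fun h => h.antisymm fun i hi => ?_⟩
      rw [mem_insert, mem_singleton] at hi
      rw [Finsupp.mem_support_iff]
      rcases hi with rfl | rfl
      · exact hs
      · exact hr
    have h2 : β ≠ Finsupp.single r (β r) := fun h => by
      apply hs
      rw [h]
      simp [hrs]
    rw [if_neg h2, sub_zero]
    by_cases h : β.support = {r, s}
    · rw [if_pos h, if_pos (h1.1 h), if_neg hr]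
      have h3 : ({r, s} : Finset ℕ).val.map β = β r ::ₘ {β s} := by
        rw [Finset.insert_val_of_notMem (by simpa using hrs)]
        rfl
      rw [h3, hurG_zero _ (by simp), genusZero]
      · simp only [Multiset.sum_cons, Multiset.sum_singleton, Multiset.card_cons,
          Multiset.card_singleton, Multiset.map_cons, Multiset.map_singleton, Multiset.prod_cons,
          Multiset.prod_singleton]
        rw [show ((1 + 1 : ℕ) : ℤ) - 3 = -1 by norm_num, zpow_neg, zpow_one, div_eq_mul_inv]
        push_cast
        rw [add_comm (β s : ℚ)]
        ring
      · simp only [Multiset.mem_cons, Multiset.mem_singleton, not_or]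
        exact ⟨fun h => hr h.symm, fun h => hs h.symm⟩
    · rw [if_neg h, if_neg fun h5 => h (h1.2 h5), mul_zero]

/-! ### The equation in the field of fractions -/

section Field

theorem toField_injective : Function.Injective toField := IsFractionRing.injective _ _

theorem toField_smul (c : ℚ) (F : Series) : toField (c • F) = c * toField F := by
  rw [MvPowerSeries.smul_eq_C_mul, map_mul]
  congr 1
  exact map_ratCast (toField.comp (MvPowerSeries.C (σ := ℕ) (R := ℚ))) c

theorem ratCast_half : (((1 / 2 : ℚ)) : SeriesField) = 1 / 2 := by
  have : CharZero SeriesField := algebraRat.charZero _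
  norm_num

theorem toField_w_sub_ne_zero {r s : ℕ} (hrs : r ≠ s) : toField (w r) - toField (w s) ≠ 0 := by
  rw [← map_sub]
  exact (map_ne_zero_iff _ toField_injective).2 (w_sub_w_ne_zero hrs)

theorem toField_X_sub_ne_zero {r s : ℕ} (hrs : r ≠ s) :
    toField (MvPowerSeries.X r) - toField (MvPowerSeries.X s) ≠ 0 := by
  rw [← map_sub]
  exact (map_ne_zero_iff _ toField_injective).2 (X_sub_X_ne_zero hrs)

theorem toField_one_sub_w_mul (r : ℕ) :
    (1 - toField (w r)) * (1 + toField (wFrac r)) = 1 := by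
  rw [← map_one toField, ← map_sub, ← map_add, ← map_mul, one_sub_w_mul]

/-- The closed form of the κ-series contributes -x_r/(x_r - x_s), which cancels the explicit
dependence on x up to the constant -1; what remains is a rational function of w_r and w_s. -/
theorem joinS_coefficient {r s : ℕ} (hrs : r ≠ s) :
    toField (MvPowerSeries.X s) / (toField (MvPowerSeries.X r) - toField (MvPowerSeries.X s)) +
      toField (xD r (psiS 0 {r, s})) =
    toField (w s) / (1 - toField (w r)) * (1 / (toField (w r) - toField (w s))) := by
  have h1 := congrArg toField (kappa_mul hrs.symm)
  have h2 := toField_one_sub_w_mul r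
  have h3 := toField_w_sub_ne_zero hrs
  have h4 := toField_X_sub_ne_zero hrs
  have h5 := congrArg toField (w_mul_one_add_wFrac r)
  have h6 : 1 - toField (w r) ≠ 0 := left_ne_zero_of_mul (h2 ▸ one_ne_zero)
  rw [xD_psiS_pair hrs, map_sub]
  simp only [map_mul, map_sub, map_add, map_one] at h1 h5
  set K := toField (biSeries s r kappaCoeff)
  set W := toField (wFrac r)
  set a := toField (w r)
  set b := toField (w s)
  set x := toField (MvPowerSeries.X r)
  set y := toField (MvPowerSeries.X s)
  have hW : W = a / (1 - a) := by
    rw [eq_div_iff h6]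
    linear_combination h2 - h5 + h5
  have hK : K = -(x / (x - y)) + W / (a - b) := by
    field_simp
    linear_combination h1
  rw [hK, hW]
  field_simp
  ring

/-- Dividing by x_r - x_s writes each join term as the sum of two expressions exchanged by r ↔ s;
over ordered pairs they contribute equally, which absorbs the factor 1/2. -/
theorem sum_join {g : ℕ} (M : Finset ℕ) :
    toField ((1 / 2 : ℚ) • ∑ r ∈ M, ∑ s ∈ M.erase r, joinS g M r s) =
      ∑ r ∈ M, ∑ s ∈ M.erase r, toField (MvPowerSeries.X s) /
        (toField (MvPowerSeries.X r) - toField (MvPowerSeries.X s)) *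
        toField (xD r (psiS g (M.erase s))) := by
  set P : ℕ → ℕ → SeriesField := fun r s => toField (MvPowerSeries.X s) /
        (toField (MvPowerSeries.X r) - toField (MvPowerSeries.X s)) *
        toField (xD r (psiS g (M.erase s))) with hP
  have h1 : ∀ r ∈ M, ∀ s ∈ M.erase r, toField (joinS g M r s) = P r s + P s r := by
    intro r hr s hs
    rw [mem_erase] at hs
    have h2 := congrArg toField (sub_mul_joinS g hr hs.2 hs.1.symm)
    have h3 := toField_X_sub_ne_zero hs.1.symm
    have h4 := toField_X_sub_ne_zero hs.1
    simp only [map_mul, map_sub] at h2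
    rw [hP]
    dsimp only
    apply mul_left_cancel₀ h3
    rw [h2, mul_add, ← mul_assoc, mul_div_cancel₀ _ h3, ← mul_assoc,
      ← neg_sub (toField (MvPowerSeries.X s)) (toField (MvPowerSeries.X r)), neg_mul,
      mul_div_cancel₀ _ h4]
    ring
  have h2 : ∑ r ∈ M, ∑ s ∈ M.erase r, P s r = ∑ r ∈ M, ∑ s ∈ M.erase r, P r s := by
    refine Finset.sum_comm' fun r s => ?_
    simp only [mem_erase]
    tauto
  rw [toField_smul, map_sum]
  simp only [map_sum]
  rw [Finset.sum_congr rfl fun r hr => Finset.sum_congr rfl (h1 r hr)]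
  simp only [Finset.sum_add_distrib]
  rw [h2, ratCast_half]
  have : (2 : SeriesField) ≠ 0 := by
    have : CharZero SeriesField := algebraRat.charZero _
    norm_num
  change _ = ∑ r ∈ M, ∑ s ∈ M.erase r, P r s
  rw [← two_mul, ← mul_assoc, one_div, inv_mul_cancel₀ this, one_mul]

theorem sum_antidiagonal_ends {R : Type*} [AddCommMonoid R] {g : ℕ} (hg : 1 ≤ g)
    (F : ℕ × ℕ → R) : ∑ a ∈ antidiagonal g, F a =
      F (0, g) + F (g, 0) + ∑ a ∈ Icc 1 (g - 1), F (a, g - a) := by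
  rw [Finset.Nat.sum_antidiagonal_eq_sum_range_succ_mk, Finset.sum_range_succ, Nat.sub_self]
  obtain ⟨k, rfl⟩ := Nat.exists_eq_add_of_le' hg
  rw [Finset.sum_range_succ', Nat.add_sub_cancel, Nat.sub_zero, add_comm (∑ i ∈ range k, _),
    add_right_comm]
  congr 1
  rw [Finset.range_eq_Ico, Finset.sum_Ico_add' (fun i => F (i, k + 1 - i)) 0 k 1]
  rfl

/-- The product terms by the size of the first set. -/
def prodTerm (g : ℕ) (M : Finset ℕ) (a j : ℕ) : SeriesField :=
  ∑ r ∈ M, ∑ S ∈ (M.erase r).powersetCard j, toField (xD r (psiS a (insert r S))) *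
    toField (xD r (psiS (g - a) (insert r ((M.erase r) \ S))))

theorem sum_powerset_eq_prodTerm (g : ℕ) (M : Finset ℕ) (a : ℕ) :
    ∑ r ∈ M, ∑ S ∈ (M.erase r).powerset, toField (xD r (psiS a (insert r S))) *
      toField (xD r (psiS (g - a) (insert r ((M.erase r) \ S)))) =
    ∑ j ∈ range M.card, prodTerm g M a j := by
  simp only [prodTerm]
  rw [Finset.sum_comm]
  refine Finset.sum_congr rfl fun r hr => ?_
  rw [Finset.sum_powerset, Finset.card_erase_add_one hr]

theorem prodTerm_zero_zero (g : ℕ) (M : Finset ℕ) :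
    prodTerm g M 0 0 = ∑ r ∈ M, toField (w r) * toField (xD r (psiS g M)) := by
  refine Finset.sum_congr rfl fun r hr => ?_
  rw [Finset.powersetCard_zero, Finset.sum_singleton, Finset.sdiff_empty,
    Finset.insert_erase hr, Nat.sub_zero, insert_empty_eq, xD_psiS_singleton]

theorem prodTerm_zero_one (g : ℕ) (M : Finset ℕ) :
    prodTerm g M 0 1 = ∑ r ∈ M, ∑ s ∈ M.erase r, toField (xD r (psiS 0 {r, s})) *
      toField (xD r (psiS g (M.erase s))) := by
  refine Finset.sum_congr rfl fun r hr => ?_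
  rw [Finset.powersetCard_one, Finset.sum_map]
  refine Finset.sum_congr rfl fun s hs => ?_
  rw [mem_erase] at hs
  rw [Nat.sub_zero]
  have h1 : insert r (M.erase r \ {s}) = M.erase s := by
    rw [Finset.sdiff_singleton_eq_erase, Finset.erase_right_comm,
      Finset.insert_erase (mem_erase.2 ⟨hs.1.symm, hr⟩)]
  exact congrArg (fun N => toField (xD r (psiS 0 {r, s})) * toField (xD r (psiS g N))) h1

/-- Sizes 0 and 1 are the terms with genus zero factors in one and two variables that receive
special treatment. When M has one element the term of size 1 is an empty sum. -/
theorem sum_range_prodTerm (g : ℕ) {M : Finset ℕ} (hM : M.Nonempty) (a : ℕ) :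
    ∑ j ∈ range M.card, prodTerm g M a j = prodTerm g M a 0 + prodTerm g M a 1 +
      ∑ k ∈ Icc 3 M.card, prodTerm g M a (k - 1) := by
  have hpos := hM.card_pos
  obtain ⟨m, hm⟩ := Nat.exists_eq_add_of_le' (Nat.one_le_iff_ne_zero.2 hpos.ne')
  rw [hm, Finset.sum_range_succ']
  rcases m with _ | m
  · have h1 : prodTerm g M a 1 = 0 := by
      refine Finset.sum_eq_zero fun r hr => ?_
      have := Finset.card_erase_add_one hr
      rw [Finset.powersetCard_eq_empty.2 (by omega), Finset.sum_empty]
    rw [h1]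
    simp
  · rw [Finset.sum_range_succ', add_comm (prodTerm g M a 0), add_comm, ← add_assoc, add_comm]
    have h2 : ∑ k ∈ Icc 3 (m + 1 + 1), prodTerm g M a (k - 1) =
        ∑ k ∈ range m, prodTerm g M a (k + 1 + 1) := by
      rw [Finset.range_eq_Ico]
      refine Eq.trans ?_ (Finset.sum_Ico_add' (fun k => prodTerm g M a (k - 1)) 0 m 3).symm
      rfl
    rw [h2, add_comm (prodTerm g M a 0)]
    ring

/-- Sorting of the products: genus splittings (0, g) and (g, 0) agree by passing to the complement
and so lose the factor 1/2. Their terms of size 0 pass to the left side, those of size 1 merge with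
the join terms, and the larger ones stay. -/
theorem field_equation {g : ℕ} (hg : 1 ≤ g) {M : Finset ℕ} (hM : M.Nonempty) {t : ℕ} (ht : t ∉ M) :
    toField (∑ i ∈ M, w i * wDeriv i (psiS g M) +
        ((M.card : ℚ) + 2 * ((g : ℚ) - 1)) • psiS g M) =
      toField ((1 / 2 : ℚ) • ∑ r ∈ M, setEq t r (xD r (xD t (psiS (g - 1) (insert t M))))) +
      ∑ r ∈ M, ∑ s ∈ M.erase r, toField (w s) / (1 - toField (w r)) *
        (1 / (toField (w r) - toField (w s))) * toField (xD r (psiS g (M.erase s))) +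
      ∑ k ∈ Icc 3 M.card, prodTerm g M 0 (k - 1) +
      1 / 2 * ∑ k ∈ Icc 1 M.card, ∑ a ∈ Icc 1 (g - 1), prodTerm g M a (k - 1) := by
  have hw : ∑ i ∈ M, w i * wDeriv i (psiS g M) =
      ∑ i ∈ M, xD i (psiS g M) - ∑ i ∈ M, w i * xD i (psiS g M) := by
    rw [← Finset.sum_sub_distrib]
    refine Finset.sum_congr rfl fun i _ => ?_
    rw [w_mul_wDeriv]
    ring
  set c : ℚ := (M.card : ℚ) + 2 * ((g : ℚ) - 1) with hc
  have key := congrArg toField (psiS_cut_join hg hM ht)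
  rw [← hc, map_add toField, map_add toField (_ + _), map_add toField (_ • _), sum_join,
    toField_smul (1 / 2) (∑ r ∈ M, ∑ S ∈ (M.erase r).powerset, _)] at key
  have hprod : toField (∑ r ∈ M, ∑ S ∈ (M.erase r).powerset, ∑ a ∈ antidiagonal g,
        xD r (psiS a.1 (insert r S)) * xD r (psiS a.2 (insert r ((M.erase r) \ S)))) =
      2 * ∑ j ∈ range M.card, prodTerm g M 0 j +
        ∑ a ∈ Icc 1 (g - 1), ∑ j ∈ range M.card, prodTerm g M a j := by
    simp only [← sum_powerset_eq_prodTerm]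
    -- Complementation of S in M∖{r} exchanges the two factors.
    have h1 : ∑ r ∈ M, ∑ S ∈ (M.erase r).powerset, toField (xD r (psiS g (insert r S))) *
        toField (xD r (psiS 0 (insert r ((M.erase r) \ S)))) =
      ∑ r ∈ M, ∑ S ∈ (M.erase r).powerset, toField (xD r (psiS 0 (insert r S))) *
        toField (xD r (psiS (g - 0) (insert r ((M.erase r) \ S)))) := by
      refine Finset.sum_congr rfl fun r _ => ?_
      rw [sum_powerset_compl (M.erase r) fun S T => toField (xD r (psiS g (insert r S))) *
        toField (xD r (psiS 0 (insert r T)))]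
      exact Finset.sum_congr rfl fun S _ => mul_comm _ _
    simp only [map_sum, map_mul]
    simp only [sum_antidiagonal_ends hg, Finset.sum_add_distrib]
    rw [h1, two_mul]
    congr 1
    refine Eq.trans ?_ Finset.sum_comm
    exact Finset.sum_congr rfl fun r _ => Finset.sum_comm
  have hIcc : ∑ k ∈ Icc 1 M.card, ∑ a ∈ Icc 1 (g - 1), prodTerm g M a (k - 1) =
      ∑ a ∈ Icc 1 (g - 1), ∑ j ∈ range M.card, prodTerm g M a j := by
    rw [Finset.sum_comm]
    refine Finset.sum_congr rfl fun a _ => ?_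
    rw [Finset.range_eq_Ico]
    refine (Finset.sum_Ico_add' (fun k => prodTerm g M a (k - 1)) 0 M.card 1).symm.trans ?_
    rfl
  have hpair : ∑ r ∈ M, ∑ s ∈ M.erase r, toField (w s) / (1 - toField (w r)) *
        (1 / (toField (w r) - toField (w s))) * toField (xD r (psiS g (M.erase s))) =
      ∑ r ∈ M, ∑ s ∈ M.erase r, toField (MvPowerSeries.X s) /
        (toField (MvPowerSeries.X r) - toField (MvPowerSeries.X s)) *
        toField (xD r (psiS g (M.erase s))) + prodTerm g M 0 1 := by
    rw [prodTerm_zero_one, ← Finset.sum_add_distrib]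
    refine Finset.sum_congr rfl fun r _ => ?_
    rw [← Finset.sum_add_distrib]
    refine Finset.sum_congr rfl fun s hs => ?_
    rw [← joinS_coefficient (mem_erase.1 hs).1.symm, add_mul]
  have hzero : toField (∑ i ∈ M, w i * xD i (psiS g M)) = prodTerm g M 0 0 := by
    rw [prodTerm_zero_zero, map_sum]
    exact Finset.sum_congr rfl fun r _ => map_mul ..
  rw [hprod, sum_range_prodTerm g hM] at key
  rw [hw, hIcc, hpair, map_add, map_sub, hzero]
  rw [ratCast_half] at key
  have h2 : (2 : SeriesField) ≠ 0 := by
    have : CharZero SeriesField := algebraRat.charZero _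
    norm_num
  field_simp at key ⊢
  linear_combination key

end Field

/-! ### The action of permutations of the variables -/

section Permute

theorem permute_toField (σ : Equiv.Perm ℕ) (F : Series) :
    permute σ (toField F) = toField (MvPowerSeries.rename σ F) :=
  IsFractionRing.ringEquivOfRingEquiv_algebraMap ..

theorem coeff_rename_perm (σ : Equiv.Perm ℕ) (F : Series) (β : ℕ →₀ ℕ) :
    MvPowerSeries.coeff β (MvPowerSeries.rename σ F) =
      MvPowerSeries.coeff (Finsupp.equivMapDomain σ.symm β) F := by
  have h := MvPowerSeries.coeff_embDomain_rename σ.toEmbedding F (Finsupp.equivMapDomain σ.symm β)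
  rw [show Finsupp.embDomain σ.toEmbedding (Finsupp.equivMapDomain σ.symm β) = β from ?_] at h
  · exact h
  · ext i
    obtain ⟨j, rfl⟩ := σ.surjective i
    rw [show σ j = σ.toEmbedding j from rfl, Finsupp.embDomain_apply_self,
      Finsupp.equivMapDomain_apply]
    rfl

theorem rename_xD (σ : Equiv.Perm ℕ) (i : ℕ) (F : Series) :
    MvPowerSeries.rename σ (xD i F) = xD (σ i) (MvPowerSeries.rename σ F) := by
  ext β
  rw [coeff_rename_perm, coeff_xD, coeff_xD, coeff_rename_perm, Finsupp.equivMapDomain_apply,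
    Equiv.symm_symm]

theorem rename_psiS (σ : Equiv.Perm ℕ) (g : ℕ) (S : Finset ℕ) :
    MvPowerSeries.rename σ (psiS g S) = psiS g (S.image σ) := by
  ext β
  rw [coeff_rename_perm, coeff_psiS, coeff_psiS]
  have h1 : (Finsupp.equivMapDomain σ.symm β).support = S ↔ β.support = S.image σ := by
    rw [Finset.ext_iff, Finset.ext_iff]
    simp only [Finsupp.mem_support_iff, Finsupp.equivMapDomain_apply, Equiv.symm_symm]
    constructor
    · intro h i
      obtain ⟨j, rfl⟩ := σ.surjective i
      rw [h j, mem_image]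
      exact ⟨fun hj => ⟨j, hj, rfl⟩, fun ⟨k, hk, hkj⟩ => σ.injective hkj ▸ hk⟩
    · intro h j
      rw [h (σ j), mem_image]
      exact ⟨fun ⟨k, hk, hkj⟩ => σ.injective hkj ▸ hk, fun hj => ⟨j, hj, rfl⟩⟩
  have h2 : S.val.map (Finsupp.equivMapDomain σ.symm β) = (S.image σ).val.map β := by
    rw [Finset.image_val_of_injOn σ.injective.injOn, Multiset.map_map]
    refine Multiset.map_congr rfl fun i _ => ?_
    rw [Finsupp.equivMapDomain_apply, Equiv.symm_symm]
    rfl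
  rw [h2]
  exact if_congr h1 rfl rfl

/-- Uses that w_i is itself x_i ∂/∂x_i of a genus zero series, so the general renaming rules apply.
-/
theorem rename_w (σ : Equiv.Perm ℕ) (i : ℕ) : MvPowerSeries.rename σ (w i) = w (σ i) := by
  rw [← xD_psiS_singleton, rename_xD, rename_psiS, Finset.image_singleton, xD_psiS_singleton]

end Permute

/-! ### The splittings as pairs of an element and a set -/

section Splittings

theorem exists_strictMonoOn (S : Finset ℕ) (a : ℕ) : ∃ φ : ℕ → ℕ,
    StrictMonoOn φ (Set.Ico a (a + S.card)) ∧ (Finset.Ico a (a + S.card)).image φ = S := by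
  have hmem : ∀ j ∈ Set.Ico a (a + S.card), j - a < S.card := fun j hj => by
    have := hj.1
    have := hj.2
    omega
  refine ⟨fun j => if h : j - a < S.card then S.orderEmbOfFin rfl ⟨j - a, h⟩ else 0, ?_, ?_⟩
  · intro i hi j hj hij
    have hi1 := hi.1
    dsimp only
    rw [dif_pos (hmem i hi), dif_pos (hmem j hj)]
    refine (S.orderEmbOfFin rfl).strictMono ?_
    rw [Fin.lt_def]
    dsimp only
    omega
  · ext x
    rw [mem_image]
    constructor
    · rintro ⟨j, hj, rfl⟩
      rw [dif_pos (hmem j (by simpa using hj))]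
      exact Finset.orderEmbOfFin_mem S rfl _
    · intro hx
      have h1 : x ∈ Set.range (S.orderEmbOfFin rfl) := by
        rw [Finset.range_orderEmbOfFin]
        exact hx
      obtain ⟨k, rfl⟩ := h1
      have hk := k.2
      refine ⟨k + a, by rw [Finset.mem_Ico]; omega, ?_⟩
      rw [dif_pos (by omega)]
      congr 1
      exact Fin.ext (Nat.add_sub_cancel _ _)

theorem eqOn_of_strictMonoOn {s : Set ℕ} {φ ψ : ℕ → ℕ} (hφ : StrictMonoOn φ s)
    (hψ : StrictMonoOn ψ s) (h : φ '' s = ψ '' s) : ∀ j ∈ s, φ j = ψ j := by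
  have h1 : StrictMono fun x : s => φ x := fun x y hxy => hφ x.2 y.2 hxy
  have h2 : StrictMono fun x : s => ψ x := fun x y hxy => hψ x.2 y.2 hxy
  have h3 := (h1.range_inj h2).1 (by
    rw [Set.image_eq_range, Set.image_eq_range] at h
    exact h)
  intro j hj
  exact congrFun h3 ⟨j, hj⟩

variable {m i : ℕ}

theorem ofSubtype_mem_Icc (σ : Equiv.Perm (Icc 1 m)) {j : ℕ} (hj : j ∈ Icc 1 m) :
    Equiv.Perm.ofSubtype σ j ∈ Icc 1 m := by
  rw [Equiv.Perm.ofSubtype_apply_of_mem σ hj]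
  exact (σ ⟨j, hj⟩).2

theorem image_ofSubtype (σ : Equiv.Perm (Icc 1 m)) :
    (Icc 1 m).image (Equiv.Perm.ofSubtype σ) = Icc 1 m :=
  Finset.eq_of_subset_of_card_le
    (Finset.image_subset_iff.2 fun _ hj => ofSubtype_mem_Icc σ hj)
    (Finset.card_image_of_injective _ (Equiv.injective _)).ge

/-- The block T of a splitting is determined by R and S, so sums over splittings need only record
the latter two. -/
theorem image_ofSubtype_tail (σ : Equiv.Perm (Icc 1 m)) :
    (Icc (i + 2) m).image (Equiv.Perm.ofSubtype σ) =
      (Icc 1 m).erase (Equiv.Perm.ofSubtype σ 1) \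
        (Icc 2 (i + 1)).image (Equiv.Perm.ofSubtype σ) := by
  have h1 : Icc (i + 2) m = (Icc 1 m).erase 1 \ Icc 2 (i + 1) := by
    ext j
    simp only [mem_Icc, mem_sdiff, mem_erase]
    omega
  rw [h1, Finset.image_sdiff _ _ (Equiv.injective _), Finset.image_erase (Equiv.injective _),
    image_ofSubtype]

theorem mem_splittings {σ : Equiv.Perm (Icc 1 m)} : σ ∈ splittings m i ↔ i + 1 ≤ m ∧
    StrictMonoOn (Equiv.Perm.ofSubtype σ) (Set.Icc 2 (i + 1)) ∧
    StrictMonoOn (Equiv.Perm.ofSubtype σ) (Set.Icc (i + 2) m) := by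
  classical
  rw [splittings, mem_filter, and_iff_right (mem_univ σ)]

/-- A splitting σ is determined by r = σ 1 and the set S of the values on the second block, because
σ is increasing on both blocks; all pairs (r, S) occur. The hypothesis says that the permuted
function depends on σ only through this pair. -/
theorem theta_eq_sum (hi : i + 1 ≤ m) (f : SeriesField) (G : ℕ → Finset ℕ → SeriesField)
    (hf : ∀ σ : Equiv.Perm (Icc 1 m), permute (Equiv.Perm.ofSubtype σ) f =
      G (Equiv.Perm.ofSubtype σ 1) ((Icc 2 (i + 1)).image (Equiv.Perm.ofSubtype σ))) :
    Theta m i f = ∑ r ∈ Icc 1 m, ∑ S ∈ ((Icc 1 m).erase r).powersetCard i, G r S := by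
  rw [Theta, Finset.sum_sigma']
  have h1m : 1 ∈ Icc 1 m := by
    rw [mem_Icc]
    omega
  refine Finset.sum_bij (fun σ _ => ⟨Equiv.Perm.ofSubtype σ 1,
    (Icc 2 (i + 1)).image (Equiv.Perm.ofSubtype σ)⟩) ?_ ?_ ?_ fun σ _ => hf σ
  · intro σ _
    rw [mem_sigma, mem_powersetCard]
    refine ⟨ofSubtype_mem_Icc σ h1m, ?_, ?_⟩
    · intro x hx
      obtain ⟨j, hj, rfl⟩ := mem_image.1 hx
      rw [mem_Icc] at hj
      rw [mem_erase]
      refine ⟨fun h => ?_, ofSubtype_mem_Icc σ (by rw [mem_Icc]; omega)⟩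
      have := (Equiv.injective _) h
      omega
    · dsimp only
      rw [Finset.card_image_of_injective _ (Equiv.injective _), Nat.card_Icc]
      omega
  · intro σ hσ τ hτ h
    obtain ⟨-, hσ1, hσ2⟩ := mem_splittings.1 hσ
    obtain ⟨-, hτ1, hτ2⟩ := mem_splittings.1 hτ
    rw [Sigma.mk.injEq, heq_eq_eq] at h
    have h3 := image_ofSubtype_tail (i := i) σ
    rw [h.1, h.2, ← image_ofSubtype_tail τ] at h3
    have e1 := eqOn_of_strictMonoOn hσ1 hτ1 (by
      rw [← Finset.coe_Icc, ← Finset.coe_image, ← Finset.coe_image, h.2])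
    have e2 := eqOn_of_strictMonoOn hσ2 hτ2 (by
      rw [← Finset.coe_Icc, ← Finset.coe_image, ← Finset.coe_image, h3])
    have h4 : ∀ j ∈ Icc 1 m, Equiv.Perm.ofSubtype σ j = Equiv.Perm.ofSubtype τ j := by
      intro j hj
      rw [mem_Icc] at hj
      by_cases hj1 : j = 1
      · rw [hj1, h.1]
      · by_cases hj2 : j ≤ i + 1
        · exact e1 j ⟨by omega, hj2⟩
        · exact e2 j ⟨by omega, hj.2⟩
    ext j
    have h5 := h4 j j.2
    rwa [Equiv.Perm.ofSubtype_apply_coe, Equiv.Perm.ofSubtype_apply_coe] at h5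
  · rintro ⟨r, S⟩ hrS
    rw [mem_sigma, mem_powersetCard] at hrS
    obtain ⟨hr, hS, hSc⟩ := hrS
    dsimp only at hr hS hSc
    set T := (Icc 1 m).erase r \ S with hT
    have hTc : T.card = m - i - 1 := by
      rw [hT, Finset.card_sdiff_of_subset hS, Finset.card_erase_of_mem hr, hSc, Nat.card_Icc]
      omega
    obtain ⟨φ, hφ, hφS⟩ := exists_strictMonoOn S 2
    obtain ⟨ψ, hψ, hψT⟩ := exists_strictMonoOn T (i + 2)
    rw [hSc] at hφ hφS
    rw [hTc] at hψ hψT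
    have hI1 : Ico 2 (2 + i) = Icc 2 (i + 1) := by
      ext j
      rw [mem_Ico, mem_Icc]
      omega
    have hI2 : Ico (i + 2) (i + 2 + (m - i - 1)) = Icc (i + 2) m := by
      ext j
      rw [mem_Ico, mem_Icc]
      omega
    rw [← Finset.coe_Ico, hI1] at hφ
    rw [← Finset.coe_Ico, hI2] at hψ
    rw [hI1] at hφS
    rw [hI2] at hψT
    -- The splitting with given r and S: 1 is sent to r, and the two blocks are enumerated
    -- increasingly into S and into the remaining elements.
    let F : ℕ → ℕ := fun j => if j = 1 then r else if j ≤ i + 1 then φ j else ψ j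
    have hF1 : F 1 = r := if_pos rfl
    have hFφ : ∀ j ∈ Icc 2 (i + 1), F j = φ j := fun j hj => by
      rw [mem_Icc] at hj
      simp only [F]
      rw [if_neg (by omega), if_pos hj.2]
    have hFψ : ∀ j ∈ Icc (i + 2) m, F j = ψ j := fun j hj => by
      rw [mem_Icc] at hj
      simp only [F]
      rw [if_neg (by omega), if_neg (by omega)]
    have hFS : (Icc 2 (i + 1)).image F = S := by
      rw [← hφS]
      exact Finset.image_congr fun j hj => hFφ j hj
    have hFT : (Icc (i + 2) m).image F = T := by
      rw [← hψT]
      exact Finset.image_congr fun j hj => hFψ j hj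
    have hdec : Icc 1 m = insert 1 (Icc 2 (i + 1) ∪ Icc (i + 2) m) := by
      ext j
      simp only [mem_Icc, mem_insert, mem_union]
      omega
    have hFI : (Icc 1 m).image F = Icc 1 m := by
      conv_lhs => rw [hdec]
      rw [Finset.image_insert, Finset.image_union, hFS, hFT, hF1, hT,
        Finset.union_sdiff_of_subset hS, Finset.insert_erase hr]
    have hFm : ∀ j ∈ Icc 1 m, F j ∈ Icc 1 m := fun j hj => by
      have h := mem_image_of_mem F hj
      rwa [hFI] at h
    have hsurj : Function.Surjective fun j : Icc 1 m => (⟨F j, hFm j j.2⟩ : Icc 1 m) := by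
      rintro ⟨x, hx⟩
      obtain ⟨j, hj, hjx⟩ := mem_image.1 (hFI.symm ▸ hx : x ∈ (Icc 1 m).image F)
      exact ⟨⟨j, hj⟩, Subtype.ext hjx⟩
    let σ : Equiv.Perm (Icc 1 m) :=
      Equiv.ofBijective _ (Finite.injective_iff_bijective.1 (Finite.injective_iff_surjective.2 hsurj))
    have hσ : ∀ j ∈ Icc 1 m, Equiv.Perm.ofSubtype σ j = F j := fun j hj => by
      rw [Equiv.Perm.ofSubtype_apply_of_mem σ hj]
      rfl
    have hσφ : ∀ j ∈ Icc 2 (i + 1), Equiv.Perm.ofSubtype σ j = φ j := fun j hj => by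
      rw [hσ j _, hFφ j hj]
      rw [mem_Icc] at hj ⊢
      omega
    have hσψ : ∀ j ∈ Icc (i + 2) m, Equiv.Perm.ofSubtype σ j = ψ j := fun j hj => by
      rw [hσ j _, hFψ j hj]
      rw [mem_Icc] at hj ⊢
      omega
    refine ⟨σ, ?_, ?_⟩
    · refine mem_splittings.2 ⟨hi, ?_, ?_⟩
      · rw [← Finset.coe_Icc]
        exact hφ.congr fun j hj => (hσφ j hj).symm
      · rw [← Finset.coe_Icc]
        exact hψ.congr fun j hj => (hσψ j hj).symm
    · rw [Sigma.mk.injEq, heq_eq_eq]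
      refine ⟨by rw [hσ 1 h1m, hF1], ?_⟩
      rw [← hφS]
      exact Finset.image_congr fun j hj => hσφ j hj

theorem theta_of_lt (hi : m < i + 1) (f : SeriesField) : Theta m i f = 0 := by
  refine Finset.sum_eq_zero fun σ hσ => ?_
  have h := (mem_splittings.1 hσ).1
  omega

end Splittings

/-! ### The genus zero series -/

theorem coeff_prod_wFrac (S : Finset ℕ) (β : ℕ →₀ ℕ) :
    MvPowerSeries.coeff β (∏ i ∈ S, wFrac i) =
      if β.support = S then ∏ i ∈ S, treeA (β i) else 0 := by
  induction S using Finset.induction_on generalizing β with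
  | empty =>
    rw [Finset.prod_empty, Finset.prod_empty, MvPowerSeries.coeff_one]
    simp only [Finsupp.support_eq_empty]
  | insert r S hr ih =>
    rw [Finset.prod_insert hr, wFrac, coeff_subst_X_mul, Finset.sum_eq_single (β r, 0)]
    · dsimp only
      rw [ih, coeff_treeW, Finset.prod_insert hr]
      have h1 : ∏ i ∈ S, treeA (β.update r 0 i) = ∏ i ∈ S, treeA (β i) :=
        Finset.prod_congr rfl fun i hi => by
          rw [Finsupp.update_apply, if_neg (ne_of_mem_of_not_mem hi hr)]
      have h2 : (β.update r 0).support = β.support.erase r := Finsupp.support_update_zero _ _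
      rw [h1, h2]
      by_cases hβ : β r = 0
      · rw [if_pos hβ, zero_mul, if_neg]
        intro h
        have h3 : r ∈ β.support := h ▸ Finset.mem_insert_self r S
        exact Finsupp.mem_support_iff.1 h3 hβ
      · rw [if_neg hβ]
        have h3 : β.support.erase r = S ↔ β.support = insert r S := by
          constructor
          · rintro rfl
            exact (Finset.insert_erase (Finsupp.mem_support_iff.2 hβ)).symm
          · intro h
            rw [h, Finset.erase_insert hr]
        rw [mul_ite, mul_zero]
        exact if_congr h3 rfl rfl
    · rintro ⟨p, q⟩ hp hne
      rw [HasAntidiagonal.mem_antidiagonal] at hp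
      dsimp only at hp ⊢
      rw [ih, if_neg, mul_zero]
      intro h
      apply hne
      have h3 : r ∉ (β.update r q).support := by rwa [h]
      rw [Finsupp.mem_support_iff, not_not, Finsupp.update_apply, if_pos rfl] at h3
      rw [Prod.mk.injEq]
      omega
    · intro h
      exact absurd (HasAntidiagonal.mem_antidiagonal.2 (Nat.add_zero _)) h

theorem V_eq_prod_wFrac (m : ℕ) : V m = ∏ i ∈ Icc 1 m, wFrac i :=
  Finset.prod_congr rfl fun i _ => by rw [one_sub_w_inv, w_mul_one_add_wFrac]

theorem coeff_euler (m : ℕ) (F : Series) (β : ℕ →₀ ℕ) :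
    MvPowerSeries.coeff β (euler m F) = (∑ i ∈ Icc 1 m, (β i : ℚ)) * MvPowerSeries.coeff β F := by
  rw [euler, map_sum, Finset.sum_mul]
  exact Finset.sum_congr rfl fun i _ => coeff_xD i F β

theorem coeff_euler_iterate (m k : ℕ) (F : Series) (β : ℕ →₀ ℕ) :
    MvPowerSeries.coeff β ((euler m)^[k] F) =
      (∑ i ∈ Icc 1 m, (β i : ℚ)) ^ k * MvPowerSeries.coeff β F := by
  induction k with
  | zero => simp
  | succ k ih => rw [Function.iterate_succ_apply', coeff_euler, ih, pow_succ]; ring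

theorem coeff_psiS_zero {S : Finset ℕ} (hS : S.Nonempty) (β : ℕ →₀ ℕ) :
    MvPowerSeries.coeff β (psiS 0 S) = if β.support = S then
      (∑ i ∈ S, (β i : ℚ)) ^ ((S.card : ℤ) - 3) * ∏ i ∈ S, treeA (β i) else 0 := by
  rw [coeff_psiS]
  refine ite_congr rfl (fun h => ?_) fun _ => rfl
  rw [hurG_zero, genusZero_map]
  · intro h0
    obtain ⟨i, hi, h1⟩ := Multiset.mem_map.1 h0
    rw [Finset.mem_val, ← h, Finsupp.mem_support_iff] at hi
    exact hi h1
  · rw [Ne, Multiset.map_eq_zero, Finset.val_eq_zero]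
    exact hS.ne_empty

theorem sum_ne_zero_of_support {S : Finset ℕ} (hS : S.Nonempty) {β : ℕ →₀ ℕ}
    (h : β.support = S) : (∑ i ∈ S, (β i : ℚ)) ≠ 0 := by
  refine (Finset.sum_pos (fun i hi => ?_) hS).ne'
  rw [← h, Finsupp.mem_support_iff] at hi
  exact_mod_cast Nat.pos_of_ne_zero hi

/-- The Euler operator multiplies a monomial by its total degree in the variables, which is the n in
Hurwitz's factor n^(m-3). -/
theorem psiS_zero_eq_iterate {m : ℕ} (hm : 3 ≤ m) :
    psiS 0 (Icc 1 m) = (euler m)^[m - 3] (V m) := by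
  have hne : (Icc 1 m).Nonempty := Finset.nonempty_Icc.2 (by omega)
  ext β
  rw [coeff_euler_iterate, V_eq_prod_wFrac, coeff_prod_wFrac, coeff_psiS_zero hne, Nat.card_Icc,
    mul_ite, mul_zero]
  refine ite_congr rfl (fun _ => ?_) fun _ => rfl
  rw [← zpow_natCast]
  congr 2
  omega

/-- For m = 1, 2 the exponent m - 3 is negative; n is nonzero on the support of the series, so
applying the Euler operator 3 - m times cancels the power. -/
theorem iterate_psiS_zero {m k : ℕ} (hm : 1 ≤ m) (hk : m + k = 3) :
    (euler m)^[k] (psiS 0 (Icc 1 m)) = V m := by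
  have hne : (Icc 1 m).Nonempty := Finset.nonempty_Icc.2 hm
  ext β
  rw [coeff_euler_iterate, V_eq_prod_wFrac, coeff_prod_wFrac, coeff_psiS_zero hne, Nat.card_Icc,
    mul_ite, mul_zero]
  refine ite_congr rfl (fun h => ?_) fun _ => rfl
  rw [← mul_assoc, ← zpow_natCast, ← zpow_add₀ (sum_ne_zero_of_support hne h),
    show ((k : ℕ) : ℤ) + (((m + 1 - 1 : ℕ) : ℤ) - 3) = 0 by omega, zpow_zero, one_mul]

theorem constantCoeff_psiS {g : ℕ} {S : Finset ℕ} (hS : S.Nonempty) :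
    MvPowerSeries.constantCoeff (psiS g S) = 0 := by
  rw [← MvPowerSeries.coeff_zero_eq_constantCoeff_apply, coeff_psiS, if_neg]
  rw [Finsupp.support_zero]
  exact hS.ne_empty.symm

/-! ### The four terms -/

theorem psiStd_eq (g m : ℕ) : PsiStd g m = psiS g (Icc 1 m) := by
  rw [PsiStd, psiAt_eq fun a b h => Fin.ext (Nat.succ_injective h)]
  congr 1
  ext j
  simp only [mem_image, mem_univ, true_and, mem_Icc]
  constructor
  · rintro ⟨a, rfl⟩
    omega
  · intro h
    exact ⟨⟨j - 1, by omega⟩, by dsimp only; omega⟩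

theorem psiSkip_eq (g : ℕ) {m k : ℕ} (hk : 1 ≤ k) :
    PsiSkip g (m + 1) k = psiS g (insert 1 (Icc (k + 1) (k + m))) := by
  rw [PsiSkip, psiAt_eq]
  · congr 1
    ext j
    simp only [mem_image, mem_univ, true_and, mem_Icc, mem_insert]
    constructor
    · rintro ⟨a, rfl⟩
      have := a.2
      split_ifs <;> omega
    · rintro (rfl | h)
      · exact ⟨0, if_pos rfl⟩
      · refine ⟨⟨j - k, by omega⟩, ?_⟩
        dsimp only
        rw [if_neg (by omega)]
        omega
  · intro a b h
    dsimp only at h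
    apply Fin.ext
    split_ifs at h <;> omega

theorem T₁_eq (g m : ℕ) : T₁ g m = (1 / 2 : ℚ) • ∑ r ∈ Icc 1 m,
    setEq (m + 1) r (xD r (xD (m + 1) (psiS (g - 1) (insert (m + 1) (Icc 1 m))))) := by
  have h : Icc 1 (m + 1) = insert (m + 1) (Icc 1 m) := by
    ext j
    simp only [mem_insert, mem_Icc]
    omega
  rw [T₁, psiStd_eq, h]

/-- For i = 1 the set S is a singleton {s}, and the series in x_1, x_3, …, x_m omits exactly the
variable that is permuted to x_s. For m = 1 both sides are empty sums. -/
theorem T₂_eq (g m : ℕ) : T₂ g m = ∑ r ∈ Icc 1 m, ∑ s ∈ (Icc 1 m).erase r,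
    toField (w s) / (1 - toField (w r)) * (1 / (toField (w r) - toField (w s))) *
      toField (xD r (psiS g ((Icc 1 m).erase s))) := by
  by_cases hm : 1 + 1 ≤ m
  · obtain ⟨n, rfl⟩ := Nat.exists_eq_add_of_le' hm
    have hI : insert 1 (Icc (2 + 1) (2 + n)) = (Icc 1 (n + 2)).erase 2 := by
      ext j
      simp only [mem_insert, mem_Icc, mem_erase]
      omega
    rw [T₂, show n + (1 + 1) - 1 = n + 1 by omega, psiSkip_eq g (by omega), hI,
      theta_eq_sum hm _ fun r S => ∑ s ∈ S,
        toField (w s) / (1 - toField (w r)) * (1 / (toField (w r) - toField (w s))) *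
          toField (xD r (psiS g ((Icc 1 (n + 2)).erase s)))]
    · refine Finset.sum_congr rfl fun r _ => ?_
      rw [Finset.powersetCard_one, Finset.sum_map]
      exact Finset.sum_congr rfl fun s _ => Finset.sum_singleton _ _
    · intro σ
      rw [show Icc 2 (1 + 1) = {2} from Finset.Icc_self 2, Finset.image_singleton,
        Finset.sum_singleton, map_mul, map_mul, map_div₀, map_div₀, map_sub, map_sub, map_one,
        permute_toField, permute_toField, permute_toField, rename_w, rename_w, rename_xD,
        rename_psiS, Finset.image_erase (Equiv.injective _), image_ofSubtype]
  · rw [T₂, theta_of_lt (by omega)]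
    refine (Finset.sum_eq_zero fun r hr => Finset.sum_eq_zero fun s hs => ?_).symm
    rw [mem_erase, mem_Icc] at hs
    rw [mem_Icc] at hr
    omega

/-- The two series share the variable x_r; their other variables form S, of size k - 1, and its
complement. -/
theorem theta_psi_mul_psi (g a : ℕ) {m k : ℕ} (hk : 1 ≤ k) (hkm : k ≤ m) :
    Theta m (k - 1) (toField (xD 1 (PsiStd a k)) *
      toField (xD 1 (PsiSkip (g - a) (m - k + 1) k))) = prodTerm g (Icc 1 m) a (k - 1) := by
  obtain ⟨i, rfl⟩ := Nat.exists_eq_add_of_le' hk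
  obtain ⟨n, rfl⟩ := Nat.exists_eq_add_of_le hkm
  have hI : Icc 1 (i + 1) = insert 1 (Icc 2 (i + 1)) := by
    ext j
    simp only [mem_insert, mem_Icc]
    omega
  rw [Nat.add_sub_cancel_left, Nat.add_sub_cancel, psiStd_eq, hI, psiSkip_eq _ hk, prodTerm]
  refine theta_eq_sum (by omega) _ (fun r S => _) fun σ => ?_
  rw [map_mul, permute_toField, permute_toField, rename_xD, rename_xD, rename_psiS, rename_psiS,
    Finset.image_insert, Finset.image_insert, image_ofSubtype_tail]

theorem T₃_eq (g m : ℕ) : T₃ g m = ∑ k ∈ Icc 3 m, prodTerm g (Icc 1 m) 0 (k - 1) := by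
  refine Finset.sum_congr rfl fun k hk => ?_
  rw [mem_Icc] at hk
  exact theta_psi_mul_psi g 0 (by omega) hk.2

theorem T₄_eq (g m : ℕ) : T₄ g m = 1 / 2 * ∑ k ∈ Icc 1 m, ∑ a ∈ Icc 1 (g - 1),
    prodTerm g (Icc 1 m) a (k - 1) := by
  rw [T₄]
  congr 1
  refine Finset.sum_congr rfl fun k hk => Finset.sum_congr rfl fun a _ => ?_
  rw [mem_Icc] at hk
  exact theta_psi_mul_psi g a hk.1 hk.2

end Hurwitz

end

/-! ### The recursion in positive genus and its initial conditions -/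

theorem theorem4p4 :
    (∀ g m : ℕ, 1 ≤ g → 1 ≤ m →
      Hurwitz.toField (∑ i ∈ Finset.Icc 1 m, Hurwitz.w i * Hurwitz.wDeriv i (Hurwitz.PsiStd g m) +
          ((m : ℚ) + 2 * ((g : ℚ) - 1)) • Hurwitz.PsiStd g m) =
        Hurwitz.toField (Hurwitz.T₁ g m) + Hurwitz.T₂ g m + Hurwitz.T₃ g m + Hurwitz.T₄ g m) ∧
    (∀ m : ℕ, 3 ≤ m → Hurwitz.PsiStd 0 m = (Hurwitz.euler m)^[m - 3] (Hurwitz.V m)) ∧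
    (Hurwitz.euler 2 (Hurwitz.PsiStd 0 2) = Hurwitz.V 2 ∧
      MvPowerSeries.constantCoeff (Hurwitz.PsiStd 0 2) = 0) ∧
    (Hurwitz.euler 1 (Hurwitz.euler 1 (Hurwitz.PsiStd 0 1)) = Hurwitz.V 1 ∧
      MvPowerSeries.constantCoeff (Hurwitz.PsiStd 0 1) = 0) ∧
    (∀ g : ℕ, 1 ≤ g → Hurwitz.PsiStd g 0 = 0) := by
  refine ⟨fun g m hg hm => ?_, fun m hm => ?_, ⟨?_, ?_⟩, ⟨?_, ?_⟩, fun g _ => ?_⟩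
  · have h := Hurwitz.field_equation hg (M := Finset.Icc 1 m) (Finset.nonempty_Icc.2 hm)
      (t := m + 1) (by rw [Finset.mem_Icc]; omega)
    rw [Nat.card_Icc, Nat.add_sub_cancel] at h
    rw [Hurwitz.psiStd_eq, h, Hurwitz.T₁_eq, Hurwitz.T₂_eq, Hurwitz.T₃_eq, Hurwitz.T₄_eq]
  · rw [Hurwitz.psiStd_eq, Hurwitz.psiS_zero_eq_iterate hm]
  · rw [Hurwitz.psiStd_eq]
    exact Hurwitz.iterate_psiS_zero (m := 2) (k := 1) (by norm_num) (by norm_num)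
  · rw [Hurwitz.psiStd_eq]
    exact Hurwitz.constantCoeff_psiS (Finset.nonempty_Icc.2 (by norm_num))
  · rw [Hurwitz.psiStd_eq]
    exact Hurwitz.iterate_psiS_zero (m := 1) (k := 2) (by norm_num) (by norm_num)
  · rw [Hurwitz.psiStd_eq]
    exact Hurwitz.constantCoeff_psiS (Finset.nonempty_Icc.2 (by norm_num))
  · rw [Hurwitz.psiStd_eq]
    exact Hurwitz.psiS_empty g
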